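/- **Setting.** Let $\mathcal X,\mathcal Y$ be nonempty finite sets, $\nu$ a probability on $\mathcal X$, $\xi$ a probability on $\mathcal Y\times\mathcal Y$, and $\bar\xi(y,y')=\frac12[\xi(y,y')+\xi(y',y)]$. Let $\mathcal G_*$ be the space of isomorphism classes of connected locally finite rooted graphs $(G,o)$ with at most countably many vertices, a mark $x_v\in\mathcal X$ at each vertex, and marks $y_{(u,v)},y_{(v,u)}\in\mathcal Y$ on each edge $\{u,v\}$ ($y_{(u,v)}$ at the end $u$), with the local topology and its Borel $\sigma$-field. Write $\deg$ for the root degree, $N_o$ for the set of neighbours of the root, and $\tau_h$ for the subgraph induced by the vertices at distance at most $h$ from the root. For an edge $\{u,v\}$ let $\tau(v\setminus u)_h$ be the pair formed by the component of $v$ in $\tau\setminus\{u,v\}$, rooted at $v$ and truncated at depth $h$, and the mark $y_{(v,u)}$. For a probability $\rho$ on $\mathcal G_*$ let $\rho_o$ be the law of the root mark and $\rho_h$ the law of $\tau_h$. For $\beta>0$ let $\mathcal P_u^\beta$ be the set of unimodular $\rho$ (i.e. $\mathbb E_\rho\sum_v f(G,o,v)=\mathbb E_\rho\sum_v f(G,v,o)$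 for all measurable $f\ge 0$ on doubly rooted marked graphs) that are carried by trees and satisfy $\mathbb E_\rho[\deg]=\beta$. $H(\cdot)$ is Shannon entropy and $H(\cdot\|\cdot)$ relative entropy; $0\log0=0$. **Microstate entropy.** For $h\ge1$ let $E_h(t,t')(\tau)=|\{v\in N_o:\tau(v\setminus o)_{h-1}=t,\ \tau(o\setminus v)_{h-1}=t'\}|$ and, with $\beta=\mathbb E_{\mu}[\deg]\in(0,\infty)$, $\pi_{\mu}(t,t')=\frac1\beta\mathbb E_{\mu}[E_h(t,t')]$ for a law $\mu$ on rooted marked graphs of depth at most $h$. The size-biased marginal $\bar\mu^{1,o}$ is the joint law of $(\tau(1\setminus o)_{h-1},\tau(o\setminus1)_{h-1})$ when $\tau$ has law $\bar\mu$, $d\bar\mu/d\mu=\deg/\beta$, and $1$ is a uniformly chosen neighbour of the root; $\bar\mu^{1}$ and $\bar\mu^{o}$ are its marginals and $\bar\mu^{1|o}$ is the conditional law of the first coordinate given the second. $\mu$ is admissible if $\bar\mu^{1,o}$ is symmetric. Put $\vec\beta_\rho(y,y')=\beta\sum_{x,x'}\pi_{\rho_1}((x,y),(x',y'))$, $s(b)=\frac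 b2-\frac b2\log b$, $\vec s(\vec\beta_\rho)=\sum_{y,y'}s(\vec\beta_\rho(y,y'))$, and $$J_h(\mu)=-s(\beta)+H(\mu)-\tfrac\beta2H(\pi_{\mu})-\sum_{t,t'}\mathbb E_{\mu}[\log E_h(t,t')!]$$ if $\mu$ is admissible and carried by trees of depth at most $h$ with $\mathbb E_\mu[\deg]=\beta$ and $\mathbb E_{\mu}[\deg\log\deg]<\infty$; $J_h(\mu)=-\infty$ otherwise. Then $\Sigma_{\vec\beta_\rho,\rho_o}(\rho)=\lim_{h\to\infty}J_h(\rho_h)$ if $\rho\in\mathcal P_u^\beta$, and $-\infty$ otherwise. **Rate function.** Let $\eta_1^\beta$ be the law of the first neighbourhood of the root in the Poisson($\beta$) Galton–Watson tree with i.i.d. vertex marks of law $\nu$ and i.i.d. pairs of edge marks of law $\bar\xi$. For $\mu=\rho_1\ll\eta_1=\eta_1^\beta$ put $$\frac{d\check\rho_1}{d\eta_1}(\tau)=\prod_{v\in N_o}\frac{d\bar\mu^{1}}{d\bar\eta_1^{1}}(x_v,y_{(v,o)}),\qquad \frac{d\hat\rho_1}{d\eta_1}(\tau)=\prod_{v\in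 N_o}\frac{d\bar\mu^{1|o}}{d\bar\eta_1^{1|o}}(x_v,y_{(v,o)}\mid x_o,y_{(o,v)}),$$ where $\bar\mu^{1|o}(\cdot\mid t')=\bar\eta_1^{1|o}(\cdot\mid t')$ for $t'$ with $\bar\mu^o(t')=0$. For $h\ge2$ let $\check\rho_h=\rho_h^*$ be the one-step unimodular extension of $\rho_{h-1}$: sample $\tau$ from $\rho_{h-1}$ and, independently for $v\in N_o$, replace $\tau(v\setminus o)_{h-2}$ by a sample from the conditional law of $\tau'(o\setminus1)_{h-1}$ given $\tau'(o\setminus1)_{h-2}=\tau(v\setminus o)_{h-2}$ and $\tau'(1\setminus o)_{h-2}=\tau(o\setminus v)_{h-2}$, where $\tau'$ has the size-biased law of $\rho_{h-1}$ and $1$ is a uniformly chosen neighbour of its root; and let $$\frac{d\hat\rho_h}{d\rho_h^*}(\tau)=\prod_{v\in N_o}\frac{d\bar\rho_h^{1,o}}{d\overline{\rho_h^*}^{1,o}}(\tau(v\setminus o)_{h-1},\tau(o\setminus v)_{h-1}).$$ For $\beta>0$, $$\mathscr I_{\beta,\eta^\beta}(\rho)=\tfrac12\sum_{h\ge1}\big[H(\rho_h\|\check\rho_h)+H(\rho_h\|\hat\rho_h)\big]\quad\text{if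 }\rho\in\mathcal P_u^\beta\text{ and }\rho_1\ll\eta_1^\beta,\qquad \mathscr I_{\beta,\eta^\beta}(\rho)=\infty\text{ otherwise.}$$ **Corollary.** Let $\rho$ be a probability on $\mathcal G_*$ with $0<\beta:=\mathbb E_\rho[\deg]<\infty$. If $\rho\in\mathcal P_u^\beta$ and $\mathbb E_\rho[\deg\log\deg]<\infty$, assume that the term $H(\rho_h)-\frac\beta2H(\pi_{\rho_h})$ in $J_h(\rho_h)$ is not of the form $\infty-\infty$ for any $h\ge1$. Put $$A_\rho=H(\rho_o)+H(\rho_o\|\nu)+\tfrac\beta2H\Big(\tfrac{\vec\beta_\rho}{\beta}\Big\|\bar\xi\Big)+\vec s(\vec\beta_\rho).$$ 1. If $\rho\in\mathcal P_u^\beta$, the limit that defines $\Sigma_{\vec\beta_\rho,\rho_o}(\rho)$ exists in $[-\infty,\infty]$. 2. If $\rho_o\ll\nu$ and $\vec\beta_\rho/\beta\ll\bar\xi$ (in particular, if $\nu$ and $\bar\xi$ have full support), then $A_\rho<\infty$ and $$\Sigma_{\vec\beta_\rho,\rho_o}(\rho)=H(\rho_o)+H(\rho_o\|\nu)+\tfrac\beta2H\Big(\tfrac{\vec\beta_\rho}{\beta}\Big\|\bar\xi\Big)+\vec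 s(\vec\beta_\rho)-\mathscr I_{\beta,\eta^\beta}(\rho).$$ 3. Without the assumption of 2., $\Sigma_{\vec\beta_\rho,\rho_o}(\rho)<\infty$ and $\mathscr I_{\beta,\eta^\beta}(\rho)=A_\rho-\Sigma_{\vec\beta_\rho,\rho_o}(\rho)$. -/

import Mathlib

open MeasureTheory Filter Topology InformationTheory
open scoped ENNReal NNReal

noncomputable section

namespace MarkedTree

universe u v

/-! ### Rooted marked graphs and their isomorphism classes -/

/-- A representative of a rooted marked graph with vertex marks in `X` and edge marks in `Y`.
The vertices are natural numbers, every vertex has finite degree, and the object that is represented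
is the connected component of `root`; what happens outside of this component is ignored by the
isomorphism relation below. `emark u v` is the mark `y_(u,v)` which the edge `{u, v}` carries at its
end `u`; its values at non-adjacent pairs are ignored as well. -/
structure RawGraph (X : Type u) (Y : Type v) where
  graph : SimpleGraph ℕ
  locallyFinite : ∀ a, (graph.neighborSet a).Finite
  root : ℕ
  vmark : ℕ → X
  emark : ℕ → ℕ → Y

variable {X : Type u} {Y : Type v}

namespace RawGraph

/-- The vertex set of the connected component of the root. -/
def comp (G : RawGraph X Y) : Set ℕ := {a | G.graph.Reachable G.root a}

lemma root_mem_comp (G : RawGraph X Y) : G.root ∈ G.comp := SimpleGraph.Reachable.refl _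

/-- Isomorphisms of the represented connected rooted marked graphs. -/
structure Iso (G H : RawGraph X Y) where
  toEquiv : G.comp ≃ H.comp
  map_root : (toEquiv ⟨G.root, G.root_mem_comp⟩ : ℕ) = H.root
  map_adj : ∀ a b : G.comp, H.graph.Adj (toEquiv a) (toEquiv b) ↔ G.graph.Adj a b
  map_vmark : ∀ a : G.comp, H.vmark (toEquiv a) = G.vmark a
  map_emark : ∀ a b : G.comp, G.graph.Adj a b →
    H.emark (toEquiv a) (toEquiv b) = G.emark a b

/-- The identity isomorphism. -/
def Iso.refl (G : RawGraph X Y) : Iso G G :=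
  ⟨Equiv.refl _, rfl, fun _ _ => Iff.rfl, fun _ => rfl, fun _ _ _ => rfl⟩

/-- The inverse isomorphism. -/
def Iso.symm {G H : RawGraph X Y} (φ : Iso G H) : Iso H G where
  toEquiv := φ.toEquiv.symm
  map_root := by
    have h : φ.toEquiv ⟨G.root, G.root_mem_comp⟩ = ⟨H.root, H.root_mem_comp⟩ :=
      Subtype.ext φ.map_root
    rw [← h, Equiv.symm_apply_apply]
  map_adj a b := by
    have := φ.map_adj (φ.toEquiv.symm a) (φ.toEquiv.symm b)
    simpa using this.symm
  map_vmark a := by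
    have := φ.map_vmark (φ.toEquiv.symm a)
    simpa using this.symm
  map_emark a b hab := by
    have h1 := φ.map_adj (φ.toEquiv.symm a) (φ.toEquiv.symm b)
    have h2 := φ.map_emark (φ.toEquiv.symm a) (φ.toEquiv.symm b)
    simp only [Equiv.apply_symm_apply] at h1 h2
    exact (h2 (h1.1 hab)).symm

/-- Composition of isomorphisms. -/
def Iso.trans {G H K : RawGraph X Y} (φ : Iso G H) (ψ : Iso H K) : Iso G K where
  toEquiv := φ.toEquiv.trans ψ.toEquiv
  map_root := by
    have h : φ.toEquiv ⟨G.root, G.root_mem_comp⟩ = ⟨H.root, H.root_mem_comp⟩ :=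
      Subtype.ext φ.map_root
    rw [Equiv.trans_apply, h]
    exact ψ.map_root
  map_adj a b := (ψ.map_adj _ _).trans (φ.map_adj a b)
  map_vmark a := (ψ.map_vmark _).trans (φ.map_vmark a)
  map_emark a b hab := (ψ.map_emark _ _ ((φ.map_adj a b).2 hab)).trans (φ.map_emark a b hab)

/-- `(G, o)_h`: the subgraph induced by the vertices at distance at most `h` from the root. -/
def trunc (h : ℕ) (G : RawGraph X Y) : RawGraph X Y where
  graph :=
    { Adj := fun a b => G.graph.Adj a b ∧
        (a ∈ G.comp ∧ G.graph.dist G.root a ≤ h) ∧ (b ∈ G.comp ∧ G.graph.dist G.root b ≤ h)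
      symm := ⟨fun _ _ hab => ⟨hab.1.symm, hab.2.2, hab.2.1⟩⟩
      loopless := ⟨fun a ha => G.graph.loopless.irrefl a ha.1⟩ }
  locallyFinite a := (G.locallyFinite a).subset fun _ hb => hb.1
  root := G.root
  vmark := G.vmark
  emark := G.emark

/-- The connected component of `a` in `G` minus the edge `{a, b}`, rooted at `a`. -/
def cut (G : RawGraph X Y) (a b : ℕ) : RawGraph X Y where
  graph := G.graph.deleteEdges {s(a, b)}
  locallyFinite c := (G.locallyFinite c).subset fun d hd => by
    have hd' : (G.graph.deleteEdges {s(a, b)}).Adj c d := hd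
    rw [SimpleGraph.deleteEdges_adj] at hd'
    exact hd'.1
  root := a
  vmark := G.vmark
  emark := G.emark

/-- The same graph with another root. -/
def reroot (G : RawGraph X Y) (a : ℕ) : RawGraph X Y := { G with root := a }

/-- The set `N_o` of neighbours of the root. -/
def nbrs (G : RawGraph X Y) : Finset ℕ := (G.locallyFinite G.root).toFinset

/-- The represented graph is a tree. -/
def IsTree (G : RawGraph X Y) : Prop := (G.graph.induce G.comp).IsAcyclic

/-- The graph with a single vertex, whose mark is `x`. -/
def point [Nonempty Y] (x : X) : RawGraph X Y where
  graph := ⊥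
  locallyFinite a := by simp [SimpleGraph.neighborSet]
  root := 0
  vmark _ := x
  emark _ _ := Classical.arbitrary Y

/-- The graph obtained from a root (the vertex `0`, with mark `x`) and rooted graphs `c i`, `i ∈ S`,
by joining the root to the root `v` of `c i` with an edge that carries the mark `yc i` at `v` and
the mark `yo i` at the new root. The vertex `m` of `c i` becomes the vertex `Nat.pair i m + 1`. -/
def join (x : X) (S : Finset ℕ) (c : ℕ → RawGraph X Y) (yc yo : ℕ → Y) : RawGraph X Y where
  graph := SimpleGraph.fromRel fun a b => ∃ i ∈ S,
    (a = 0 ∧ b = Nat.pair i (c i).root + 1) ∨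
    ∃ m n, (c i).graph.Adj m n ∧ a = Nat.pair i m + 1 ∧ b = Nat.pair i n + 1
  locallyFinite a := by
    let j := (Nat.unpair (a - 1)).1
    let m₀ := (Nat.unpair (a - 1)).2
    have hfin : (({0} : Set ℕ) ∪ ((fun i => Nat.pair i (c i).root + 1) '' (S : Set ℕ)) ∪
        ((fun n => Nat.pair j n + 1) '' ((c j).graph.neighborSet m₀))).Finite :=
      ((Set.finite_singleton 0).union (S.finite_toSet.image _)).union
        (((c j).locallyFinite m₀).image _)
    refine hfin.subset ?_
    intro b hb
    rw [SimpleGraph.mem_neighborSet, SimpleGraph.fromRel_adj] at hb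
    rcases hb.2 with ⟨i, hi, ⟨-, h⟩ | ⟨m, n, hmn, rfl, rfl⟩⟩ |
        ⟨i, hi, ⟨h, -⟩ | ⟨m, n, hmn, rfl, rfl⟩⟩
    · exact Or.inl (Or.inr ⟨i, hi, h.symm⟩)
    · refine Or.inr ⟨n, ?_, ?_⟩ <;> simp [j, m₀, hmn]
    · exact Or.inl (Or.inl h)
    · refine Or.inr ⟨m, ?_, ?_⟩ <;> simp [j, m₀, hmn.symm]
  root := 0
  vmark
    | 0 => x
    | a + 1 => (c (Nat.unpair a).1).vmark (Nat.unpair a).2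
  emark
    | 0, 0 => yo 0
    | 0, b + 1 => yo (Nat.unpair b).1
    | a + 1, 0 => yc (Nat.unpair a).1
    | a + 1, b + 1 => (c (Nat.unpair a).1).emark (Nat.unpair a).2 (Nat.unpair b).2

end RawGraph

/-- Being isomorphic as rooted marked graphs. -/
instance isoSetoid (X : Type u) (Y : Type v) : Setoid (RawGraph X Y) where
  r G H := Nonempty (RawGraph.Iso G H)
  iseqv := ⟨fun G => ⟨RawGraph.Iso.refl G⟩, fun ⟨φ⟩ => ⟨φ.symm⟩, fun ⟨φ⟩ ⟨ψ⟩ => ⟨φ.trans ψ⟩⟩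

/-- The space of unlabeled (connected, locally finite) rooted marked graphs. All functions on this
space below are given by their values at some representative; these do not depend on its choice. -/
def MGraph (X : Type u) (Y : Type v) : Type (max u v) := Quotient (isoSetoid X Y)

/-- The isomorphism class of a rooted marked graph. -/
def MGraph.mk (G : RawGraph X Y) : MGraph X Y := Quotient.mk _ G

/-- A representative of an isomorphism class. -/
def MGraph.rep (τ : MGraph X Y) : RawGraph X Y := Quotient.out τ

/-- The truncation at depth `h`. -/
def trunc (h : ℕ) (τ : MGraph X Y) : MGraph X Y := MGraph.mk (τ.rep.trunc h)

/-- The local topology: it is generated by the sets of all graphs with a given `h`-neighbourhood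
of the root (the mark spaces are finite, hence discrete). -/
instance : TopologicalSpace (MGraph X Y) :=
  TopologicalSpace.generateFrom {U | ∃ (h : ℕ) (c : MGraph X Y), U = {τ | trunc h τ = c}}

instance : MeasurableSpace (MGraph X Y) := borel _

instance : BorelSpace (MGraph X Y) := ⟨rfl⟩

/-! ### Doubly rooted graphs and unimodularity -/

/-- A representative of a doubly rooted graph: the second root lies in the component of the first
one. -/
def RawBiGraph (X : Type u) (Y : Type v) : Type (max u v) :=
  {p : RawGraph X Y × ℕ // p.2 ∈ p.1.comp}

/-- Isomorphisms of doubly rooted graphs preserve both roots. -/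
instance biIsoSetoid (X : Type u) (Y : Type v) : Setoid (RawBiGraph X Y) where
  r p q := ∃ φ : RawGraph.Iso p.1.1 q.1.1, (φ.toEquiv ⟨p.1.2, p.2⟩ : ℕ) = q.1.2
  iseqv := by
    refine ⟨fun p => ⟨RawGraph.Iso.refl _, rfl⟩, ?_, ?_⟩
    · rintro p q ⟨φ, hφ⟩
      refine ⟨φ.symm, ?_⟩
      have h : φ.toEquiv ⟨p.1.2, p.2⟩ = ⟨q.1.2, q.2⟩ := Subtype.ext hφ
      change ((φ.toEquiv.symm ⟨q.1.2, q.2⟩ : p.1.1.comp) : ℕ) = p.1.2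
      rw [← h, Equiv.symm_apply_apply]
    · rintro p q r ⟨φ, hφ⟩ ⟨ψ, hψ⟩
      refine ⟨φ.trans ψ, ?_⟩
      have h : φ.toEquiv ⟨p.1.2, p.2⟩ = ⟨q.1.2, q.2⟩ := Subtype.ext hφ
      change ((ψ.toEquiv (φ.toEquiv ⟨p.1.2, p.2⟩) : r.1.1.comp) : ℕ) = r.1.2
      rw [h, hψ]

/-- The space of unlabeled doubly rooted marked graphs. -/
def BiGraph (X : Type u) (Y : Type v) : Type (max u v) := Quotient (biIsoSetoid X Y)

/-- The class of `(G, o, a)`, where `o` is the root of `G`. -/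
def BiGraph.mk (G : RawGraph X Y) (a : ℕ) (ha : a ∈ G.comp) : BiGraph X Y :=
  Quotient.mk _ (⟨(G, a), ha⟩ : RawBiGraph X Y)

/-- The set of all `(G, o, a)` such that the `h`-neighbourhood of `o` in `G` contains `a` and is
isomorphic to the `h`-neighbourhood of the root of `H`, by an isomorphism that takes `a` to `b`. -/
def biCylinder (h : ℕ) (H : RawGraph X Y) (b : ℕ) : Set (BiGraph X Y) :=
  {D | ∃ (φ : RawGraph.Iso ((Quotient.out D).1.1.trunc h) (H.trunc h))
    (ha : (Quotient.out D).1.2 ∈ ((Quotient.out D).1.1.trunc h).comp),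
    (φ.toEquiv ⟨(Quotient.out D).1.2, ha⟩ : ℕ) = b}

/-- The local topology on doubly rooted graphs. -/
instance : TopologicalSpace (BiGraph X Y) :=
  TopologicalSpace.generateFrom {U | ∃ (h : ℕ) (H : RawGraph X Y) (b : ℕ), U = biCylinder h H b}

instance : MeasurableSpace (BiGraph X Y) := borel _

instance : BorelSpace (BiGraph X Y) := ⟨rfl⟩

/-- The mass transport principle. -/
def Unimodular (ρ : Measure (MGraph X Y)) : Prop :=
  ∀ f : BiGraph X Y → ℝ≥0∞, Measurable f →
    ∫⁻ τ, ∑' a : τ.rep.comp, f (BiGraph.mk τ.rep a a.2) ∂ρ =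
    ∫⁻ τ, ∑' a : τ.rep.comp,
      f (BiGraph.mk (τ.rep.reroot a) τ.rep.root (SimpleGraph.Reachable.symm a.2)) ∂ρ

/-- `ρ` is carried by the set of trees. -/
def OnTrees (ρ : Measure (MGraph X Y)) : Prop := ∀ᵐ τ ∂ρ, τ.rep.IsTree

/-! ### Root degree, marginals, and the trees on both sides of an edge -/

/-- The mark of the root. -/
def rootMark (τ : MGraph X Y) : X := τ.rep.vmark τ.rep.root

/-- The degree of the root. -/
def deg (τ : MGraph X Y) : ℕ := τ.rep.nbrs.card

/-- `E_ρ[deg(o)]`. -/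
def meanDeg (ρ : Measure (MGraph X Y)) : ℝ≥0∞ := ∫⁻ τ, (deg τ : ℝ≥0∞) ∂ρ

/-- The law `ρ_o` of the root mark. -/
def rootLaw [MeasurableSpace X] (ρ : Measure (MGraph X Y)) : Measure X := ρ.map rootMark

/-- The law `ρ_h` of the truncation at depth `h`. -/
def marginal (ρ : Measure (MGraph X Y)) (h : ℕ) : Measure (MGraph X Y) := ρ.map (trunc h)

/-- A tree together with an edge mark. -/
abbrev Branch (X : Type u) (Y : Type v) : Type (max u v) := MGraph X Y × Y

/-- For adjacent vertices `a`, `b`, the pair `τ(a ∖ b)_h`: the component of `a` after removal of the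
edge `{a, b}`, truncated at depth `h`, and the mark `y_(a,b)`. -/
def RawGraph.branch (G : RawGraph X Y) (h a b : ℕ) : Branch X Y :=
  (MGraph.mk ((G.cut a b).trunc h), G.emark a b)

/-- `τ(v ∖ o)_h` for a neighbour `v` of the root `o`. -/
def RawGraph.down (G : RawGraph X Y) (h a : ℕ) : Branch X Y := G.branch h a G.root

/-- `τ(o ∖ v)_h` for a neighbour `v` of the root `o`. -/
def RawGraph.up (G : RawGraph X Y) (h a : ℕ) : Branch X Y := G.branch h G.root a

/-- `E_h(t, t')(τ)` for `p = (t, t')`: the number of neighbours `v` of the root such that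
`τ(v ∖ o)_{h-1} = t` and `τ(o ∖ v)_{h-1} = t'`. -/
def edgeCount (h : ℕ) (p : Branch X Y × Branch X Y) (τ : MGraph X Y) : ℕ :=
  {a : ℕ | a ∈ τ.rep.nbrs ∧ τ.rep.down (h - 1) a = p.1 ∧ τ.rep.up (h - 1) a = p.2}.ncard

/-- The covariance measure `π_μ` of a law `μ` on trees of depth at most `h`, as a mass function:
`π_μ(t, t') = E_μ[E_h(t, t')] / E_μ[deg(o)]`. -/
def covMass (h : ℕ) (μ : Measure (MGraph X Y)) (p : Branch X Y × Branch X Y) : ℝ≥0∞ :=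
  (∫⁻ τ, (edgeCount h p τ : ℝ≥0∞) ∂μ) / meanDeg μ

/-- The size-biased law, with density `deg(o) / E_μ[deg(o)]`. -/
def sizeBiased (μ : Measure (MGraph X Y)) : Measure (MGraph X Y) :=
  μ.withDensity fun τ => (deg τ : ℝ≥0∞) / meanDeg μ

/-- The size-biased marginal, as a mass function: the joint law of `τ(1 ∖ o)_{h-1}` and
`τ(o ∖ 1)_{h-1}` when `τ` has the size-biased law and `1` is a uniformly chosen neighbour of the
root. -/
def edgeMass (h : ℕ) (μ : Measure (MGraph X Y)) (p : Branch X Y × Branch X Y) : ℝ≥0∞ :=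
  ∫⁻ τ, (edgeCount h p τ : ℝ≥0∞) / deg τ ∂(sizeBiased μ)

/-- First marginal of the size-biased marginal. -/
def edgeMassFst (h : ℕ) (μ : Measure (MGraph X Y)) (t : Branch X Y) : ℝ≥0∞ :=
  ∑' t' : Branch X Y, edgeMass h μ (t, t')

/-- Second marginal of the size-biased marginal. -/
def edgeMassSnd (h : ℕ) (μ : Measure (MGraph X Y)) (t' : Branch X Y) : ℝ≥0∞ :=
  ∑' t : Branch X Y, edgeMass h μ (t, t')

/-- Admissibility: the size-biased marginal is symmetric. -/
def Admissible (h : ℕ) (μ : Measure (MGraph X Y)) : Prop :=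
  ∀ p : Branch X Y × Branch X Y, edgeMass h μ p = edgeMass h μ p.swap

/-- The measure with the given point masses. -/
def ofMass {α : Type*} [MeasurableSpace α] (m : α → ℝ≥0∞) : Measure α :=
  Measure.sum fun a => m a • Measure.dirac a

/-- The Shannon entropy of the probability with the given point masses. -/
def shannon {α : Type*} (m : α → ℝ≥0∞) : ℝ≥0∞ :=
  ∑' a, ENNReal.ofReal (Real.negMulLog (m a).toReal)

/-! ### The one-step unimodular extension -/

/-- The conditional law, as a mass function, of `τ(o ∖ 1)_h` given `τ(o ∖ 1)_{h-1} = t` and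
`τ(1 ∖ o)_{h-1} = t'`, when `τ` has the size-biased law of `μ` and `1` is a uniformly chosen
neighbour of the root. Here `μ` is a law on trees of depth at most `h`. -/
def condMass (h : ℕ) (μ : Measure (MGraph X Y)) (t t' s : Branch X Y) : ℝ≥0∞ :=
  (∫⁻ τ, ({a : ℕ | a ∈ τ.rep.nbrs ∧ τ.rep.up h a = s ∧ τ.rep.up (h - 1) a = t ∧
      τ.rep.down (h - 1) a = t'}.ncard : ℝ≥0∞) / deg τ ∂(sizeBiased μ)) / edgeMass h μ (t', t)

/-- The tree obtained from `τ` when, for each neighbour `v` of the root `o`, the branch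
`τ(v ∖ o)` (tree and edge mark) is replaced by `s v`. -/
def replaceBranches (τ : MGraph X Y) (s : τ.rep.nbrs → Branch X Y) : MGraph X Y :=
  MGraph.mk (RawGraph.join (rootMark τ) τ.rep.nbrs
    (fun i => if hi : i ∈ τ.rep.nbrs then (s ⟨i, hi⟩).1.rep else τ.rep)
    (fun i => if hi : i ∈ τ.rep.nbrs then (s ⟨i, hi⟩).2 else τ.rep.emark i τ.rep.root)
    (fun i => τ.rep.emark τ.rep.root i))

open Classical in
/-- The one-step unimodular extension of a law `μ` on trees of depth at most `h` to a law on trees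
of depth at most `h + 1`: sample `τ` from `μ`; then, independently for the neighbours `v` of the
root, replace `τ(v ∖ o)` by a sample of the conditional law `condMass h μ` at
`(τ(v ∖ o)_{h-1}, τ(o ∖ v)_{h-1})`. -/
def extension (h : ℕ) (μ : Measure (MGraph X Y)) : Measure (MGraph X Y) :=
  ofMass fun σ => ∫⁻ τ, ∑' s : τ.rep.nbrs → Branch X Y,
    (if replaceBranches τ s = σ then
      ∏ a : τ.rep.nbrs, condMass h μ (τ.rep.down (h - 1) a) (τ.rep.up (h - 1) a) (s a)
    else 0) ∂μ

/-! ### The reference law and the rate function -/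

/-- The symmetrization `ξ̄` of a law of edge marks. -/
def symmLaw [MeasurableSpace Y] (ξ : Measure (Y × Y)) : Measure (Y × Y) :=
  (2 : ℝ≥0∞)⁻¹ • (ξ + ξ.map Prod.swap)

/-- The star whose root has mark `x` and `n` children; the child `i` has mark `(m i).1`, and its
edge to the root carries the mark `(m i).2.1` at the child and `(m i).2.2` at the root. -/
def star [Nonempty Y] (x : X) (n : ℕ) (m : Fin n → X × Y × Y) : MGraph X Y :=
  MGraph.mk (RawGraph.join x (Finset.range n)
    (fun i => if hi : i < n then RawGraph.point (m ⟨i, hi⟩).1 else RawGraph.point x)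
    (fun i => if hi : i < n then (m ⟨i, hi⟩).2.1 else Classical.arbitrary Y)
    (fun i => if hi : i < n then (m ⟨i, hi⟩).2.2 else Classical.arbitrary Y))

open Classical in
/-- The law `η^β_1` of the first neighbourhood of the root in the Galton-Watson tree with Poisson
offspring distribution of mean `β` and independent marks: the root degree is Poisson with mean `β`,
the vertex marks have law `ν`, the pairs of edge marks have law `ξ̄`, and all of them are
independent. -/
def poissonStar [Nonempty Y] [MeasurableSpace X] [MeasurableSpace Y]
    (ν : Measure X) (ξ : Measure (Y × Y)) (β : ℝ≥0) : Measure (MGraph X Y) :=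
  ofMass fun σ => ∑' n : ℕ, ProbabilityTheory.poissonMeasure β {n} *
    ∑' x : X, ν {x} * ∑' m : Fin n → X × Y × Y,
      (if star x n m = σ then ∏ i, ν {(m i).1} * symmLaw ξ {(m i).2} else 0)

/-- `μ̌`: density with respect to `η₁` the product over the neighbours `v` of the root of
`dμ̄^1/dη̄₁^1` at `(X_v, Y_(v,o))`. -/
def checkOne (η₁ μ : Measure (MGraph X Y)) : Measure (MGraph X Y) :=
  η₁.withDensity fun τ => ∏ a ∈ τ.rep.nbrs,
    edgeMassFst 1 μ (τ.rep.down 0 a) / edgeMassFst 1 η₁ (τ.rep.down 0 a)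

open Classical in
/-- The density of the conditional law `μ̄^{1|o}(· | t')` with respect to `η̄₁^{1|o}(· | t')` at `t`.
Where `t'` has probability zero under `μ̄^o`, the version `μ̄^{1|o}(· | t') = η̄₁^{1|o}(· | t')` of
the conditional law is used. -/
def condDensity (η₁ μ : Measure (MGraph X Y)) (t t' : Branch X Y) : ℝ≥0∞ :=
  if edgeMassSnd 1 μ t' = 0 then 1 else
    (edgeMass 1 μ (t, t') / edgeMassSnd 1 μ t') / (edgeMass 1 η₁ (t, t') / edgeMassSnd 1 η₁ t')

/-- `μ̂`: density with respect to `η₁` the product over the neighbours `v` of the root of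
`dμ̄^{1|o}/dη̄₁^{1|o}` at `(X_v, Y_(v,o))` given `(X_o, Y_(o,v))`. -/
def hatOne (η₁ μ : Measure (MGraph X Y)) : Measure (MGraph X Y) :=
  η₁.withDensity fun τ => ∏ a ∈ τ.rep.nbrs, condDensity η₁ μ (τ.rep.down 0 a) (τ.rep.up 0 a)

/-- `ρ*_h = ρ̌_h` for `h ≥ 2`: the one-step unimodular extension of `ρ_{h-1}`. -/
def checkLaw (ρ : Measure (MGraph X Y)) (h : ℕ) : Measure (MGraph X Y) :=
  extension (h - 1) (marginal ρ (h - 1))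

/-- `ρ̂_h` for `h ≥ 2`: density with respect to `ρ*_h` the product over the neighbours `v` of the
root of the ratio of the size-biased marginals of `ρ_h` and `ρ*_h` at
`(τ(v ∖ o)_{h-1}, τ(o ∖ v)_{h-1})`. -/
def hatLaw (ρ : Measure (MGraph X Y)) (h : ℕ) : Measure (MGraph X Y) :=
  (checkLaw ρ h).withDensity fun τ => ∏ a ∈ τ.rep.nbrs,
    edgeMass h (marginal ρ h) (τ.rep.down (h - 1) a, τ.rep.up (h - 1) a) /
      edgeMass h (checkLaw ρ h) (τ.rep.down (h - 1) a, τ.rep.up (h - 1) a)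

/-- `ρ` is a unimodular law on trees with mean root degree `β`. -/
def UnimodularTree (β : ℝ≥0∞) (ρ : Measure (MGraph X Y)) : Prop :=
  OnTrees ρ ∧ Unimodular ρ ∧ meanDeg ρ = β

open Classical in
/-- The rate function at `ρ`; it depends on the reference law `η` only through the law `η₁` of its
first neighbourhood. -/
def rate [MeasurableSpace X] (ν : Measure X) (β : ℝ≥0∞) (η₁ ρ : Measure (MGraph X Y)) : ℝ≥0∞ :=
  if β = 0 ∧ meanDeg ρ = 0 then klDiv (rootLaw ρ) ν
  else if 0 < β ∧ UnimodularTree β ρ ∧ marginal ρ 1 ≪ η₁ then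
    (2 : ℝ≥0∞)⁻¹ *
      ((klDiv (marginal ρ 1) (checkOne η₁ (marginal ρ 1)) +
          klDiv (marginal ρ 1) (hatOne η₁ (marginal ρ 1))) +
        ∑' k : ℕ, (klDiv (marginal ρ (k + 2)) (checkLaw ρ (k + 2)) +
          klDiv (marginal ρ (k + 2)) (hatLaw ρ (k + 2))))
  else ⊤

/-! ### The microstate entropy -/

/-- The function `β⃗_ρ`: `β` times the law of the pair of edge marks under the covariance measure
of depth one. -/
def edgeIntensity [Fintype X] [Nonempty Y] (ρ : Measure (MGraph X Y)) (y y' : Y) : ℝ≥0∞ :=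
  meanDeg ρ * ∑ x : X, ∑ x' : X, covMass 1 (marginal ρ 1)
    ((MGraph.mk (RawGraph.point x), y), (MGraph.mk (RawGraph.point x'), y'))

/-- The probability `β⃗_ρ / β` on pairs of edge marks. -/
def edgeMarkLaw [Fintype X] [Nonempty Y] [MeasurableSpace Y] (ρ : Measure (MGraph X Y)) :
    Measure (Y × Y) :=
  ofMass fun p => edgeIntensity ρ p.1 p.2 / meanDeg ρ

/-- `s(b) = b/2 - (b/2) log b`. -/
def sFun (b : ℝ) : ℝ := b / 2 - b / 2 * Real.log b

/-- `s⃗(b) = ∑_{y,y'} s(b(y,y'))`. -/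
def sVec [Fintype Y] (b : Y → Y → ℝ≥0∞) : ℝ := ∑ y : Y, ∑ y' : Y, sFun (b y y').toReal

/-- `E_μ[deg(o) log deg(o)]`. -/
def degLogMoment (μ : Measure (MGraph X Y)) : ℝ≥0∞ :=
  ∫⁻ τ, ENNReal.ofReal ((deg τ : ℝ) * Real.log (deg τ)) ∂μ

open Classical in
/-- The functional `J_h` at a law `μ` on rooted marked graphs of depth at most `h`, for `h ≥ 1`. -/
def J (β : ℝ≥0∞) (h : ℕ) (μ : Measure (MGraph X Y)) : EReal :=
  if OnTrees μ ∧ meanDeg μ = β ∧ Admissible h μ ∧ degLogMoment μ < ⊤ then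
    -((sFun β.toReal : ℝ) : EReal) + ((shannon fun τ => μ {τ} : ℝ≥0∞) : EReal)
      - ((β / 2 * shannon (covMass h μ) : ℝ≥0∞) : EReal)
      - ((∑' p : Branch X Y × Branch X Y,
          ∫⁻ τ, ENNReal.ofReal (Real.log ((edgeCount h p τ).factorial : ℝ)) ∂μ : ℝ≥0∞) : EReal)
  else ⊥

/-- The expression `H(ρ_h) - (β/2) H(π_{ρ_h})` which occurs in `J_h(ρ_h)` is not of the form `∞ - ∞`
for any `h ≥ 1`. (Nothing is required if `E_ρ[deg(o) log deg(o)] = ∞`, as `J_h(ρ_h) = -∞` then.) -/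
def EntropyDefined (ρ : Measure (MGraph X Y)) : Prop :=
  degLogMoment ρ < ⊤ → ∀ h : ℕ, 1 ≤ h →
    (shannon fun τ => marginal ρ h {τ}) < ⊤ ∨ shannon (covMass h (marginal ρ h)) < ⊤

open Classical in
/-- The microstate entropy `Σ_{b, θ}(ρ)`, the limit of `J_h(ρ_h)` as `h → ∞`. (The limit is written
as an upper limit, which is always defined.) -/
def microstateEntropy [Fintype X] [Nonempty Y] [MeasurableSpace X]
    (b : Y → Y → ℝ≥0∞) (θ : Measure X) (ρ : Measure (MGraph X Y)) : EReal :=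
  if 0 < meanDeg ρ ∧ meanDeg ρ < ⊤ ∧ UnimodularTree (meanDeg ρ) ρ ∧
      edgeIntensity ρ = b ∧ rootLaw ρ = θ then
    limsup (fun h : ℕ => J (meanDeg ρ) h (marginal ρ h)) atTop
  else ⊥

/-- The sum `H(ρ_o) + H(ρ_o ‖ ν) + (β/2) H(β⃗_ρ/β ‖ ξ̄) + s⃗(β⃗_ρ)`. -/
def explicitPart [Fintype X] [Fintype Y] [Nonempty Y] [MeasurableSpace X] [MeasurableSpace Y]
    (ν : Measure X) (ξ : Measure (Y × Y)) (ρ : Measure (MGraph X Y)) : EReal :=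
  ((shannon fun x => rootLaw ρ {x} : ℝ≥0∞) : EReal) + ((klDiv (rootLaw ρ) ν : ℝ≥0∞) : EReal)
    + ((meanDeg ρ / 2 * klDiv (edgeMarkLaw ρ) (symmLaw ξ) : ℝ≥0∞) : EReal)
    + ((sVec (edgeIntensity ρ) : ℝ) : EReal)

end MarkedTree

end

open MeasureTheory Filter Topology InformationTheory
open scoped ENNReal NNReal

noncomputable section

namespace MarkedTree

universe u v

set_option linter.unusedSectionVars false

/-! ### Labelled graphs: isomorphisms, balls, cuts and trees. -/

section

variable {X : Type u} {Y : Type v}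

namespace RawGraph

/-! ### Components, balls and isomorphisms given by maps of labels -/

/-! The sum in the rate function telescopes: from one depth to the next, `J` drops by exactly half
of the two relative entropies of the new depth (`J_step`), and at depth one `J` is `explicitPart`
minus half of the two relative entropies there (`J_one_eq`). The drops are nonnegative, so the limit
exists, and it is `explicitPart` minus `rate`.

The reason for the drop is a formula for point masses. Let `π_{i,k}` be `pairMass ρ i k`, the law of
the two branches at a typical root edge, with the far side truncated at depth `i` and the root side
at depth `k`. A tree of depth `j + 2` is its truncation at depth `j + 1` with the branches at the
root prolonged. Under both `checkLaw` and `hatLaw` its mass is the mass of the truncation, times the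
number of ways of prolonging (a quotient of products of factorials of multiplicities, `factProd`),
times a product over the root edges of conditional probabilities: `π_{j,j+1} / π_{j,j}` for the
first law (`extension_singleton`) and `π_{j+1,j+1} / π_{j,j+1}` for the second (`hatLaw_singleton`).
The integral of minus the logarithm against `ρ` is a cross entropy, that is, Shannon entropy plus
relative entropy (`Atomic.add_klDiv`), and sums over root edges integrate to the mean degree times
entropies of the `π_{i,k}`. This gives `check_balance` and `hat_balance`; when they are added, the
entropy of `π_{j,j+1}` cancels. Unimodularity enters as the symmetry `π_{i,k}(t, t') = π_{k,i}(t',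
t)` (`mass_transport`, `pairMass_swap`).

At depth one the reference law is an explicit Poisson-multinomial law, and the same computation
gives `checkOne_balance` and `hatOne_balance`. The entropy of the marks at one end of an edge occurs
on opposite sides of the two and cancels, and what remains is `explicitPart`.

Infinite values need care. All balances are equalities of sums in `[0, ∞]`; subtraction occurs only
in `ereal_step` and `ereal_base`. The law of the 1-neighbourhood always has finite entropy, since
the mean degree is finite and there are finitely many marks. If `degLogMoment` is infinite, then `J`
is `-∞` at every positive depth, and the first relative entropy is infinite by `degLogMoment_le`.
Finally, the 1-neighbourhood is absolutely continuous with respect to the Poisson star exactly when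
the laws of root marks and edge marks are (`compatible_iff`); otherwise `explicitPart` and `rate`
are both infinite. -/

lemma mem_comp_of_adj {G : RawGraph X Y} {a b : ℕ} (ha : a ∈ G.comp) (h : G.graph.Adj a b) :
    b ∈ G.comp := SimpleGraph.Reachable.trans ha h.reachable

/-- Replaces walks throughout: what holds at the root and passes along edges holds on the whole
represented component. -/
lemma comp_induction {G : RawGraph X Y} {P : ℕ → Prop} (h0 : P G.root)
    (hs : ∀ a b, a ∈ G.comp → G.graph.Adj a b → P a → P b) {a : ℕ} (ha : a ∈ G.comp) : P a := by
  have h : Relation.ReflTransGen G.graph.Adj G.root a :=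
    (SimpleGraph.reachable_iff_reflTransGen _ _).1 ha
  induction h with
  | refl => exact h0
  | tail hab hbc ih =>
    have hb := (SimpleGraph.reachable_iff_reflTransGen _ _).2 hab
    exact hs _ _ hb hbc (ih hb)

lemma mem_nbrs {G : RawGraph X Y} {a : ℕ} : a ∈ G.nbrs ↔ G.graph.Adj G.root a := by
  simp [nbrs]

lemma mem_comp_of_mem_nbrs {G : RawGraph X Y} {a : ℕ} (ha : a ∈ G.nbrs) : a ∈ G.comp :=
  mem_comp_of_adj G.root_mem_comp (mem_nbrs.1 ha)

/-- The map `f` of labels induces an isomorphism of the represented graphs. -/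
structure IsoMap (f : ℕ → ℕ) (G H : RawGraph X Y) : Prop where
  root : f G.root = H.root
  adj : ∀ a ∈ G.comp, ∀ b, G.graph.Adj a b → H.graph.Adj (f a) (f b)
  lift : ∀ a ∈ G.comp, ∀ b', H.graph.Adj (f a) b' → ∃ b, G.graph.Adj a b ∧ f b = b'
  inj : Set.InjOn f G.comp
  vmark : ∀ a ∈ G.comp, H.vmark (f a) = G.vmark a
  emark : ∀ a ∈ G.comp, ∀ b, G.graph.Adj a b → H.emark (f a) (f b) = G.emark a b

namespace IsoMap

variable {f : ℕ → ℕ} {G H : RawGraph X Y}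

lemma mem_comp (hf : IsoMap f G H) {a : ℕ} (ha : a ∈ G.comp) : f a ∈ H.comp := by
  refine comp_induction (P := fun a => f a ∈ H.comp) ?_ ?_ ha
  · rw [hf.root]; exact H.root_mem_comp
  · exact fun a b ha hab h => mem_comp_of_adj h (hf.adj a ha b hab)

lemma surj (hf : IsoMap f G H) {b : ℕ} (hb : b ∈ H.comp) : ∃ a ∈ G.comp, f a = b := by
  refine comp_induction (P := fun b => ∃ a ∈ G.comp, f a = b) ⟨_, G.root_mem_comp, hf.root⟩ ?_ hb
  rintro _ c - hbc ⟨a, ha, rfl⟩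
  obtain ⟨b, hab, rfl⟩ := hf.lift a ha c hbc
  exact ⟨b, mem_comp_of_adj ha hab, rfl⟩

lemma adj_iff (hf : IsoMap f G H) {a b : ℕ} (ha : a ∈ G.comp) (hb : b ∈ G.comp) :
    H.graph.Adj (f a) (f b) ↔ G.graph.Adj a b := by
  refine ⟨fun h => ?_, hf.adj a ha b⟩
  obtain ⟨c, hac, hcb⟩ := hf.lift a ha _ h
  rwa [← hf.inj (mem_comp_of_adj ha hac) hb hcb]

lemma exists_iso (hf : IsoMap f G H) : ∃ φ : Iso G H, ∀ a, (φ.toEquiv a : ℕ) = f a := by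
  let g : G.comp → H.comp := fun a => ⟨f a, hf.mem_comp a.2⟩
  have hg : Function.Bijective g := by
    refine ⟨fun a b h => Subtype.ext (hf.inj a.2 b.2 (congrArg Subtype.val h)), fun b => ?_⟩
    obtain ⟨a, ha, h⟩ := hf.surj b.2
    exact ⟨⟨a, ha⟩, Subtype.ext h⟩
  exact ⟨⟨Equiv.ofBijective g hg, hf.root, fun a b => hf.adj_iff a.2 b.2, fun a => hf.vmark a a.2,
    fun a b => hf.emark a a.2 b⟩, fun a => rfl⟩

lemma mk_eq (hf : IsoMap f G H) : MGraph.mk G = MGraph.mk H :=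
  Quotient.sound ⟨hf.exists_iso.choose⟩

end IsoMap

/-- Exchanges an equivalence of subtypes for a plain map of labels (with the junk value `0` off the
component), so that restriction to truncations and cuts needs no coercions. -/
lemma Iso.exists_isoMap {G H : RawGraph X Y} (φ : Iso G H) :
    ∃ f, IsoMap f G H ∧ ∀ a : G.comp, f a = φ.toEquiv a := by
  classical
  let f : ℕ → ℕ := fun n => if h : n ∈ G.comp then φ.toEquiv ⟨n, h⟩ else 0
  have hf : ∀ a (ha : a ∈ G.comp), f a = φ.toEquiv ⟨a, ha⟩ := fun a ha => by simp [f, ha]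
  refine ⟨f, ⟨?_, ?_, ?_, ?_, ?_, ?_⟩, fun a => hf a a.2⟩
  · rw [hf _ G.root_mem_comp, φ.map_root]
  · intro a ha b hab
    rw [hf a ha, hf b (mem_comp_of_adj ha hab)]
    exact (φ.map_adj _ _).2 hab
  · intro a ha b' hab
    rw [hf a ha] at hab
    have hb' : b' ∈ H.comp := mem_comp_of_adj (φ.toEquiv ⟨a, ha⟩).2 hab
    refine ⟨φ.toEquiv.symm ⟨b', hb'⟩, ?_, ?_⟩
    · rw [← φ.map_adj ⟨a, ha⟩]
      simpa using hab
    · rw [hf _ (φ.toEquiv.symm ⟨b', hb'⟩).2]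
      simp
  · intro a ha b hb h
    rw [hf a ha, hf b hb] at h
    simpa using φ.toEquiv.injective (Subtype.ext h)
  · intro a ha
    rw [hf a ha, φ.map_vmark]
  · intro a ha b hab
    rw [hf a ha, hf b (mem_comp_of_adj ha hab)]
    exact φ.map_emark ⟨a, ha⟩ ⟨b, _⟩ hab

lemma exists_isoMap_of_mk_eq {G H : RawGraph X Y} (h : MGraph.mk G = MGraph.mk H) :
    ∃ f, IsoMap f G H := by
  obtain ⟨φ⟩ : Nonempty (Iso G H) := Quotient.exact h
  exact φ.exists_isoMap.imp fun _ h => h.1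

/-- The ball of radius `h` around the root. -/
def ball (G : RawGraph X Y) : ℕ → Set ℕ
  | 0 => {G.root}
  | h + 1 => G.ball h ∪ {b | ∃ a ∈ G.ball h, G.graph.Adj a b}

lemma root_mem_ball (G : RawGraph X Y) (h : ℕ) : G.root ∈ G.ball h := by
  induction h with
  | zero => rfl
  | succ h ih => exact Or.inl ih

lemma ball_mono {G : RawGraph X Y} {h k : ℕ} (hk : h ≤ k) : G.ball h ⊆ G.ball k := by
  induction hk with
  | refl => exact subset_rfl
  | step _ ih => exact ih.trans Set.subset_union_left

lemma ball_subset_comp (G : RawGraph X Y) (h : ℕ) : G.ball h ⊆ G.comp := by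
  induction h with
  | zero => rintro _ rfl; exact G.root_mem_comp
  | succ h ih =>
    rintro b (hb | ⟨a, ha, hab⟩)
    · exact ih hb
    · exact mem_comp_of_adj (ih ha) hab

/-- Truncation is defined through the distance, but inductions run over the recursive balls. A
shortest walk, shortened by its last edge, links the two. -/
lemma mem_ball_iff {G : RawGraph X Y} {h a : ℕ} :
    a ∈ G.ball h ↔ a ∈ G.comp ∧ G.graph.dist G.root a ≤ h := by
  constructor
  · intro ha
    refine ⟨G.ball_subset_comp h ha, ?_⟩
    induction h generalizing a with
    | zero => rw [show a = G.root from ha]; simp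
    | succ h ih =>
      rcases ha with ha | ⟨b, hb, hab⟩
      · exact (ih ha).trans h.le_succ
      · obtain ⟨p, hp⟩ := SimpleGraph.Reachable.exists_walk_length_eq_dist
          (G.ball_subset_comp h hb : G.graph.Reachable G.root b)
        have := SimpleGraph.dist_le (p.concat hab)
        rw [SimpleGraph.Walk.length_concat, hp] at this
        exact this.trans (Nat.succ_le_succ (ih hb))
  · rintro ⟨ha, h1⟩
    obtain ⟨p, hp⟩ := SimpleGraph.Reachable.exists_walk_length_eq_dist
      (ha : G.graph.Reachable G.root a)
    rw [← hp] at h1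
    have key : ∀ (n : ℕ) (b : ℕ) (p : G.graph.Walk G.root b), p.length = n → b ∈ G.ball n := by
      intro n
      induction n with
      | zero => intro b p hp; exact (SimpleGraph.Walk.eq_of_length_eq_zero hp).symm
      | succ n ih =>
        intro b p hp
        have hn : ¬ p.Nil := by
          intro h; rw [← SimpleGraph.Walk.length_eq_zero_iff] at h; omega
        have h2 := ih _ p.dropLast (by
          have := p.length_dropLast_add_one hn; omega)
        exact Or.inr ⟨_, h2, p.adj_penultimate hn⟩
    exact ball_mono h1 (key _ _ p rfl)

lemma mem_comp_iff {G : RawGraph X Y} {a : ℕ} : a ∈ G.comp ↔ ∃ h, a ∈ G.ball h :=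
  ⟨fun ha => ⟨_, mem_ball_iff.2 ⟨ha, le_rfl⟩⟩, fun ⟨h, ha⟩ => G.ball_subset_comp h ha⟩

lemma ball_finite (G : RawGraph X Y) (h : ℕ) : (G.ball h).Finite := by
  induction h with
  | zero => exact Set.finite_singleton _
  | succ h ih =>
    refine ih.union ((ih.biUnion fun a _ => G.locallyFinite a).subset ?_)
    rintro b ⟨a, ha, hab⟩
    exact Set.mem_biUnion ha hab

lemma trunc_adj {G : RawGraph X Y} {h a b : ℕ} :
    (G.trunc h).graph.Adj a b ↔ G.graph.Adj a b ∧ a ∈ G.ball h ∧ b ∈ G.ball h := by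
  rw [mem_ball_iff, mem_ball_iff]; rfl

lemma trunc_ball (G : RawGraph X Y) (h k : ℕ) : (G.trunc h).ball k = G.ball (min h k) := by
  induction k with
  | zero => simp [ball, trunc]
  | succ k ih =>
    ext b
    rw [ball, ih]
    simp only [Set.mem_union, Set.mem_ofPred_eq, trunc_adj]
    rcases le_or_gt h k with hk | hk
    · rw [min_eq_left hk, min_eq_left (hk.trans k.le_succ)]
      exact ⟨fun h => h.elim id fun ⟨a, _, _, _, hb⟩ => hb, Or.inl⟩
    · rw [min_eq_right hk.le, min_eq_right hk, ball]
      simp only [Set.mem_union, Set.mem_ofPred_eq]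
      refine or_congr_right (exists_congr fun a => and_congr_right fun ha => ⟨fun h => h.1,
        fun h => ⟨h, ball_mono hk.le ha, ?_⟩⟩)
      exact ball_mono hk (Or.inr ⟨a, ha, h⟩)

/-- The truncation keeps all labels; those outside the ball become isolated and thereby leave the
component. -/
lemma trunc_comp (G : RawGraph X Y) (h : ℕ) : (G.trunc h).comp = G.ball h := by
  ext a
  rw [mem_comp_iff]
  simp only [trunc_ball]
  exact ⟨fun ⟨k, hk⟩ => ball_mono (min_le_left _ _) hk, fun ha => ⟨h, by rwa [min_self]⟩⟩

/-- Rooted marked graphs with the same data are equal. -/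
lemma ext_of_adj {G H : RawGraph X Y} (hr : G.root = H.root)
    (ha : ∀ a b, G.graph.Adj a b ↔ H.graph.Adj a b) (hv : G.vmark = H.vmark)
    (he : G.emark = H.emark) : G = H := by
  have hg : G.graph = H.graph := by
    ext a b; exact ha a b
  cases G; cases H
  simp only at *
  subst hr hg hv he
  rfl

/-- An equality of representatives, not merely an isomorphism, so it can be used for rewriting. -/
lemma trunc_trunc (G : RawGraph X Y) (h k : ℕ) : (G.trunc h).trunc k = G.trunc (min h k) := by
  refine ext_of_adj rfl (fun a b => ?_) rfl rfl
  rw [trunc_adj, trunc_adj, trunc_adj, trunc_ball]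
  exact ⟨fun h => ⟨h.1.1, h.2⟩, fun h => ⟨⟨h.1, ball_mono (min_le_left _ _) h.2.1,
    ball_mono (min_le_left _ _) h.2.2⟩, h.2⟩⟩

namespace IsoMap

variable {f : ℕ → ℕ} {G H : RawGraph X Y}

lemma mem_ball_iff (hf : IsoMap f G H) {a h : ℕ} (ha : a ∈ G.comp) :
    f a ∈ H.ball h ↔ a ∈ G.ball h := by
  induction h generalizing a with
  | zero =>
    change f a = H.root ↔ a = G.root
    rw [← hf.root]
    exact hf.inj.eq_iff ha G.root_mem_comp
  | succ h ih =>
    refine or_congr (ih ha) ⟨?_, ?_⟩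
    · rintro ⟨b', hb', hab⟩
      obtain ⟨b, hb, rfl⟩ := hf.surj (H.ball_subset_comp h hb')
      exact ⟨b, (ih hb).1 hb', (hf.adj_iff hb ha).1 hab⟩
    · rintro ⟨b, hb, hab⟩
      have hb1 := G.ball_subset_comp h hb
      exact ⟨f b, (ih hb1).2 hb, hf.adj b hb1 a hab⟩

lemma trunc (hf : IsoMap f G H) (h : ℕ) : IsoMap f (G.trunc h) (H.trunc h) := by
  have hc : ∀ {a}, a ∈ (G.trunc h).comp → a ∈ G.comp := fun {a} ha => by
    rw [trunc_comp] at ha; exact G.ball_subset_comp h ha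
  refine ⟨hf.root, ?_, ?_, hf.inj.mono fun a => hc, fun a ha => hf.vmark a (hc ha),
    fun a ha b hab => hf.emark a (hc ha) b (trunc_adj.1 hab).1⟩
  · intro a ha b hab
    rw [trunc_adj] at hab ⊢
    exact ⟨hf.adj a (hc ha) b hab.1, (hf.mem_ball_iff (hc ha)).2 hab.2.1,
      (hf.mem_ball_iff (G.ball_subset_comp h hab.2.2)).2 hab.2.2⟩
  · intro a ha b' hab
    rw [trunc_adj] at hab
    obtain ⟨b, h1, rfl⟩ := hf.lift a (hc ha) b' hab.1
    refine ⟨b, trunc_adj.2 ⟨h1, ?_, ?_⟩, rfl⟩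
    · exact (hf.mem_ball_iff (hc ha)).1 hab.2.1
    · exact (hf.mem_ball_iff (mem_comp_of_adj (hc ha) h1)).1 hab.2.2

end IsoMap

lemma cut_adj {G : RawGraph X Y} {a b c d : ℕ} :
    (G.cut a b).graph.Adj c d ↔ G.graph.Adj c d ∧ ¬ ((c = a ∧ d = b) ∨ (c = b ∧ d = a)) := by
  change (G.graph.deleteEdges {s(a, b)}).Adj c d ↔ _
  rw [SimpleGraph.deleteEdges_adj]
  simp

/-- The represented component of a subgraph is contained in that of the graph. -/
lemma comp_subset_of_le {G H : RawGraph X Y} (hr : H.root ∈ G.comp)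
    (hle : ∀ a b, H.graph.Adj a b → G.graph.Adj a b) : H.comp ⊆ G.comp := fun _ ha =>
  comp_induction (P := (· ∈ G.comp)) hr (fun a b _ hab h => mem_comp_of_adj h (hle a b hab)) ha

lemma cut_comp_subset {G : RawGraph X Y} {a b : ℕ} (ha : a ∈ G.comp) :
    (G.cut a b).comp ⊆ G.comp := comp_subset_of_le ha fun _ _ h => (cut_adj.1 h).1

lemma IsoMap.cut {f : ℕ → ℕ} {G H : RawGraph X Y} (hf : IsoMap f G H) {a b : ℕ}
    (ha : a ∈ G.comp) (hb : b ∈ G.comp) : IsoMap f (G.cut a b) (H.cut (f a) (f b)) := by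
  have hc := cut_comp_subset (b := b) ha
  have key : ∀ c ∈ G.comp, ∀ d ∈ G.comp, ((f c = f a ∧ f d = f b) ∨ (f c = f b ∧ f d = f a)) ↔
      ((c = a ∧ d = b) ∨ (c = b ∧ d = a)) := fun c hc d hd => by
    rw [hf.inj.eq_iff hc ha, hf.inj.eq_iff hc hb, hf.inj.eq_iff hd ha, hf.inj.eq_iff hd hb]
  refine ⟨rfl, ?_, ?_, hf.inj.mono hc, fun a ha => hf.vmark a (hc ha),
    fun a ha b hab => hf.emark a (hc ha) b (cut_adj.1 hab).1⟩
  · intro c hc' d hcd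
    rw [cut_adj] at hcd ⊢
    have hcc := hc hc'
    rw [key c hcc d (mem_comp_of_adj hcc hcd.1)]
    exact ⟨hf.adj c hcc d hcd.1, hcd.2⟩
  · intro c hc' d' hcd
    rw [cut_adj] at hcd
    have hcc := hc hc'
    obtain ⟨d, h1, rfl⟩ := hf.lift c hcc d' hcd.1
    rw [key c hcc d (mem_comp_of_adj hcc h1)] at hcd
    exact ⟨d, cut_adj.2 ⟨h1, hcd.2⟩, rfl⟩

lemma IsoMap.branch_eq {f : ℕ → ℕ} {G H : RawGraph X Y} (hf : IsoMap f G H) {a b : ℕ}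
    (ha : a ∈ G.comp) (hab : G.graph.Adj a b) (n : ℕ) :
    H.branch n (f a) (f b) = G.branch n a b := by
  rw [branch, branch, hf.emark a ha b hab,
    ((hf.cut ha (mem_comp_of_adj ha hab)).trunc n).mk_eq]

/-! ### Trees -/

/-- A graph is acyclic iff every edge is a bridge. In this form the tree property speaks about
components of cuts, which are exactly the branches. -/
lemma isTree_iff {G : RawGraph X Y} : G.IsTree ↔
    ∀ a ∈ G.comp, ∀ b, G.graph.Adj a b → b ∉ (G.cut a b).comp := by
  have key : ∀ (a b c : G.comp), ((G.graph.induce G.comp).deleteEdges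
      {s(a, b)}).Reachable a c ↔ (c : ℕ) ∈ (G.cut a b).comp := by
    intro a b c
    constructor
    · intro h
      rw [SimpleGraph.reachable_iff_reflTransGen] at h
      induction h with
      | refl => exact root_mem_comp _
      | tail _ hbc ih =>
        rw [SimpleGraph.deleteEdges_adj] at hbc
        refine mem_comp_of_adj ih (cut_adj.2 ⟨hbc.1, ?_⟩)
        simpa [Subtype.ext_iff] using hbc.2
    · intro hc
      have : ∀ n, n ∈ (G.cut a b).comp → ∀ hn : n ∈ G.comp, ((G.graph.induce
          G.comp).deleteEdges {s(a, b)}).Reachable a ⟨n, hn⟩ := by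
        intro n hn
        refine comp_induction (P := fun n => ∀ hn : n ∈ G.comp, ((G.graph.induce
          G.comp).deleteEdges {s(a, b)}).Reachable a ⟨n, hn⟩) ?_ ?_ hn
        · exact fun _ => SimpleGraph.Reachable.refl _
        · intro n m hn hnm ih hm
          have hn' := cut_comp_subset a.2 hn
          refine (ih hn').trans (SimpleGraph.Adj.reachable ?_)
          rw [cut_adj] at hnm
          rw [SimpleGraph.deleteEdges_adj]
          exact ⟨hnm.1, by simpa [Subtype.ext_iff] using hnm.2⟩
      exact this c hc c.2
  rw [IsTree, SimpleGraph.isAcyclic_iff_forall_adj_isBridge]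
  constructor
  · intro h a ha b hab hb
    have hb' := mem_comp_of_adj ha hab
    have h1 := @h ⟨a, ha⟩ ⟨b, hb'⟩ hab
    rw [SimpleGraph.isBridge_iff] at h1
    exact h1 ((key ⟨a, ha⟩ ⟨b, hb'⟩ ⟨b, hb'⟩).2 hb)
  · intro h a b hab
    rw [SimpleGraph.isBridge_iff]
    exact fun h1 => h a a.2 b hab ((key a b b).1 h1)

lemma IsTree.of_le {G H : RawGraph X Y} (hG : G.IsTree) (hr : H.root ∈ G.comp)
    (hle : ∀ a b, H.graph.Adj a b → G.graph.Adj a b) : H.IsTree := by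
  rw [isTree_iff] at hG ⊢
  intro a ha b hab hb
  have ha' := comp_subset_of_le hr hle ha
  refine hG a ha' b (hle a b hab) (comp_subset_of_le (G := G.cut a b) (H := H.cut a b) (root_mem_comp _) ?_ hb)
  intro c d hcd
  rw [cut_adj] at hcd ⊢
  exact ⟨hle c d hcd.1, hcd.2⟩

lemma IsTree.trunc {G : RawGraph X Y} (hG : G.IsTree) (h : ℕ) : (G.trunc h).IsTree :=
  hG.of_le G.root_mem_comp fun _ _ h => h.1

lemma IsTree.cut {G : RawGraph X Y} (hG : G.IsTree) {a : ℕ} (ha : a ∈ G.comp) (b : ℕ) :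
    (G.cut a b).IsTree := hG.of_le ha fun _ _ h => (cut_adj.1 h).1

lemma IsTree.reroot {G : RawGraph X Y} (hG : G.IsTree) {a : ℕ} (ha : a ∈ G.comp) :
    (G.reroot a).IsTree := hG.of_le ha fun _ _ h => h

lemma IsoMap.isTree {f : ℕ → ℕ} {G H : RawGraph X Y} (hf : IsoMap f G H) (hG : G.IsTree) :
    H.IsTree := by
  rw [isTree_iff] at hG ⊢
  intro a' ha' b' hab hb'
  obtain ⟨a, ha, rfl⟩ := hf.surj ha'
  obtain ⟨b, h1, rfl⟩ := hf.lift a ha b' hab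
  have hb := mem_comp_of_adj ha h1
  obtain ⟨c, hc, hcb⟩ := (hf.cut ha hb).surj hb'
  rw [hf.inj (cut_comp_subset ha hc) hb hcb] at hc
  exact hG a ha b h1 hc

end RawGraph

end

/-! ### Gluing rooted graphs at a new root. -/

section

variable {X : Type u} {Y : Type v}

namespace RawGraph

/-! ### The join of rooted graphs -/

section Join

variable {x : X} {S : Finset ℕ} {c : ℕ → RawGraph X Y} {yc yo : ℕ → Y}

lemma join_adj_iff {a b : ℕ} : (join x S c yc yo).graph.Adj a b ↔
    (a = 0 ∧ ∃ i ∈ S, b = Nat.pair i (c i).root + 1) ∨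
    (b = 0 ∧ ∃ i ∈ S, a = Nat.pair i (c i).root + 1) ∨
    ∃ i ∈ S, ∃ m n, (c i).graph.Adj m n ∧ a = Nat.pair i m + 1 ∧ b = Nat.pair i n + 1 := by
  change (SimpleGraph.fromRel _).Adj a b ↔ _
  rw [SimpleGraph.fromRel_adj]
  constructor
  · rintro ⟨-, ⟨i, hi, ⟨h1, h2⟩ | ⟨m, n, h⟩⟩ | ⟨i, hi, ⟨h1, h2⟩ | ⟨m, n, h1, h2, h3⟩⟩⟩
    · exact Or.inl ⟨h1, i, hi, h2⟩
    · exact Or.inr (Or.inr ⟨i, hi, m, n, h⟩)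
    · exact Or.inr (Or.inl ⟨h1, i, hi, h2⟩)
    · exact Or.inr (Or.inr ⟨i, hi, n, m, h1.symm, h3, h2⟩)
  · rintro (⟨rfl, i, hi, rfl⟩ | ⟨rfl, i, hi, rfl⟩ | ⟨i, hi, m, n, h, rfl, rfl⟩)
    · exact ⟨by omega, Or.inl ⟨i, hi, Or.inl ⟨rfl, rfl⟩⟩⟩
    · exact ⟨by omega, Or.inr ⟨i, hi, Or.inl ⟨rfl, rfl⟩⟩⟩
    · refine ⟨fun h' => ?_, Or.inl ⟨i, hi, Or.inr ⟨m, n, h, rfl, rfl⟩⟩⟩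
      have := Nat.pair_eq_pair.1 (Nat.succ_injective h')
      exact h.ne this.2

lemma join_adj_zero {b : ℕ} : (join x S c yc yo).graph.Adj 0 b ↔
    ∃ i ∈ S, b = Nat.pair i (c i).root + 1 := by
  rw [join_adj_iff]
  constructor
  · rintro (⟨-, h⟩ | ⟨-, i, -, h⟩ | ⟨i, -, m, n, -, h, -⟩)
    · exact h
    · omega
    · omega
  · exact fun h => Or.inl ⟨rfl, h⟩

lemma join_adj_pair {i m b : ℕ} : (join x S c yc yo).graph.Adj (Nat.pair i m + 1) b ↔
    i ∈ S ∧ ((b = 0 ∧ m = (c i).root) ∨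
      ∃ n, (c i).graph.Adj m n ∧ b = Nat.pair i n + 1) := by
  rw [join_adj_iff]
  constructor
  · rintro (⟨h, -⟩ | ⟨rfl, j, hj, h⟩ | ⟨j, hj, m', n, h, h1, rfl⟩)
    · omega
    · obtain ⟨rfl, rfl⟩ := Nat.pair_eq_pair.1 (Nat.succ_injective h)
      exact ⟨hj, Or.inl ⟨rfl, rfl⟩⟩
    · obtain ⟨rfl, rfl⟩ := Nat.pair_eq_pair.1 (Nat.succ_injective h1)
      exact ⟨hj, Or.inr ⟨n, h, rfl⟩⟩
  · rintro ⟨hi, ⟨rfl, rfl⟩ | ⟨n, h, rfl⟩⟩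
    · exact Or.inr (Or.inl ⟨rfl, i, hi, rfl⟩)
    · exact Or.inr (Or.inr ⟨i, hi, m, n, h, rfl, rfl⟩)

lemma eq_zero_or_pair (a : ℕ) : a = 0 ∨ ∃ i m, a = Nat.pair i m + 1 := by
  rcases a with _ | a
  · exact Or.inl rfl
  · exact Or.inr ⟨a.unpair.1, a.unpair.2, by simp⟩

/-- Depth shifts by one: the root of each piece is at distance one from the new root, and a walk can
leave a piece only through the root of that piece. -/
lemma pair_mem_join_ball {i m h : ℕ} :
    Nat.pair i m + 1 ∈ (join x S c yc yo).ball (h + 1) ↔ i ∈ S ∧ m ∈ (c i).ball h := by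
  induction h generalizing i m with
  | zero =>
    change (_ = 0 ∨ ∃ a, a = 0 ∧ _) ↔ i ∈ S ∧ m = (c i).root
    simp only [Nat.add_eq_zero_iff, one_ne_zero, and_false, false_or, exists_eq_left,
      join_adj_zero]
    constructor
    · rintro ⟨j, hj, h⟩
      obtain ⟨rfl, rfl⟩ := Nat.pair_eq_pair.1 (Nat.succ_injective h)
      exact ⟨hj, rfl⟩
    · rintro ⟨hi, rfl⟩
      exact ⟨i, hi, rfl⟩
  | succ h ih =>
    rw [ball]
    change (_ ∨ ∃ a, _ ∧ _) ↔ _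
    rw [ih]
    constructor
    · rintro (⟨hi, hm⟩ | ⟨a, ha, hab⟩)
      · exact ⟨hi, Or.inl hm⟩
      · rcases eq_zero_or_pair a with rfl | ⟨j, n, rfl⟩
        · obtain ⟨j, hj, h⟩ := join_adj_zero.1 hab
          obtain ⟨rfl, rfl⟩ := Nat.pair_eq_pair.1 (Nat.succ_injective h)
          exact ⟨hj, root_mem_ball _ _⟩
        · obtain ⟨hj, hn⟩ := ih.1 ha
          obtain ⟨-, ⟨h, -⟩ | ⟨m', h, h1⟩⟩ := join_adj_pair.1 hab
          · omega
          · obtain ⟨rfl, rfl⟩ := Nat.pair_eq_pair.1 (Nat.succ_injective h1)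
            exact ⟨hj, Or.inr ⟨n, hn, h⟩⟩
    · rintro ⟨hi, hm | ⟨n, hn, hnm⟩⟩
      · exact Or.inl ⟨hi, hm⟩
      · exact Or.inr ⟨_, ih.2 ⟨hi, hn⟩, join_adj_pair.2 ⟨hi, Or.inr ⟨m, hnm, rfl⟩⟩⟩

lemma pair_mem_join_comp {i m : ℕ} :
    Nat.pair i m + 1 ∈ (join x S c yc yo).comp ↔ i ∈ S ∧ m ∈ (c i).comp := by
  rw [mem_comp_iff]
  constructor
  · rintro ⟨h, hm⟩
    have := pair_mem_join_ball.1 (ball_mono h.le_succ hm)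
    exact ⟨this.1, ball_subset_comp _ _ this.2⟩
  · rintro ⟨hi, hm⟩
    obtain ⟨h, hm⟩ := mem_comp_iff.1 hm
    exact ⟨h + 1, pair_mem_join_ball.2 ⟨hi, hm⟩⟩

lemma join_vmark_pair {i m : ℕ} :
    (join x S c yc yo).vmark (Nat.pair i m + 1) = (c i).vmark m := by
  change (c (Nat.unpair (Nat.pair i m)).1).vmark (Nat.unpair (Nat.pair i m)).2 = _
  rw [Nat.unpair_pair]

lemma join_emark_zero_pair {i m : ℕ} :
    (join x S c yc yo).emark 0 (Nat.pair i m + 1) = yo i := by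
  change yo (Nat.unpair (Nat.pair i m)).1 = _
  rw [Nat.unpair_pair]

lemma join_emark_pair_zero {i m : ℕ} :
    (join x S c yc yo).emark (Nat.pair i m + 1) 0 = yc i := by
  change yc (Nat.unpair (Nat.pair i m)).1 = _
  rw [Nat.unpair_pair]

lemma join_emark_pair_pair {i m n : ℕ} :
    (join x S c yc yo).emark (Nat.pair i m + 1) (Nat.pair i n + 1) = (c i).emark m n := by
  change (c (Nat.unpair (Nat.pair i m)).1).emark (Nat.unpair (Nat.pair i m)).2
    (Nat.unpair (Nat.pair i n)).2 = _
  rw [Nat.unpair_pair, Nat.unpair_pair]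

lemma trunc_join (h : ℕ) : (join x S c yc yo).trunc (h + 1) =
    join x S (fun i => (c i).trunc h) yc yo := by
  refine ext_of_adj rfl (fun a b => ?_) ?_ ?_
  · rw [trunc_adj]
    rcases eq_zero_or_pair a with rfl | ⟨i, m, rfl⟩
    · rw [join_adj_zero, join_adj_zero]
      refine ⟨fun h => h.1, fun ⟨i, hi, hb⟩ => ⟨⟨i, hi, hb⟩, root_mem_ball _ _, ?_⟩⟩
      subst hb
      exact pair_mem_join_ball.2 ⟨hi, root_mem_ball _ _⟩
    · rw [join_adj_pair, join_adj_pair, pair_mem_join_ball]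
      constructor
      · rintro ⟨⟨hi, ⟨rfl, rfl⟩ | ⟨n, hmn, rfl⟩⟩, ha, hb⟩
        · exact ⟨hi, Or.inl ⟨rfl, rfl⟩⟩
        · exact ⟨hi, Or.inr ⟨n, trunc_adj.2 ⟨hmn, ha.2, (pair_mem_join_ball.1 hb).2⟩, rfl⟩⟩
      · rintro ⟨hi, ⟨rfl, rfl⟩ | ⟨n, hmn, rfl⟩⟩
        · exact ⟨⟨hi, Or.inl ⟨rfl, rfl⟩⟩, ⟨hi, root_mem_ball _ _⟩, root_mem_ball _ _⟩
        · rw [trunc_adj] at hmn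
          exact ⟨⟨hi, Or.inr ⟨n, hmn.1, rfl⟩⟩, ⟨hi, hmn.2.1⟩,
            pair_mem_join_ball.2 ⟨hi, hmn.2.2⟩⟩
  · funext a
    rcases a with _ | a <;> rfl
  · funext a b
    rcases a with _ | a <;> rcases b with _ | b <;> rfl

lemma isoMap_join_cut {i : ℕ} (hi : i ∈ S) : IsoMap (fun m => Nat.pair i m + 1) (c i)
    ((join x S c yc yo).cut (Nat.pair i (c i).root + 1) 0) := by
  refine ⟨rfl, ?_, ?_, ?_, 
    fun a _ => join_vmark_pair (x := x) (S := S) (yc := yc) (yo := yo),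
    fun a _ b _ => join_emark_pair_pair (x := x) (S := S) (yc := yc) (yo := yo)⟩
  · intro a _ b hab
    rw [cut_adj, join_adj_pair]
    exact ⟨⟨hi, Or.inr ⟨b, hab, rfl⟩⟩, by omega⟩
  · intro a _ b' hab
    rw [cut_adj, join_adj_pair] at hab
    obtain ⟨⟨-, ⟨rfl, rfl⟩ | ⟨n, hmn, rfl⟩⟩, h⟩ := hab
    · exact absurd (Or.inl ⟨rfl, rfl⟩) h
    · exact ⟨n, hmn, rfl⟩
  · intro a _ b _ h
    exact (Nat.pair_eq_pair.1 (Nat.succ_injective h)).2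

/-- Seen from the new root, deleting its edge to a piece is the same as never having glued that
piece: its labels survive but are unreachable. Hence root-side branches are again joins. -/
lemma isoMap_join_erase {i : ℕ} : IsoMap id (join x (S.erase i) c yc yo)
    ((join x S c yc yo).cut 0 (Nat.pair i (c i).root + 1)) := by
  refine ⟨rfl, ?_, ?_, Set.injOn_id _, fun a _ => rfl, fun a _ b _ => rfl⟩
  · intro a ha b hab
    simp only [id]
    rw [cut_adj]
    rcases eq_zero_or_pair a with rfl | ⟨j, m, rfl⟩
    · rw [join_adj_zero] at hab ⊢
      obtain ⟨j, hj, rfl⟩ := hab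
      rw [Finset.mem_erase] at hj
      refine ⟨⟨j, hj.2, rfl⟩, ?_⟩
      rintro (⟨-, h⟩ | ⟨h, -⟩)
      · exact hj.1 (Nat.pair_eq_pair.1 (Nat.succ_injective h)).1
      · omega
    · rw [join_adj_pair] at hab ⊢
      rw [Finset.mem_erase] at hab
      refine ⟨⟨hab.1.2, hab.2⟩, ?_⟩
      rintro (⟨h, -⟩ | ⟨h, -⟩)
      · omega
      · exact hab.1.1 (Nat.pair_eq_pair.1 (Nat.succ_injective h)).1
  · intro a ha b hab
    simp only [id] at hab ⊢
    refine ⟨b, ?_, rfl⟩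
    rw [cut_adj] at hab
    rcases eq_zero_or_pair a with rfl | ⟨j, m, rfl⟩
    · rw [join_adj_zero] at hab ⊢
      obtain ⟨⟨j, hj, rfl⟩, h⟩ := hab
      refine ⟨j, Finset.mem_erase.2 ⟨?_, hj⟩, rfl⟩
      rintro rfl
      exact h (Or.inl ⟨rfl, rfl⟩)
    · rw [join_adj_pair] at hab ⊢
      exact ⟨(pair_mem_join_comp.1 ha).1, hab.1.2⟩

lemma join_nbrs : (join x S c yc yo).nbrs = S.image fun i => Nat.pair i (c i).root + 1 := by
  ext b
  rw [mem_nbrs]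
  change (join x S c yc yo).graph.Adj 0 b ↔ _
  rw [join_adj_zero, Finset.mem_image]
  simp only [eq_comm]

lemma join_down {i : ℕ} (hi : i ∈ S) (n : ℕ) :
    (join x S c yc yo).down n (Nat.pair i (c i).root + 1) =
      (MGraph.mk ((c i).trunc n), yc i) := by
  refine Prod.ext ?_ (join_emark_pair_zero (x := x) (S := S) (c := c) (yo := yo))
  exact ((isoMap_join_cut hi).trunc n).mk_eq.symm

lemma join_up {i : ℕ} (n : ℕ) :
    (join x S c yc yo).up n (Nat.pair i (c i).root + 1) =
      (MGraph.mk ((join x (S.erase i) c yc yo).trunc n), yo i) := by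
  refine Prod.ext ?_ (join_emark_zero_pair (x := x) (S := S) (c := c) (yc := yc))
  exact (isoMap_join_erase.trunc n).mk_eq.symm

/-- Edges at the new root are bridges by the two isomorphisms for cuts. For an edge inside a piece,
collapsing everything outside onto the root of the piece turns a detour in the join into a detour in
the piece. -/
lemma join_isTree (hc : ∀ i ∈ S, (c i).IsTree) : (join x S c yc yo).IsTree := by
  rw [isTree_iff]
  intro a ha b hab hb
  rcases eq_zero_or_pair a with rfl | ⟨i, m, rfl⟩
  · obtain ⟨i, hi, rfl⟩ := join_adj_zero.1 hab
    obtain ⟨d, hd, rfl⟩ := isoMap_join_erase.surj hb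
    exact (Finset.notMem_erase i S) (pair_mem_join_comp.1 hd).1
  · obtain ⟨hi, ⟨rfl, rfl⟩ | ⟨n, hmn, rfl⟩⟩ := join_adj_pair.1 hab
    · obtain ⟨d, -, h⟩ := (isoMap_join_cut hi).surj hb
      exact absurd h (Nat.succ_ne_zero _)
    · have hm := (pair_mem_join_comp.1 ha).2
      refine isTree_iff.1 (hc i hi) m hm n hmn ?_
      -- `P v` says that the image of `v` under this collapse lies in the component of `m` after
      -- removal of the edge `{m, n}`.
      let P : ℕ → Prop := fun v => (∀ k, v = Nat.pair i k + 1 → k ∈ ((c i).cut m n).comp) ∧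
        ((v = 0 ∨ ∃ j k, j ≠ i ∧ v = Nat.pair j k + 1) →
          (c i).root ∈ ((c i).cut m n).comp)
      have key : P (Nat.pair i n + 1) := by
        refine comp_induction (P := P) ⟨?_, ?_⟩ ?_ hb
        · intro k hk
          change Nat.pair i m + 1 = _ at hk
          rw [← (Nat.pair_eq_pair.1 (Nat.succ_injective hk)).2]
          exact root_mem_comp ((c i).cut m n)
        · rintro (h | ⟨j, k, hj, h⟩)
          · exact absurd h (Nat.succ_ne_zero _)
          · exact absurd (Nat.pair_eq_pair.1 (Nat.succ_injective h)).1.symm hj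
        · intro v w _ hvw hv
          rw [cut_adj] at hvw
          rcases eq_zero_or_pair v with rfl | ⟨j, k, rfl⟩
          · have h0 := hv.2 (Or.inl rfl)
            refine ⟨?_, fun _ => h0⟩
            rintro k rfl
            obtain ⟨j, hj, h⟩ := join_adj_zero.1 hvw.1
            obtain ⟨rfl, rfl⟩ := Nat.pair_eq_pair.1 (Nat.succ_injective h)
            exact h0
          · obtain ⟨hj, ⟨rfl, rfl⟩ | ⟨l, hkl, rfl⟩⟩ := join_adj_pair.1 hvw.1
            · refine ⟨fun k h => by omega, fun _ => ?_⟩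
              rcases eq_or_ne j i with rfl | hji
              · exact hv.1 _ rfl
              · exact hv.2 (Or.inr ⟨j, _, hji, rfl⟩)
            · rcases eq_or_ne j i with rfl | hji
              · have hk := hv.1 _ rfl
                refine ⟨?_, ?_⟩
                · intro l' h
                  obtain ⟨-, rfl⟩ := Nat.pair_eq_pair.1 (Nat.succ_injective h)
                  refine mem_comp_of_adj hk (cut_adj.2 ⟨hkl, fun h => hvw.2 ?_⟩)
                  rcases h with ⟨rfl, rfl⟩ | ⟨rfl, rfl⟩
                  · exact Or.inl ⟨rfl, rfl⟩
                  · exact Or.inr ⟨rfl, rfl⟩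
                · rintro (h | ⟨j', k', hj', h⟩)
                  · exact absurd h (Nat.succ_ne_zero _)
                  · exact absurd (Nat.pair_eq_pair.1 (Nat.succ_injective h)).1.symm hj'
              · have h0 := hv.2 (Or.inr ⟨j, k, hji, rfl⟩)
                refine ⟨?_, fun _ => h0⟩
                intro l' h
                exact absurd (Nat.pair_eq_pair.1 (Nat.succ_injective h)).1 hji
      exact key.1 n rfl

@[simp] lemma cut_root (G : RawGraph X Y) (a b : ℕ) : (G.cut a b).root = a := rfl

@[simp] lemma cut_vmark (G : RawGraph X Y) (a b : ℕ) : (G.cut a b).vmark = G.vmark := rfl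

@[simp] lemma cut_emark (G : RawGraph X Y) (a b : ℕ) : (G.cut a b).emark = G.emark := rfl

/-- A tree is the join of the trees below the neighbours of the root. -/
lemma IsTree.isoMap_join {G : RawGraph X Y} (hG : G.IsTree) :
    IsoMap (fun a => if a = 0 then G.root else (a - 1).unpair.2)
      (join (G.vmark G.root) G.nbrs (fun i => G.cut i G.root) (fun i => G.emark i G.root)
        fun i => G.emark G.root i) G := by
  have h1 : ∀ i ∈ G.nbrs, G.root ∉ (G.cut i G.root).comp := fun i hi =>
    isTree_iff.1 hG i (mem_comp_of_mem_nbrs hi) _ (mem_nbrs.1 hi).symm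
  -- Branches below different neighbours are disjoint: a common vertex would connect `i` to `j`, and
  -- then to the root, without using the edge between `i` and the root.
  have h2 : ∀ i ∈ G.nbrs, ∀ j ∈ G.nbrs, ∀ m, m ∈ (G.cut i G.root).comp →
      m ∈ (G.cut j G.root).comp → i = j := by
    intro i hi j hj m hmi hmj
    by_contra hij
    have h3 : ∀ v ∈ (G.cut j G.root).comp, (G.cut i G.root).graph.Reachable j v := by
      intro v hv
      refine comp_induction (G := G.cut j G.root)
        (P := fun v => (G.cut i G.root).graph.Reachable j v) (SimpleGraph.Reachable.refl _) ?_ hv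
      intro v w hv hvw ih
      refine ih.trans (SimpleGraph.Adj.reachable (cut_adj.2 ⟨(cut_adj.1 hvw).1, ?_⟩))
      rintro (⟨-, rfl⟩ | ⟨rfl, -⟩)
      · exact h1 j hj (mem_comp_of_adj hv hvw)
      · exact h1 j hj hv
    have h4 : j ∈ (G.cut i G.root).comp :=
      SimpleGraph.Reachable.trans hmi (h3 m hmj).symm
    refine h1 i hi (mem_comp_of_adj h4 (cut_adj.2 ⟨(mem_nbrs.1 hj).symm, ?_⟩))
    rintro (⟨h, -⟩ | ⟨h, -⟩)
    · exact hij h.symm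
    · rw [h] at hj
      exact (mem_nbrs.1 hj).ne rfl
  refine ⟨rfl, ?_, ?_, ?_, ?_, ?_⟩
  · intro a ha b hab
    rcases eq_zero_or_pair a with rfl | ⟨i, m, rfl⟩
    · obtain ⟨i, hi, rfl⟩ := join_adj_zero.1 hab
      simpa using mem_nbrs.1 hi
    · obtain ⟨hi, ⟨rfl, rfl⟩ | ⟨n, hmn, rfl⟩⟩ := join_adj_pair.1 hab
      · simpa using (mem_nbrs.1 hi).symm
      · simpa using (cut_adj.1 hmn).1
  · intro a ha b' hab
    rcases eq_zero_or_pair a with rfl | ⟨i, m, rfl⟩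
    · exact ⟨Nat.pair b' b' + 1, join_adj_zero.2 ⟨b', mem_nbrs.2 (by simpa using hab), rfl⟩,
        by simp⟩
    · obtain ⟨hi, hm⟩ := pair_mem_join_comp.1 ha
      have hab' : G.graph.Adj m b' := by simpa using hab
      by_cases h : (m = i ∧ b' = G.root) ∨ (m = G.root ∧ b' = i)
      · rcases h with ⟨rfl, rfl⟩ | ⟨rfl, rfl⟩
        · exact ⟨0, join_adj_pair.2 ⟨hi, Or.inl ⟨rfl, rfl⟩⟩, by simp⟩
        · exact absurd hm (h1 _ hi)
      · exact ⟨Nat.pair i b' + 1,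
          join_adj_pair.2 ⟨hi, Or.inr ⟨b', cut_adj.2 ⟨hab', h⟩, rfl⟩⟩, by simp⟩
  · intro a ha b hb hab
    rcases eq_zero_or_pair a with rfl | ⟨i, m, rfl⟩ <;>
      rcases eq_zero_or_pair b with rfl | ⟨j, n, rfl⟩
    · rfl
    · obtain ⟨hj, hn⟩ := pair_mem_join_comp.1 hb
      have : G.root = n := by simpa using hab
      exact absurd (this ▸ hn) (h1 j hj)
    · obtain ⟨hi, hm⟩ := pair_mem_join_comp.1 ha
      have : m = G.root := by simpa using hab
      exact absurd (this ▸ hm) (h1 i hi)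
    · obtain ⟨hi, hm⟩ := pair_mem_join_comp.1 ha
      obtain ⟨hj, hn⟩ := pair_mem_join_comp.1 hb
      have : m = n := by simpa using hab
      subst this
      rw [h2 i hi j hj m hm hn]
  · intro a ha
    rcases eq_zero_or_pair a with rfl | ⟨i, m, rfl⟩
    · rfl
    · rw [join_vmark_pair]; simp
  · intro a ha b hab
    rcases eq_zero_or_pair a with rfl | ⟨i, m, rfl⟩
    · obtain ⟨i, hi, rfl⟩ := join_adj_zero.1 hab
      rw [join_emark_zero_pair]; simp
    · obtain ⟨hi, ⟨rfl, rfl⟩ | ⟨n, hmn, rfl⟩⟩ := join_adj_pair.1 hab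
      · rw [join_emark_pair_zero]; simp
      · rw [join_emark_pair_pair]; simp

/-- The class of a join depends only on the family of classes of the pieces and marks, up to
reindexing: isomorphisms of the pieces are glued along the bijection of the indices. -/
lemma join_congr {S' : Finset ℕ} {c' : ℕ → RawGraph X Y} {yc' yo' : ℕ → Y} (e : S ≃ S')
    (hc : ∀ i : S, MGraph.mk (c i) = MGraph.mk (c' (e i))) (hyc : ∀ i : S, yc i = yc' (e i))
    (hyo : ∀ i : S, yo i = yo' (e i)) :
    MGraph.mk (join x S c yc yo) = MGraph.mk (join x S' c' yc' yo') := by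
  classical
  choose g hg using fun i : S => exists_isoMap_of_mk_eq (hc i)
  let f : ℕ → ℕ := fun a => if a = 0 then 0 else
    if h : (a - 1).unpair.1 ∈ S then
      Nat.pair (e ⟨_, h⟩) (g ⟨_, h⟩ (a - 1).unpair.2) + 1 else 0
  have f0 : f 0 = 0 := rfl
  have fp : ∀ i (hi : i ∈ S) m, f (Nat.pair i m + 1) = Nat.pair (e ⟨i, hi⟩) (g ⟨i, hi⟩ m) + 1 := by
    intro i hi m
    have : (Nat.unpair (Nat.pair i m + 1 - 1)) = (i, m) := by simp
    simp only [f, Nat.succ_ne_zero, if_false, this]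
    rw [dif_pos hi]
  refine IsoMap.mk_eq (f := f) ⟨f0, ?_, ?_, ?_, ?_, ?_⟩
  · intro a ha b hab
    rcases eq_zero_or_pair a with rfl | ⟨i, m, rfl⟩
    · obtain ⟨i, hi, rfl⟩ := join_adj_zero.1 hab
      rw [f0, fp i hi, join_adj_zero]
      exact ⟨e ⟨i, hi⟩, (e ⟨i, hi⟩).2, by rw [(hg ⟨i, hi⟩).root]⟩
    · obtain ⟨hi, hm⟩ := pair_mem_join_comp.1 ha
      rw [fp i hi, join_adj_pair]
      refine ⟨(e ⟨i, hi⟩).2, ?_⟩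
      obtain ⟨-, ⟨rfl, rfl⟩ | ⟨n, hmn, rfl⟩⟩ := join_adj_pair.1 hab
      · exact Or.inl ⟨f0, (hg ⟨i, hi⟩).root⟩
      · exact Or.inr ⟨_, (hg ⟨i, hi⟩).adj m hm n hmn, fp i hi n⟩
  · intro a ha b' hab
    rcases eq_zero_or_pair a with rfl | ⟨i, m, rfl⟩
    · rw [f0, join_adj_zero] at hab
      obtain ⟨j, hj, rfl⟩ := hab
      have hi := (e.symm ⟨j, hj⟩).2
      refine ⟨Nat.pair (e.symm ⟨j, hj⟩) (c (e.symm ⟨j, hj⟩)).root + 1,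
        join_adj_zero.2 ⟨_, hi, rfl⟩, ?_⟩
      rw [fp _ hi, (hg ⟨_, hi⟩).root]
      simp
    · obtain ⟨hi, hm⟩ := pair_mem_join_comp.1 ha
      rw [fp i hi, join_adj_pair] at hab
      obtain ⟨-, ⟨rfl, h⟩ | ⟨n, hmn, rfl⟩⟩ := hab
      · refine ⟨0, join_adj_pair.2 ⟨hi, Or.inl ⟨rfl, ?_⟩⟩, f0⟩
        rw [← (hg ⟨i, hi⟩).root] at h
        exact (hg ⟨i, hi⟩).inj hm (root_mem_comp _) h
      · obtain ⟨n, h, rfl⟩ := (hg ⟨i, hi⟩).lift m hm n hmn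
        exact ⟨_, join_adj_pair.2 ⟨hi, Or.inr ⟨n, h, rfl⟩⟩, fp i hi n⟩
  · intro a ha b hb hab
    rcases eq_zero_or_pair a with rfl | ⟨i, m, rfl⟩ <;>
      rcases eq_zero_or_pair b with rfl | ⟨j, n, rfl⟩
    · rfl
    · obtain ⟨hj, hn⟩ := pair_mem_join_comp.1 hb
      rw [f0, fp j hj] at hab
      omega
    · obtain ⟨hi, hm⟩ := pair_mem_join_comp.1 ha
      rw [f0, fp i hi] at hab
      omega
    · obtain ⟨hi, hm⟩ := pair_mem_join_comp.1 ha
      obtain ⟨hj, hn⟩ := pair_mem_join_comp.1 hb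
      rw [fp i hi, fp j hj] at hab
      obtain ⟨h1, h2⟩ := Nat.pair_eq_pair.1 (Nat.succ_injective hab)
      have h3 := congrArg Subtype.val (e.injective (Subtype.ext h1))
      simp only at h3
      subst h3
      rw [(hg ⟨i, hi⟩).inj hm hn h2]
  · intro a ha
    rcases eq_zero_or_pair a with rfl | ⟨i, m, rfl⟩
    · rfl
    · obtain ⟨hi, hm⟩ := pair_mem_join_comp.1 ha
      rw [fp i hi, join_vmark_pair, join_vmark_pair, (hg ⟨i, hi⟩).vmark m hm]
  · intro a ha b hab
    rcases eq_zero_or_pair a with rfl | ⟨i, m, rfl⟩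
    · obtain ⟨i, hi, rfl⟩ := join_adj_zero.1 hab
      rw [f0, fp i hi, join_emark_zero_pair, join_emark_zero_pair, ← hyo ⟨i, hi⟩]
    · obtain ⟨hi, hm⟩ := pair_mem_join_comp.1 ha
      obtain ⟨-, ⟨rfl, rfl⟩ | ⟨n, hmn, rfl⟩⟩ := join_adj_pair.1 hab
      · rw [f0, fp i hi, join_emark_pair_zero, join_emark_pair_zero, ← hyc ⟨i, hi⟩]
      · rw [fp i hi, fp i hi, join_emark_pair_pair, join_emark_pair_pair,
          (hg ⟨i, hi⟩).emark m hm n hmn]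

lemma mk_trunc_zero [Nonempty Y] (G : RawGraph X Y) :
    MGraph.mk (G.trunc 0) = MGraph.mk (point (G.vmark G.root)) := by
  have hc : ∀ a ∈ (G.trunc 0).comp, a = G.root := fun a ha => by
    rw [trunc_comp] at ha; exact ha
  have hn : ∀ a ∈ (G.trunc 0).comp, ∀ b, ¬ (G.trunc 0).graph.Adj a b := fun a ha b hab =>
    hab.ne ((hc a ha).trans (hc b (mem_comp_of_adj ha hab)).symm)
  refine IsoMap.mk_eq (f := fun _ => 0) ⟨rfl, fun a ha b hab => (hn a ha b hab).elim,
    fun a ha b' hab => ?_, fun a ha b hb _ => (hc a ha).trans (hc b hb).symm, fun a ha => ?_,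
    fun a ha b hab => (hn a ha b hab).elim⟩
  · exact absurd hab (by simp [point])
  · rw [hc a ha]; rfl

end Join

end RawGraph

end

/-! ### Unlabelled trees as a root mark with a multiset of marked branches. -/

section

variable {X : Type u} {Y : Type v}

/-! ### Families with the same multiset of values -/

lemma card_fiber_eq_count {ι E : Type*} [Fintype ι] [DecidableEq E] (g : ι → E) (e : E) :
    Fintype.card {i // g i = e} = (Finset.univ.val.map g).count e := by
  rw [Multiset.count_map, Fintype.card_subtype]
  simp only [eq_comm (a := e)]
  rfl

/-- Equal multisets have equal multiplicities, so the fibres over each value have the same size;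
bijections of the fibres are glued together. -/
lemma exists_equiv_of_map_eq {ι ι' E : Type*} [Fintype ι] [Fintype ι'] {g : ι → E} {g' : ι' → E}
    (h : Finset.univ.val.map g = Finset.univ.val.map g') : ∃ e : ι ≃ ι', ∀ i, g' (e i) = g i := by
  classical
  have key : ∀ c, Nonempty ({i // g i = c} ≃ {i // g' i = c}) := fun c => by
    refine Fintype.card_eq.1 ?_
    convert (card_fiber_eq_count g c).trans (h ▸ (card_fiber_eq_count g' c).symm)
  let e := fun c => (key c).some
  exact ⟨Equiv.ofFiberEquiv e, Equiv.ofFiberEquiv_map e⟩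

lemma map_univ_coe {E : Type*} (S : Finset ℕ) (g : ℕ → E) :
    (Finset.univ : Finset S).val.map (fun i : S => g i) = S.val.map g :=
  Multiset.attach_map_val' S.val g

/-! ### Unlabelled trees -/

@[simp] lemma MGraph.mk_rep (τ : MGraph X Y) : MGraph.mk τ.rep = τ := Quotient.out_eq τ

lemma exists_isoMap_rep (G : RawGraph X Y) : ∃ f, RawGraph.IsoMap f G (MGraph.mk G).rep :=
  RawGraph.exists_isoMap_of_mk_eq (MGraph.mk_rep _).symm

@[simp] lemma trunc_mk (h : ℕ) (G : RawGraph X Y) :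
    trunc h (MGraph.mk G) = MGraph.mk (G.trunc h) := by
  obtain ⟨f, hf⟩ := exists_isoMap_rep G
  exact (hf.trunc h).mk_eq.symm

lemma trunc_trunc (h k : ℕ) (τ : MGraph X Y) : trunc k (trunc h τ) = trunc (min h k) τ := by
  rw [← τ.mk_rep, trunc_mk, trunc_mk, trunc_mk, RawGraph.trunc_trunc]

@[simp] lemma rootMark_mk (G : RawGraph X Y) : rootMark (MGraph.mk G) = G.vmark G.root := by
  obtain ⟨f, hf⟩ := exists_isoMap_rep G
  rw [rootMark, ← hf.root, hf.vmark _ G.root_mem_comp]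

@[simp] lemma rootMark_trunc (h : ℕ) (τ : MGraph X Y) : rootMark (trunc h τ) = rootMark τ := by
  rw [← τ.mk_rep, trunc_mk, rootMark_mk, rootMark_mk]
  rfl

/-- The represented graph is a tree. -/
def MGraph.IsTree (τ : MGraph X Y) : Prop := τ.rep.IsTree

@[simp] lemma isTree_mk {G : RawGraph X Y} : (MGraph.mk G).IsTree ↔ G.IsTree := by
  obtain ⟨f, hf⟩ := exists_isoMap_rep G
  obtain ⟨g, hg⟩ := RawGraph.exists_isoMap_of_mk_eq (MGraph.mk_rep (MGraph.mk G))
  exact ⟨hg.isTree, hf.isTree⟩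

lemma MGraph.IsTree.trunc {τ : MGraph X Y} (hτ : τ.IsTree) (h : ℕ) :
    (MarkedTree.trunc h τ).IsTree := by
  rw [← τ.mk_rep, trunc_mk, isTree_mk]
  exact RawGraph.IsTree.trunc hτ h

/-- The pairs of branches `(τ(a ∖ o)_i, τ(o ∖ a)_j)` for the neighbours `a` of the root `o`. -/
def RawGraph.ends (i j : ℕ) (G : RawGraph X Y) : Multiset (Branch X Y × Branch X Y) :=
  G.nbrs.val.map fun a => (G.down i a, G.up j a)

/-- The pairs of branches `(τ(a ∖ o)_i, τ(o ∖ a)_j)` for the neighbours `a` of the root `o`. -/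
def ends (i j : ℕ) (τ : MGraph X Y) : Multiset (Branch X Y × Branch X Y) := τ.rep.ends i j

lemma RawGraph.IsoMap.nbrs_eq {f : ℕ → ℕ} {G H : RawGraph X Y} (hf : RawGraph.IsoMap f G H) :
    H.nbrs.val = G.nbrs.val.map f := by
  have : H.nbrs = G.nbrs.image f := by
    ext b
    rw [Finset.mem_image, mem_nbrs, ← hf.root]
    constructor
    · intro h
      obtain ⟨a, ha, rfl⟩ := hf.lift _ G.root_mem_comp _ h
      exact ⟨a, mem_nbrs.2 ha, rfl⟩
    · rintro ⟨a, ha, rfl⟩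
      exact hf.adj _ G.root_mem_comp a (mem_nbrs.1 ha)
  rw [this, Finset.image_val_of_injOn]
  exact hf.inj.mono fun a ha => mem_comp_of_mem_nbrs ha

/-- The multiset of pairs of branches does not depend on the representative, whereas the individual
branches `down` and `up` are indexed by labels. -/
lemma RawGraph.IsoMap.ends_eq {f : ℕ → ℕ} {G H : RawGraph X Y} (hf : RawGraph.IsoMap f G H)
    (i j : ℕ) : H.ends i j = G.ends i j := by
  rw [RawGraph.ends, RawGraph.ends, hf.nbrs_eq, Multiset.map_map]
  refine Multiset.map_congr rfl fun a ha => ?_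
  have ha' := mem_nbrs.1 ha
  simp only [Function.comp, RawGraph.down, RawGraph.up, ← hf.root]
  rw [hf.branch_eq (mem_comp_of_adj G.root_mem_comp ha') ha'.symm,
    hf.branch_eq G.root_mem_comp ha']

@[simp] lemma ends_mk (i j : ℕ) (G : RawGraph X Y) : ends i j (MGraph.mk G) = G.ends i j := by
  obtain ⟨f, hf⟩ := exists_isoMap_rep G
  exact hf.ends_eq i j

lemma card_ends (i j : ℕ) (τ : MGraph X Y) : Multiset.card (ends i j τ) = deg τ := by
  rw [ends, RawGraph.ends, Multiset.card_map]
  rfl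

lemma RawGraph.join_ends {x : X} {S : Finset ℕ} {c : ℕ → RawGraph X Y} {yc yo : ℕ → Y}
    (i j : ℕ) : (RawGraph.join x S c yc yo).ends i j = S.val.map fun a =>
      ((MGraph.mk ((c a).trunc i), yc a),
        (MGraph.mk ((RawGraph.join x (S.erase a) c yc yo).trunc j), yo a)) := by
  rw [RawGraph.ends, RawGraph.join_nbrs, Finset.image_val_of_injOn, Multiset.map_map]
  · refine Multiset.map_congr rfl fun a ha => ?_
    simp only [Function.comp, join_down ha, join_up]
  · intro a _ b _ h
    exact (Nat.pair_eq_pair.1 (Nat.succ_injective h)).1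

variable [Nonempty Y]

/-- The truncation of a branch. -/
def truncBranch (n : ℕ) (t : Branch X Y) : Branch X Y := (trunc n t.1, t.2)

/-- The truncation of a branch that carries an additional mark. -/
def truncEntry (n : ℕ) (e : Branch X Y × Y) : Branch X Y × Y := (truncBranch n e.1, e.2)

/-- The graph which is obtained by joining a root with mark `x` to the graphs in `M`; an entry
`((t, y), y')` stands for the graph `t` and an edge with mark `y` at the root of `t` and mark `y'`
at the new root. -/
def graft (x : X) (M : Multiset (Branch X Y × Y)) : MGraph X Y :=
  MGraph.mk (RawGraph.join x (Finset.range M.card)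
    (fun i => (M.toList.getD i ((MGraph.mk (RawGraph.point x), Classical.arbitrary Y),
      Classical.arbitrary Y)).1.1.rep)
    (fun i => (M.toList.getD i ((MGraph.mk (RawGraph.point x), Classical.arbitrary Y),
      Classical.arbitrary Y)).1.2)
    (fun i => (M.toList.getD i ((MGraph.mk (RawGraph.point x), Classical.arbitrary Y),
      Classical.arbitrary Y)).2))

lemma map_range_getD {α : Type*} (l : List α) (d : α) :
    (Multiset.range l.length).map (fun i => l.getD i d) = (l : Multiset α) := by
  rw [Multiset.range, Multiset.map_coe]
  congr 1
  apply List.ext_getElem (by simp)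
  intro n h1 h2
  simp [List.getD, h2]

/-- Every join is a `graft`, so the labels of its pieces can be forgotten. From here on trees are
handled as a root mark with a multiset of entries. -/
lemma mk_join (x : X) (S : Finset ℕ) (c : ℕ → RawGraph X Y) (yc yo : ℕ → Y) :
    MGraph.mk (RawGraph.join x S c yc yo) =
      graft x (S.val.map fun i => ((MGraph.mk (c i), yc i), yo i)) := by
  set M := S.val.map fun i => ((MGraph.mk (c i), yc i), yo i) with hM
  set d : Branch X Y × Y := ((MGraph.mk (RawGraph.point x), Classical.arbitrary Y),
    Classical.arbitrary Y) with hd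
  have h1 : S.val.map (fun i => ((MGraph.mk (c i), yc i), yo i)) =
      (Finset.range M.card).val.map (fun i => M.toList.getD i d) := by
    have := map_range_getD M.toList d
    rw [Multiset.length_toList, Multiset.coe_toList] at this
    exact this.symm
  rw [← map_univ_coe, ← map_univ_coe (Finset.range M.card)] at h1
  obtain ⟨e, he⟩ := exists_equiv_of_map_eq h1
  refine RawGraph.join_congr e (fun i => ?_) (fun i => ?_) fun i => ?_
  · have := congrArg (fun e => e.1.1) (he i)
    rw [MGraph.mk_rep]
    exact this.symm
  · exact (congrArg (fun e => e.1.2) (he i)).symm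
  · exact (congrArg (fun e => e.2) (he i)).symm

/-- Every graft is represented by a join over a finite set of labels. -/
lemma exists_join (x : X) (M : Multiset (Branch X Y × Y)) : ∃ (S : Finset ℕ)
    (c : ℕ → RawGraph X Y) (yc yo : ℕ → Y),
    (S.val.map fun i => ((MGraph.mk (c i), yc i), yo i)) = M := by
  let d : Branch X Y × Y := ((MGraph.mk (RawGraph.point x), Classical.arbitrary Y),
    Classical.arbitrary Y)
  refine ⟨Finset.range M.card, fun i => (M.toList.getD i d).1.1.rep,
    fun i => (M.toList.getD i d).1.2, fun i => (M.toList.getD i d).2, ?_⟩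
  simp only [MGraph.mk_rep]
  have := map_range_getD M.toList d
  rw [Multiset.length_toList, Multiset.coe_toList] at this
  exact this

@[simp] lemma rootMark_graft (x : X) (M : Multiset (Branch X Y × Y)) :
    rootMark (graft x M) = x := by
  rw [graft, rootMark_mk]; rfl

lemma map_erase_eq {α : Type*} [DecidableEq α] {S : Finset ℕ} (g : ℕ → α) {a : ℕ} (ha : a ∈ S) :
    (S.erase a).val.map g = (S.val.map g).erase (g a) := by
  rw [Finset.erase_val]
  exact Multiset.map_erase_of_mem g S.val ha

open Classical in
-- The branch of the root that is seen from one entry is the graft of all the other entries.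
lemma ends_graft (i j : ℕ) (x : X) (M : Multiset (Branch X Y × Y)) :
    ends i j (graft x M) = M.map fun e =>
      (truncBranch i e.1, (trunc j (graft x (M.erase e)), e.2)) := by
  obtain ⟨S, c, yc, yo, rfl⟩ := exists_join x M
  rw [← mk_join, ends_mk, RawGraph.join_ends, Multiset.map_map]
  refine Multiset.map_congr rfl fun a ha => ?_
  simp only [Function.comp, truncBranch, trunc_mk]
  rw [← map_erase_eq (fun i => ((MGraph.mk (c i), yc i), yo i)) ha, ← mk_join, trunc_mk]

lemma trunc_succ_graft (k : ℕ) (x : X) (M : Multiset (Branch X Y × Y)) :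
    trunc (k + 1) (graft x M) = graft x (M.map (truncEntry k)) := by
  obtain ⟨S, c, yc, yo, rfl⟩ := exists_join x M
  rw [← mk_join, trunc_mk, RawGraph.trunc_join, mk_join, Multiset.map_map]
  congr 1
  refine Multiset.map_congr rfl fun a _ => ?_
  simp only [Function.comp, truncEntry, truncBranch, trunc_mk]

lemma trunc_zero (τ : MGraph X Y) : trunc 0 τ = MGraph.mk (RawGraph.point (rootMark τ)) := by
  conv_lhs => rw [← τ.mk_rep, trunc_mk, RawGraph.mk_trunc_zero]
  rfl

lemma isTree_graft {x : X} {M : Multiset (Branch X Y × Y)} (hM : ∀ e ∈ M, e.1.1.IsTree) :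
    (graft x M).IsTree := by
  obtain ⟨S, c, yc, yo, rfl⟩ := exists_join x M
  rw [← mk_join, isTree_mk]
  refine RawGraph.join_isTree fun i hi => ?_
  have := hM _ (Multiset.mem_map_of_mem _ hi)
  exact isTree_mk.1 this

lemma MGraph.IsTree.exists_graft {τ : MGraph X Y} (hτ : τ.IsTree) :
    ∃ M : Multiset (Branch X Y × Y), (∀ e ∈ M, e.1.1.IsTree) ∧ τ = graft (rootMark τ) M := by
  have h := RawGraph.IsTree.isoMap_join hτ
  refine ⟨τ.rep.nbrs.val.map fun i => ((MGraph.mk (τ.rep.cut i τ.rep.root),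
    τ.rep.emark i τ.rep.root), τ.rep.emark τ.rep.root i), ?_, ?_⟩
  · intro e he
    obtain ⟨i, hi, rfl⟩ := Multiset.mem_map.1 he
    exact isTree_mk.2 (RawGraph.IsTree.cut hτ (RawGraph.mem_comp_of_mem_nbrs hi) _)
  · rw [← mk_join]
    conv_lhs => rw [← τ.mk_rep, ← h.mk_eq]
    rfl

/-! ### The first generation of a tree -/

/-- The branches at the root, truncated at depth `k`, and the edge marks at the root. -/
def entries (k : ℕ) (τ : MGraph X Y) : Multiset (Branch X Y × Y) :=
  (ends k 0 τ).map fun p => (p.1, p.2.2)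

lemma card_entries (k : ℕ) (τ : MGraph X Y) : Multiset.card (entries k τ) = deg τ := by
  rw [entries, Multiset.card_map, card_ends]

lemma entries_graft (k : ℕ) (x : X) (M : Multiset (Branch X Y × Y)) :
    entries k (graft x M) = M.map (truncEntry k) := by
  rw [entries, ends_graft, Multiset.map_map]
  rfl

lemma truncBranch_truncBranch (h k : ℕ) (t : Branch X Y) :
    truncBranch k (truncBranch h t) = truncBranch (min h k) t := by
  rw [truncBranch, truncBranch, trunc_trunc]; rfl

lemma truncEntry_truncEntry (h k : ℕ) (e : Branch X Y × Y) :
    truncEntry k (truncEntry h e) = truncEntry (min h k) e := by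
  rw [truncEntry, truncEntry, truncBranch_truncBranch]; rfl

lemma MGraph.IsTree.trunc_succ {τ : MGraph X Y} (hτ : τ.IsTree) (k : ℕ) :
    MarkedTree.trunc (k + 1) τ = graft (rootMark τ) (entries k τ) := by
  obtain ⟨M, -, h⟩ := hτ.exists_graft
  rw [h, rootMark_graft, trunc_succ_graft, entries_graft]

lemma MGraph.IsTree.entries_trunc {τ : MGraph X Y} (hτ : τ.IsTree) {k h : ℕ} (hk : k ≤ h) :
    entries k (MarkedTree.trunc (h + 1) τ) = entries k τ := by
  obtain ⟨M, -, h⟩ := hτ.exists_graft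
  rw [h, trunc_succ_graft, entries_graft, entries_graft, Multiset.map_map]
  refine Multiset.map_congr rfl fun e _ => ?_
  rw [Function.comp, truncEntry_truncEntry, min_eq_right hk]

lemma MGraph.IsTree.map_entries {τ : MGraph X Y} (hτ : τ.IsTree) {k h : ℕ} (hk : k ≤ h) :
    (entries h τ).map (truncEntry k) = entries k τ := by
  obtain ⟨M, -, h⟩ := hτ.exists_graft
  rw [h, entries_graft, entries_graft, Multiset.map_map]
  refine Multiset.map_congr rfl fun e _ => ?_
  rw [Function.comp, truncEntry_truncEntry, min_eq_right hk]

open Classical in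
/-- The branch of the root, truncated at depth `j`, after removal of the entry `e`. -/
def upBranch (j : ℕ) (x : X) (N : Multiset (Branch X Y × Y)) (e : Branch X Y × Y) : Branch X Y :=
  (trunc j (graft x (N.erase e)), e.2)

lemma upBranch_zero (x : X) (N : Multiset (Branch X Y × Y)) (e : Branch X Y × Y) :
    upBranch 0 x N e = (MGraph.mk (RawGraph.point x), e.2) := by
  rw [upBranch, trunc_zero, rootMark_graft]

/-- The root-side branch to depth `k + 1` involves the other entries only to depth `k`, so
truncating all entries at depth `k` leaves it unchanged. -/
lemma upBranch_map {j k : ℕ} (hj : j ≤ k + 1) (x : X) (M : Multiset (Branch X Y × Y))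
    {e : Branch X Y × Y} (he : e ∈ M) :
    upBranch j x (M.map (truncEntry k)) (truncEntry k e) = upBranch j x M e := by
  classical
  rw [upBranch, upBranch, ← Multiset.map_erase_of_mem _ _ he, ← trunc_succ_graft, trunc_trunc,
    min_eq_right hj]
  rfl

lemma ends_graft' (i j : ℕ) (x : X) (M : Multiset (Branch X Y × Y)) :
    ends i j (graft x M) = M.map fun e => (truncBranch i e.1, upBranch j x M e) := by
  classical
  rw [ends_graft]
  simp only [upBranch]

/-- In a tree, all branches at an edge of the root are determined by the entries. -/
lemma MGraph.IsTree.ends_eq {τ : MGraph X Y} (hτ : τ.IsTree) {i j k : ℕ} (hi : i ≤ k)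
    (hj : j ≤ k + 1) : ends i j τ = (entries k τ).map fun e =>
      (truncBranch i e.1, upBranch j (rootMark τ) (entries k τ) e) := by
  obtain ⟨M, -, h⟩ := hτ.exists_graft
  rw [h, ends_graft', entries_graft, rootMark_graft, Multiset.map_map]
  refine Multiset.map_congr rfl fun e he => ?_
  rw [Function.comp, upBranch_map hj _ _ he]
  simp only [truncEntry, truncBranch_truncBranch, min_eq_right hi]

/-- The asymmetry is essential: the neighbourhood of radius `k + 1` shows the far side of an edge to
depth `k`, but the root side to depth `k + 1`. Hence the law at depth `j + 1` already determines
`pairMass ρ j (j + 1)`. -/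
lemma MGraph.IsTree.ends_trunc {τ : MGraph X Y} (hτ : τ.IsTree) {i j k : ℕ} (hi : i ≤ k)
    (hj : j ≤ k + 1) : ends i j (MarkedTree.trunc (k + 1) τ) = ends i j τ := by
  rw [(hτ.trunc _).ends_eq hi hj, hτ.ends_eq hi hj, hτ.entries_trunc le_rfl, rootMark_trunc]

/-- The pairs of branches with truncations at other depths. -/
lemma map_truncBranch_ends (i j i' j' : ℕ) (hi : i' ≤ i) (hj : j' ≤ j) (τ : MGraph X Y) :
    (ends i j τ).map (fun p => (truncBranch i' p.1, truncBranch j' p.2)) = ends i' j' τ := by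
  rw [ends, ends, RawGraph.ends, RawGraph.ends, Multiset.map_map]
  refine Multiset.map_congr rfl fun a _ => ?_
  simp only [Function.comp, RawGraph.down, RawGraph.up, RawGraph.branch, truncBranch, trunc_mk,
    RawGraph.trunc_trunc, min_eq_right hi, min_eq_right hj]

lemma replaceBranches_eq (τ : MGraph X Y) (s : τ.rep.nbrs → Branch X Y) :
    replaceBranches τ s = graft (rootMark τ)
      ((Finset.univ : Finset τ.rep.nbrs).val.map fun a => (s a, τ.rep.emark τ.rep.root a)) := by
  classical
  rw [replaceBranches, mk_join]
  congr 1
  rw [← map_univ_coe]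
  refine Multiset.map_congr rfl fun a _ => ?_
  simp

lemma star_eq (x : X) (n : ℕ) (m : Fin n → X × Y × Y) : star x n m = graft x
    (Finset.univ.val.map fun i =>
      ((MGraph.mk (RawGraph.point (m i).1), (m i).2.1), (m i).2.2)) := by
  rw [star, mk_join]
  congr 1
  have h : (Finset.range n).val = (Finset.univ : Finset (Fin n)).val.map Fin.val := by
    have := congrArg Finset.val (Fin.map_valEmbedding_univ (n := n))
    rw [Finset.map_val, Nat.Iio_eq_range] at this
    exact this.symm
  rw [h, Multiset.map_map]
  refine Multiset.map_congr rfl fun a _ => ?_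
  simp

end

/-! ### Locality, countability and the mass transport principle. -/

section

variable {X : Type u} {Y : Type v}

/-! ### Local functions are measurable -/

/-- A set that is decided by the `h`-neighbourhood is a union of basic open sets. Consequently every
function of a truncation is measurable, whatever its target. -/
lemma isOpen_of_trunc {s : Set (MGraph X Y)} (h : ℕ)
    (hs : ∀ τ τ', trunc h τ = trunc h τ' → τ ∈ s → τ' ∈ s) : IsOpen s := by
  have : s = ⋃ τ ∈ s, {τ' | trunc h τ' = trunc h τ} := by
    ext τ'
    simp only [Set.mem_iUnion, Set.mem_ofPred_eq, exists_prop]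
    exact ⟨fun h' => ⟨τ', h', rfl⟩, fun ⟨τ, hτ, h'⟩ => hs τ τ' h'.symm hτ⟩
  rw [this]
  exact isOpen_biUnion fun τ _ => TopologicalSpace.isOpen_generateFrom_of_mem ⟨h, _, rfl⟩

lemma measurable_of_trunc {β : Type*} [MeasurableSpace β] {F : MGraph X Y → β} (h : ℕ)
    (hF : ∀ τ τ', trunc h τ = trunc h τ' → F τ = F τ') : Measurable F := fun s _ =>
  (isOpen_of_trunc h fun τ τ' hτ (hs : F τ ∈ s) => by
    change F τ' ∈ s
    rwa [← hF τ τ' hτ]).measurableSet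

lemma measurable_comp_trunc {β : Type*} [MeasurableSpace β] (F : MGraph X Y → β) (h : ℕ) :
    Measurable fun τ => F (trunc h τ) :=
  measurable_of_trunc h fun τ τ' hτ => by rw [hτ]

lemma measurable_trunc (h : ℕ) : Measurable (trunc h : MGraph X Y → MGraph X Y) :=
  measurable_comp_trunc id h

/-- If two consecutive balls are isomorphic, they have the same finite cardinality and hence
coincide; then no edge leaves the ball, and it is the whole component. -/
lemma RawGraph.trunc_eq_self_of_mk_eq {G : RawGraph X Y} {h : ℕ}
    (hG : MGraph.mk (G.trunc (h + 1)) = MGraph.mk (G.trunc h)) :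
    MGraph.mk G = MGraph.mk (G.trunc h) := by
  obtain ⟨f, hf⟩ := exists_isoMap_of_mk_eq hG
  have h1 : G.ball h = f '' G.ball (h + 1) := by
    rw [← trunc_comp, ← trunc_comp]
    ext b
    exact ⟨fun hb => hf.surj hb, fun ⟨a, ha, hab⟩ => hab ▸ hf.mem_comp ha⟩
  have h2 : Set.InjOn f (G.ball (h + 1)) := by
    rw [← trunc_comp]; exact hf.inj
  have h3 : G.ball h = G.ball (h + 1) := by
    refine Set.eq_of_subset_of_ncard_le (ball_mono h.le_succ) ?_ (G.ball_finite _)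
    rw [h1, h2.ncard_image]
  have h4 : G.comp = G.ball h := by
    refine Set.Subset.antisymm (fun a ha => ?_) (G.ball_subset_comp h)
    refine comp_induction (P := (· ∈ G.ball h)) (root_mem_ball _ _) ?_ ha
    intro a b _ hab h'
    rw [h3]
    exact Or.inr ⟨a, h', hab⟩
  refine IsoMap.mk_eq (f := id) ⟨rfl, fun a ha b hab => ?_, fun a ha b hab => ⟨b, hab.1, rfl⟩,
    Set.injOn_id _, fun _ _ => rfl, fun _ _ _ _ => rfl⟩
  refine trunc_adj.2 ⟨hab, ?_, ?_⟩
  · rw [← h4]; exact ha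
  · rw [← h4]; exact mem_comp_of_adj ha hab

lemma eq_of_trunc_succ_eq {τ σ : MGraph X Y} {h : ℕ} (hσ : trunc h σ = σ)
    (hτ : trunc (h + 1) τ = σ) : τ = σ := by
  have h1 : trunc h τ = σ := by
    rw [← hσ, ← hτ, trunc_trunc, min_eq_right h.le_succ]
  rw [← τ.mk_rep, trunc_mk] at h1 hτ
  rw [← h1, ← RawGraph.trunc_eq_self_of_mk_eq (hτ.trans h1.symm), MGraph.mk_rep]

/-- The singleton is a cylinder of radius `h + 1`. Radius `h` is not enough, since deeper graphs may
have the same truncation at depth `h`. -/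
lemma measurableSet_singleton_of_trunc {σ : MGraph X Y} {h : ℕ} (hσ : trunc h σ = σ) :
    MeasurableSet ({σ} : Set (MGraph X Y)) := by
  have : ({σ} : Set (MGraph X Y)) = {τ | trunc (h + 1) τ = σ} := by
    ext τ
    simp only [Set.mem_singleton_iff, Set.mem_ofPred_eq]
    constructor
    · rintro rfl
      rw [← hσ, trunc_trunc, min_eq_left h.le_succ]
    · exact eq_of_trunc_succ_eq hσ
  rw [this]
  exact (isOpen_of_trunc (h + 1) fun τ τ' hττ' (hτ : _ = _) => hττ'.symm.trans hτ).measurableSet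

/-- The set of all trees of depth at most `h`. -/
def truncTrees (X : Type u) (Y : Type v) (h : ℕ) : Set (MGraph X Y) :=
  {σ | σ.IsTree ∧ trunc h σ = σ}

lemma MGraph.IsTree.trunc_mem {τ : MGraph X Y} (hτ : τ.IsTree) (h : ℕ) :
    MarkedTree.trunc h τ ∈ truncTrees X Y h :=
  ⟨hτ.trunc h, by rw [trunc_trunc, min_self]⟩

lemma measurableSet_singleton_of_mem {σ : MGraph X Y} {h : ℕ} (hσ : σ ∈ truncTrees X Y h) :
    MeasurableSet ({σ} : Set (MGraph X Y)) := measurableSet_singleton_of_trunc hσ.2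

section

variable [Nonempty Y]

lemma MGraph.IsTree.entries_mem {τ : MGraph X Y} (hτ : τ.IsTree) {k : ℕ} {e : Branch X Y × Y}
    (he : e ∈ entries k τ) : e.1.1 ∈ truncTrees X Y k := by
  obtain ⟨M, hM, h⟩ := hτ.exists_graft
  rw [h, entries_graft] at he
  obtain ⟨e', he', rfl⟩ := Multiset.mem_map.1 he
  exact (hM e' he').trunc_mem k

lemma eq_graft_of_mem {σ : MGraph X Y} {k : ℕ} (hσ : σ ∈ truncTrees X Y (k + 1)) :
    σ = graft (rootMark σ) (entries k σ) := by
  conv_lhs => rw [← hσ.2, hσ.1.trunc_succ]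

lemma map_truncEntry_of_forall_mem {k : ℕ} {M : Multiset (Branch X Y × Y)}
    (hM : ∀ e ∈ M, e.1.1 ∈ truncTrees X Y k) : M.map (truncEntry k) = M := by
  conv_rhs => rw [← M.map_id]
  refine Multiset.map_congr rfl fun e he => ?_
  rw [truncEntry, truncBranch, (hM e he).2]
  rfl

lemma graft_mem_truncTrees {k : ℕ} {x : X} {M : Multiset (Branch X Y × Y)}
    (hM : ∀ e ∈ M, e.1.1 ∈ truncTrees X Y k) : graft x M ∈ truncTrees X Y (k + 1) := by
  refine ⟨isTree_graft fun e he => (hM e he).1, ?_⟩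
  rw [trunc_succ_graft, map_truncEntry_of_forall_mem hM]

/-- There are countably many multisets of branches of depth `k` with finitely many marks, and
`graft` maps them onto the trees of depth `k + 1`. -/
lemma countable_truncTrees [Finite X] [Finite Y] (h : ℕ) : (truncTrees X Y h).Countable := by
  induction h with
  | zero =>
    refine (Set.countable_range fun x : X => MGraph.mk (RawGraph.point (Y := Y) x)).mono ?_
    rintro σ ⟨-, hσ⟩
    exact ⟨rootMark σ, (trunc_zero σ).symm.trans hσ⟩
  | succ k ih =>
    have : Countable (truncTrees X Y k) := ih
    have : Countable (Multiset ((truncTrees X Y k × Y) × Y)) := Quotient.countable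
    refine (Set.countable_range fun p : X × Multiset ((truncTrees X Y k × Y) × Y) =>
      graft p.1 (p.2.map fun e => ((e.1.1.1, e.1.2), e.2))).mono ?_
    intro σ hσ
    refine ⟨⟨rootMark σ, (entries k σ).attach.map
      fun e => ((⟨e.1.1.1, hσ.1.entries_mem e.2⟩, e.1.1.2), e.1.2)⟩, ?_⟩
    refine Eq.trans (congrArg (graft _) ?_) (eq_graft_of_mem hσ).symm
    rw [Multiset.map_map]
    exact Multiset.attach_map_val _

end

/-! ### Atomic measures -/

/-- The measure `μ` is carried by the countable set `S`, whose points are measurable. -/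
structure Atomic {α : Type*} [MeasurableSpace α] (S : Set α) (μ : Measure α) : Prop where
  countable : S.Countable
  measurable : ∀ a ∈ S, MeasurableSet ({a} : Set α)
  compl : μ Sᶜ = 0

namespace Atomic

variable {α : Type*} [MeasurableSpace α] {S : Set α} {μ : Measure α}

lemma measurableSet (hμ : Atomic S μ) : MeasurableSet S := by
  rw [← Set.biUnion_of_singleton S]
  exact MeasurableSet.biUnion hμ.countable hμ.measurable

lemma apply_of_notMem (hμ : Atomic S μ) {a : α} (ha : a ∉ S) : μ {a} = 0 :=
  measure_mono_null (Set.singleton_subset_iff.2 ha) hμ.compl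

lemma ae_mem (hμ : Atomic S μ) : ∀ᵐ a ∂μ, a ∈ S := hμ.compl

/-- Integrals become sums over all points for arbitrary integrands; points outside the carrier
contribute zero. No measurability has to be checked for densities and counting functions. -/
lemma lintegral (hμ : Atomic S μ) (f : α → ℝ≥0∞) : ∫⁻ a, f a ∂μ = ∑' a, μ {a} * f a := by
  have h1 : ∫⁻ a, f a ∂μ = ∫⁻ a in ⋃ a ∈ S, {a}, f a ∂μ := by
    rw [Set.biUnion_of_singleton, Measure.restrict_eq_self_of_ae_mem hμ.ae_mem]
  rw [h1, lintegral_biUnion hμ.countable hμ.measurable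
    (fun a _ b _ hab => Set.disjoint_singleton.2 hab)]
  have h2 : ∀ a : S, ∫⁻ x in {(a : α)}, f x ∂μ = μ {(a : α)} * f a := by
    intro a
    rw [setLIntegral_congr_fun (g := fun _ => f a) (hμ.measurable a a.2)
      (fun x hx => by rw [Set.mem_singleton_iff.1 hx]), setLIntegral_const, mul_comm]
  simp only [h2]
  rw [tsum_subtype S fun a => μ {a} * f a]
  refine tsum_congr fun a => ?_
  by_cases ha : a ∈ S
  · rw [Set.indicator_of_mem ha]
  · rw [Set.indicator_of_notMem ha, hμ.apply_of_notMem ha, zero_mul]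

lemma aemeasurable {β : Type*} [MeasurableSpace β] [Nonempty β] (hμ : Atomic S μ) (f : α → β) :
    AEMeasurable f μ := by
  classical
  refine ⟨S.piecewise f fun _ => Classical.arbitrary β, ?_, ?_⟩
  · intro t _
    have : S.piecewise f (fun _ => Classical.arbitrary β) ⁻¹' t =
        (⋃ a ∈ S ∩ f ⁻¹' t, {a}) ∪ (Sᶜ ∩ {_a | Classical.arbitrary β ∈ t}) := by
      ext a
      by_cases ha : a ∈ S <;> simp [ha]
    rw [this]
    refine (MeasurableSet.biUnion (hμ.countable.mono Set.inter_subset_left)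
      fun a ha => hμ.measurable a ha.1).union (hμ.measurableSet.compl.inter (MeasurableSet.const _))
  · filter_upwards [hμ.ae_mem] with a ha
    rw [Set.piecewise_eq_of_mem _ _ _ ha]

lemma withDensity (hμ : Atomic S μ) (f : α → ℝ≥0∞) : Atomic S (μ.withDensity f) :=
  ⟨hμ.countable, hμ.measurable, withDensity_absolutelyContinuous μ f hμ.compl⟩

lemma withDensity_apply (hμ : Atomic S μ) (f : α → ℝ≥0∞) (a : α) :
    μ.withDensity f {a} = μ {a} * f a := by
  by_cases ha : a ∈ S
  · rw [MeasureTheory.withDensity_apply _ (hμ.measurable a ha),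
      setLIntegral_congr_fun (g := fun _ => f a) (hμ.measurable a ha)
      (fun x hx => by rw [Set.mem_singleton_iff.1 hx]), setLIntegral_const, mul_comm]
  · rw [(hμ.withDensity f).apply_of_notMem ha, hμ.apply_of_notMem ha, zero_mul]

lemma lintegral_withDensity (hμ : Atomic S μ) (f g : α → ℝ≥0∞) :
    ∫⁻ a, g a ∂μ.withDensity f = ∫⁻ a, f a * g a ∂μ := by
  rw [(hμ.withDensity f).lintegral, hμ.lintegral]
  simp only [hμ.withDensity_apply, mul_assoc]

lemma absolutelyContinuous {ν : Measure α} (hμ : Atomic S μ)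
    (h : ∀ a ∈ S, ν {a} = 0 → μ {a} = 0) : μ ≪ ν := by
  intro s hs
  have h1 : s ⊆ Sᶜ ∪ ⋃ a ∈ S ∩ s, {a} := by
    intro a ha
    by_cases haS : a ∈ S
    · exact Or.inr (Set.mem_biUnion ⟨haS, ha⟩ rfl)
    · exact Or.inl haS
  refine measure_mono_null h1 (measure_union_null hμ.compl ?_)
  refine (measure_biUnion_null_iff (hμ.countable.mono Set.inter_subset_left)).2 fun a ha => ?_
  exact h a ha.1 (measure_mono_null (Set.singleton_subset_iff.2 ha.2) hs)

end Atomic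

lemma ofMass_apply {α : Type*} [MeasurableSpace α] (m : α → ℝ≥0∞) {s : Set α}
    (hs : MeasurableSet s) : ofMass m s = ∑' a, m a * s.indicator 1 a := by
  rw [ofMass, Measure.sum_apply _ hs]
  refine tsum_congr fun a => ?_
  rw [Measure.smul_apply, Measure.dirac_apply' _ hs, smul_eq_mul]

lemma ofMass_singleton {α : Type*} [MeasurableSpace α] (m : α → ℝ≥0∞) {a : α}
    (ha : MeasurableSet ({a} : Set α)) : ofMass m {a} = m a := by
  rw [ofMass_apply m ha, tsum_eq_single a]
  · simp
  · intro b hb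
    simp [hb]

lemma atomic_ofMass {α : Type*} [MeasurableSpace α] {m : α → ℝ≥0∞} {S : Set α}
    (h1 : S.Countable) (h2 : ∀ a ∈ S, MeasurableSet ({a} : Set α)) (hm : ∀ a ∉ S, m a = 0) :
    Atomic S (ofMass m) := by
  refine ⟨h1, h2, ?_⟩
  have hS : MeasurableSet S := by
    rw [← Set.biUnion_of_singleton S]
    exact MeasurableSet.biUnion h1 h2
  rw [ofMass_apply m hS.compl]
  refine ENNReal.tsum_eq_zero.2 fun a => ?_
  by_cases ha : a ∈ S
  · simp [ha]
  · rw [hm a ha, zero_mul]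

lemma lintegral_ofMass {α : Type*} [MeasurableSpace α] {m : α → ℝ≥0∞} {S : Set α}
    (h1 : S.Countable) (h2 : ∀ a ∈ S, MeasurableSet ({a} : Set α)) (hm : ∀ a ∉ S, m a = 0)
    (f : α → ℝ≥0∞) : ∫⁻ a, f a ∂ofMass m = ∑' a, m a * f a := by
  rw [(atomic_ofMass h1 h2 hm).lintegral]
  refine tsum_congr fun a => ?_
  by_cases ha : a ∈ S
  · rw [ofMass_singleton m (h2 a ha)]
  · rw [(atomic_ofMass h1 h2 hm).apply_of_notMem ha, hm a ha]

/-! ### The mass transport principle for edges at the root -/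

open Classical in
/-- A function of the branches at an edge of the root, read off from the `K`-neighbourhood. -/
def RawGraph.edgeFun (K i j : ℕ) (f : Branch X Y × Branch X Y → ℝ≥0∞) (G : RawGraph X Y)
    (a : ℕ) : ℝ≥0∞ :=
  if (G.trunc K).graph.Adj G.root a then f ((G.trunc K).down i a, (G.trunc K).up j a) else 0

/-- Gives both that `biEdgeFun` is well defined on isomorphism classes and that it is locally
constant. Reading the branches in the `K`-neighbourhood is what makes the function local. -/
lemma RawGraph.edgeFun_congr {K i j h : ℕ} {f : Branch X Y × Branch X Y → ℝ≥0∞}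
    {G H : RawGraph X Y} {g : ℕ → ℕ} (hg : RawGraph.IsoMap g (G.trunc h) (H.trunc h)) (hK : K ≤ h)
    {a : ℕ} (ha : a ∈ G.ball h) : H.edgeFun K i j f (g a) = G.edgeFun K i j f a := by
  have hg' : RawGraph.IsoMap g (G.trunc K) (H.trunc K) := by
    have := hg.trunc K
    rwa [trunc_trunc, trunc_trunc, min_eq_right hK] at this
  have hr : g G.root = H.root := hg.root
  by_cases haK : a ∈ G.ball K
  · have hac : a ∈ (G.trunc K).comp := by rwa [trunc_comp]
    have h1 := hg'.adj_iff (root_mem_comp _) hac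
    change _ ↔ (G.trunc K).graph.Adj G.root a at h1
    change (H.trunc K).graph.Adj (g G.root) (g a) ↔ _ at h1
    rw [hr] at h1
    by_cases h2 : (G.trunc K).graph.Adj G.root a
    · rw [edgeFun, edgeFun, if_pos (h1.2 h2), if_pos h2]
      have h3 : (H.trunc K).root = g G.root := hr.symm
      have h4 := hg'.branch_eq hac h2.symm i
      have h5 := hg'.branch_eq (root_mem_comp (G.trunc K)) h2 j
      rw [down, up, down, up, h3]
      exact congrArg f (Prod.ext h4 h5)
    · rw [edgeFun, edgeFun, if_neg fun h => h2 (h1.1 h), if_neg h2]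
  · have h1 : ¬ (G.trunc K).graph.Adj G.root a := fun h => haK (trunc_adj.1 h).2.2
    have h2 : ¬ (H.trunc K).graph.Adj H.root (g a) := fun h' => by
      have h3 := (trunc_adj.1 h').2.2
      rw [← min_eq_right hK, ← trunc_ball, hg.mem_ball_iff (by rwa [trunc_comp]), trunc_ball,
        min_eq_right hK] at h3
      exact haK h3
    rw [edgeFun, edgeFun, if_neg h1, if_neg h2]

/-- The function `RawGraph.edgeFun` on unlabelled doubly rooted graphs. -/
def biEdgeFun (K i j : ℕ) (f : Branch X Y × Branch X Y → ℝ≥0∞) (D : BiGraph X Y) : ℝ≥0∞ :=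
  (Quotient.out D).1.1.edgeFun K i j f (Quotient.out D).1.2

lemma biEdgeFun_mk (K i j : ℕ) (f : Branch X Y × Branch X Y → ℝ≥0∞) (G : RawGraph X Y) (a : ℕ)
    (ha : a ∈ G.comp) : biEdgeFun K i j f (BiGraph.mk G a ha) = G.edgeFun K i j f a := by
  have h1 : BiGraph.mk G a ha = Quotient.mk _ (Quotient.out (BiGraph.mk G a ha)) :=
    (Quotient.out_eq _).symm
  obtain ⟨φ, hφ⟩ := Quotient.exact h1
  obtain ⟨g, hg, hgφ⟩ := φ.exists_isoMap
  obtain ⟨h, hh⟩ := RawGraph.mem_comp_iff.1 ha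
  have h2 := RawGraph.edgeFun_congr (i := i) (j := j) (f := f) (hg.trunc (max h K))
    (le_max_right h K) (RawGraph.ball_mono (le_max_left h K) hh)
  rw [hgφ ⟨a, ha⟩, hφ] at h2
  exact h2

lemma measurable_biEdgeFun (K i j : ℕ) (f : Branch X Y × Branch X Y → ℝ≥0∞) :
    Measurable (biEdgeFun K i j f) := by
  intro s _
  refine IsOpen.measurableSet ?_
  rw [isOpen_iff_forall_mem_open]
  intro D hD
  obtain ⟨h, hh⟩ := RawGraph.mem_comp_iff.1 (Quotient.out D).2
  -- The radius must cover both the second root, at distance at most `h`, and the neighbourhood of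
  -- radius `K` from which the value is read.
  refine ⟨biCylinder (max h K) (Quotient.out D).1.1 (Quotient.out D).1.2, ?_,
    TopologicalSpace.isOpen_generateFrom_of_mem ⟨_, _, _, rfl⟩, ?_⟩
  · rintro D' ⟨φ, ha, hφ⟩
    obtain ⟨g, hg, hgφ⟩ := φ.exists_isoMap
    have h2 := RawGraph.edgeFun_congr (i := i) (j := j) (f := f) hg (le_max_right h K)
      (a := (Quotient.out D').1.2) (by rwa [← RawGraph.trunc_comp])
    rw [hgφ ⟨_, ha⟩, hφ] at h2
    change biEdgeFun K i j f D' ∈ s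
    change biEdgeFun K i j f D = biEdgeFun K i j f D' at h2
    rw [← h2]
    exact hD
  · exact ⟨RawGraph.Iso.refl _, by
      rw [RawGraph.trunc_comp]; exact RawGraph.ball_mono (le_max_left h K) hh, rfl⟩

/-- The vertexwise form of `MGraph.IsTree.ends_trunc`; it is needed because mass transport sums over
labelled vertices. It is read off from the representation of the tree as a join. -/
lemma RawGraph.IsTree.trunc_down_up {G : RawGraph X Y} (hG : G.IsTree) {i j k : ℕ} (hi : i ≤ k)
    (hj : j ≤ k + 1) {a : ℕ} (ha : a ∈ G.nbrs) : (G.trunc (k + 1)).down i a = G.down i a ∧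
      (G.trunc (k + 1)).up j a = G.up j a := by
  have h := RawGraph.IsTree.isoMap_join hG
  set J := RawGraph.join (G.vmark G.root) G.nbrs (fun i => G.cut i G.root)
    (fun i => G.emark i G.root) fun i => G.emark G.root i with hJ
  set f : ℕ → ℕ := fun a => if a = 0 then G.root else (a - 1).unpair.2 with hf
  have hfa : f (Nat.pair a a + 1) = a := by simp [hf]
  have hadj : J.graph.Adj J.root (Nat.pair a a + 1) := join_adj_zero.2 ⟨a, ha, rfl⟩
  have ht := h.trunc (k + 1)
  have hadj' : (J.trunc (k + 1)).graph.Adj (J.trunc (k + 1)).root (Nat.pair a a + 1) := by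
    rw [hJ, trunc_join]
    exact join_adj_zero.2 ⟨a, ha, rfl⟩
  have h1 := ht.branch_eq (mem_comp_of_adj (root_mem_comp _) hadj') hadj'.symm i
  have h2 := ht.branch_eq (root_mem_comp _) hadj' j
  have h3 := h.branch_eq (mem_comp_of_adj (root_mem_comp _) hadj) hadj.symm i
  have h4 := h.branch_eq (root_mem_comp _) hadj j
  rw [hfa, ht.root] at h1 h2
  rw [hfa, h.root] at h3 h4
  change (G.trunc (k + 1)).down i a = (J.trunc (k + 1)).down i (Nat.pair a a + 1) at h1
  change (G.trunc (k + 1)).up j a = (J.trunc (k + 1)).up j (Nat.pair a a + 1) at h2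
  change G.down i a = J.down i (Nat.pair a a + 1) at h3
  change G.up j a = J.up j (Nat.pair a a + 1) at h4
  rw [h1, h2, h3, h4]
  constructor
  · rw [hJ, trunc_join]
    have e1 := join_down (x := G.vmark G.root) (S := G.nbrs)
      (c := fun i => (G.cut i G.root).trunc k) (yc := fun i => G.emark i G.root)
      (yo := fun i => G.emark G.root i) ha i
    have e2 := join_down (x := G.vmark G.root) (S := G.nbrs)
      (c := fun i => (G.cut i G.root)) (yc := fun i => G.emark i G.root)
      (yo := fun i => G.emark G.root i) ha i
    refine e1.trans (Eq.trans ?_ e2.symm)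
    rw [RawGraph.trunc_trunc, min_eq_right hi]
  · rw [hJ, trunc_join]
    have e1 := join_up (x := G.vmark G.root) (S := G.nbrs)
      (c := fun i => (G.cut i G.root).trunc k) (yc := fun i => G.emark i G.root)
      (yo := fun i => G.emark G.root i) (i := a) j
    have e2 := join_up (x := G.vmark G.root) (S := G.nbrs)
      (c := fun i => (G.cut i G.root)) (yc := fun i => G.emark i G.root)
      (yo := fun i => G.emark G.root i) (i := a) j
    refine e1.trans (Eq.trans ?_ e2.symm)
    rw [← trunc_join, RawGraph.trunc_trunc, min_eq_right hj]

lemma RawGraph.trunc_succ_adj_root {G : RawGraph X Y} {k a : ℕ} :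
    (G.trunc (k + 1)).graph.Adj G.root a ↔ G.graph.Adj G.root a := by
  rw [trunc_adj]
  refine ⟨fun h => h.1, fun h => ⟨h, root_mem_ball _ _, ?_⟩⟩
  exact ball_mono (Nat.succ_le_succ (Nat.zero_le k)) (Or.inr ⟨G.root, rfl, h⟩)

lemma RawGraph.IsTree.edgeFun_eq {G : RawGraph X Y} (hG : G.IsTree) {i j k : ℕ} (hi : i ≤ k)
    (hj : j ≤ k + 1) (f : Branch X Y × Branch X Y → ℝ≥0∞) {a : ℕ} (ha : a ∈ G.nbrs) :
    G.edgeFun (k + 1) i j f a = f (G.down i a, G.up j a) := by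
  rw [edgeFun, if_pos (trunc_succ_adj_root.2 (mem_nbrs.1 ha)),
    (IsTree.trunc_down_up hG hi hj ha).1, (IsTree.trunc_down_up hG hi hj ha).2]

lemma RawGraph.tsum_comp_eq {G : RawGraph X Y} {F : ℕ → ℝ≥0∞} (hF : ∀ a ∉ G.nbrs, F a = 0) :
    ∑' a : G.comp, F a = (G.nbrs.val.map F).sum := by
  rw [tsum_subtype G.comp F, tsum_eq_sum (s := G.nbrs)]
  · refine Finset.sum_congr rfl fun a ha => ?_
    rw [Set.indicator_of_mem (mem_comp_of_mem_nbrs ha)]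
  · intro a ha
    classical
    rw [Set.indicator_apply, hF a ha, ite_self]

/-- The mass transport principle for functions of the branches at an edge of the root. -/
lemma mass_transport {ρ : Measure (MGraph X Y)} (hT : OnTrees ρ) (hU : Unimodular ρ) (i j : ℕ)
    (f : Branch X Y × Branch X Y → ℝ≥0∞) :
    ∫⁻ τ, ((ends i j τ).map f).sum ∂ρ = ∫⁻ τ, ((ends j i τ).map fun p => f p.swap).sum ∂ρ := by
  -- The transported function vanishes unless the second vertex is a neighbour of the root.
  -- Exchanging the two roots exchanges `down` and `up` along the edge, hence also the depths `i`
  -- and `j`. Radius `max i j + 1` suffices to see both branches.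
  have h := hU (biEdgeFun (max i j + 1) i j f) (measurable_biEdgeFun _ _ _ _)
  have hi : i ≤ max i j := le_max_left _ _
  have hj : j ≤ max i j + 1 := (le_max_right _ _).trans (Nat.le_succ _)
  convert h using 1
  · refine lintegral_congr_ae ?_
    filter_upwards [hT] with τ hτ
    simp only [biEdgeFun_mk]
    rw [RawGraph.tsum_comp_eq]
    · rw [ends, RawGraph.ends, Multiset.map_map]
      congr 1
      exact Multiset.map_congr rfl fun a ha => (RawGraph.IsTree.edgeFun_eq hτ hi hj f ha).symm
    · intro a ha
      rw [RawGraph.edgeFun, if_neg]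
      rwa [RawGraph.trunc_succ_adj_root, ← RawGraph.mem_nbrs]
  · refine lintegral_congr_ae ?_
    filter_upwards [hT] with τ hτ
    refine Eq.trans ?_ (tsum_congr fun a : τ.rep.comp =>
      biEdgeFun_mk (max i j + 1) i j f (τ.rep.reroot a) τ.rep.root
        (SimpleGraph.Reachable.symm a.2)).symm
    rw [RawGraph.tsum_comp_eq (F := fun a => (τ.rep.reroot a).edgeFun (max i j + 1) i j f
      τ.rep.root)]
    · rw [ends, RawGraph.ends, Multiset.map_map]
      congr 1
      refine Multiset.map_congr rfl fun a ha => ?_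
      have h1 : τ.rep.root ∈ (τ.rep.reroot a).nbrs :=
        RawGraph.mem_nbrs.2 (RawGraph.mem_nbrs.1 ha).symm
      exact (RawGraph.IsTree.edgeFun_eq (RawGraph.IsTree.reroot hτ
        (RawGraph.mem_comp_of_mem_nbrs ha)) hi hj f h1).symm
    · intro a ha
      rw [RawGraph.edgeFun, if_neg]
      rw [RawGraph.trunc_succ_adj_root]
      exact fun h => ha (RawGraph.mem_nbrs.2 (SimpleGraph.Adj.symm h))

end

/-! ### Entropy identities without subtraction, and counting of labellings. -/

section

/-! ### Entropy and relative entropy of atomic measures -/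

/-- The surprisal `-log m` of an event of probability `m`. -/
def surprisal (m : ℝ≥0∞) : ℝ≥0∞ := ENNReal.ofReal (-Real.log m.toReal)

lemma surprisal_ne_top (m : ℝ≥0∞) : surprisal m ≠ ⊤ := ENNReal.ofReal_ne_top

lemma surprisal_anti {a b : ℝ≥0∞} (ha : a ≠ 0) (hab : a ≤ b) (hb : b ≠ ⊤) :
    surprisal b ≤ surprisal a := by
  refine ENNReal.ofReal_le_ofReal (neg_le_neg (Real.log_le_log ?_ ?_))
  · exact ENNReal.toReal_pos ha (ne_top_of_le_ne_top hb hab)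
  · exact ENNReal.toReal_mono hb hab

lemma toReal_surprisal {m : ℝ≥0∞} (hm : m ≤ 1) : (surprisal m).toReal = -Real.log m.toReal := by
  refine ENNReal.toReal_ofReal (neg_nonneg.2 (Real.log_nonpos ENNReal.toReal_nonneg ?_))
  exact ENNReal.toReal_le_of_le_ofReal zero_le_one (by simpa using hm)

lemma shannon_eq {α : Type*} {m : α → ℝ≥0∞} (hm : ∀ a, m a ≠ ⊤) :
    shannon m = ∑' a, m a * surprisal (m a) := by
  refine tsum_congr fun a => ?_
  rw [Real.negMulLog, surprisal, neg_mul_comm, ENNReal.ofReal_mul ENNReal.toReal_nonneg,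
    ENNReal.ofReal_toReal (hm a)]

lemma Atomic.ae_ne_zero {α : Type*} [MeasurableSpace α] {S : Set α} {μ : Measure α}
    (hμ : Atomic S μ) : ∀ᵐ a ∂μ, μ {a} ≠ 0 := by
  have h : μ (⋃ a ∈ S ∩ {a | μ {a} = 0}, {a}) = 0 :=
    (measure_biUnion_null_iff (hμ.countable.mono Set.inter_subset_left)).2 fun a ha => ha.2
  filter_upwards [hμ.ae_mem, measure_eq_zero_iff_ae_notMem.1 h] with a ha h1 h2
  exact h1 (Set.mem_biUnion ⟨ha, h2⟩ rfl)

lemma Atomic.shannon_eq {α : Type*} [MeasurableSpace α] {S : Set α} {μ : Measure α}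
    [IsFiniteMeasure μ] (hμ : Atomic S μ) :
    shannon (fun a => μ {a}) = ∫⁻ a, surprisal (μ {a}) ∂μ := by
  rw [hμ.lintegral, MarkedTree.shannon_eq fun a => measure_ne_top μ _]

/-- Since `klFun x = x log x + 1 - x`, this is the pointwise identity of entropy, relative entropy
and cross entropy, with the negative terms moved to the other side. It needs masses at most one,
where the surprisal is not cut off at zero. -/
lemma mul_surprisal_add_klFun {m n : ℝ≥0∞} (hm : m ≤ 1) (hn : n ≤ 1) (h : n = 0 → m = 0) :
    m * surprisal m + n * ENNReal.ofReal (klFun (m / n).toReal) + m = m * surprisal n + n := by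
  rcases eq_or_ne n 0 with h0 | hn0
  · rw [h0, h h0]; simp
  rcases eq_or_ne m 0 with rfl | hm0
  · simp [klFun]
  have hm1 : m ≠ ⊤ := ne_top_of_le_ne_top ENNReal.one_ne_top hm
  have hn1 : n ≠ ⊤ := ne_top_of_le_ne_top ENNReal.one_ne_top hn
  have hmp : 0 < m.toReal := ENNReal.toReal_pos hm0 hm1
  have hnp : 0 < n.toReal := ENNReal.toReal_pos hn0 hn1
  rw [← ENNReal.toReal_eq_toReal_iff']
  · rw [ENNReal.toReal_add, ENNReal.toReal_add, ENNReal.toReal_add, ENNReal.toReal_mul,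
      ENNReal.toReal_mul, ENNReal.toReal_mul, toReal_surprisal hm, toReal_surprisal hn,
      ENNReal.toReal_ofReal (klFun_nonneg ENNReal.toReal_nonneg), ENNReal.toReal_div, klFun,
      Real.log_div hmp.ne' hnp.ne']
    · field_simp
      ring
    all_goals first
      | exact ENNReal.mul_ne_top hm1 (surprisal_ne_top _)
      | exact ENNReal.mul_ne_top hn1 ENNReal.ofReal_ne_top
      | exact ENNReal.add_ne_top.2 ⟨ENNReal.mul_ne_top hm1 (surprisal_ne_top _),
          ENNReal.mul_ne_top hn1 ENNReal.ofReal_ne_top⟩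
      | assumption
  · exact ENNReal.add_ne_top.2 ⟨ENNReal.add_ne_top.2 ⟨ENNReal.mul_ne_top hm1 (surprisal_ne_top _),
          ENNReal.mul_ne_top hn1 ENNReal.ofReal_ne_top⟩, hm1⟩
  · exact ENNReal.add_ne_top.2 ⟨ENNReal.mul_ne_top hm1 (surprisal_ne_top _), hn1⟩

/-- The sum of entropy and relative entropy is the cross entropy. -/
lemma Atomic.add_klDiv {α : Type*} [MeasurableSpace α] {S : Set α} {μ ν : Measure α}
    [IsProbabilityMeasure μ] [IsProbabilityMeasure ν] (hμ : Atomic S μ) (hν : Atomic S ν)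
    (h : μ ≪ ν) :
    ∫⁻ a, surprisal (μ {a}) ∂μ + klDiv μ ν = ∫⁻ a, surprisal (ν {a}) ∂μ := by
  have h1 : klDiv μ ν = ∑' a, ν {a} * ENNReal.ofReal (klFun (μ {a} / ν {a}).toReal) := by
    rw [klDiv_eq_lintegral_klFun_of_ac h, hν.lintegral]
    refine tsum_congr fun a => ?_
    by_cases h0 : ν {a} = 0
    · rw [h0, zero_mul, zero_mul]
    · have h2 : μ {a} = ν {a} * μ.rnDeriv ν a := by
        conv_lhs => rw [← Measure.withDensity_rnDeriv_eq μ ν h]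
        exact hν.withDensity_apply _ a
      rw [h2, mul_comm (ν {a}) (μ.rnDeriv ν a), ENNReal.mul_div_cancel_right h0
        (measure_ne_top ν _)]
  have h2 : ∑' a, μ {a} = 1 := by
    have := hμ.lintegral 1
    simpa using this.symm
  have h3 : ∑' a, ν {a} = 1 := by
    have := hν.lintegral 1
    simpa using this.symm
  -- The added `1` is expanded as the total mass of `μ` on the left and of `ν` on the right; these
  -- are the terms `m` and `n` of the pointwise identity.
  have h4 : ∫⁻ a, surprisal (μ {a}) ∂μ + klDiv μ ν + 1 = ∫⁻ a, surprisal (ν {a}) ∂μ + 1 := by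
    conv_lhs => rw [← h2]
    conv_rhs => rw [← h3]
    rw [hμ.lintegral, hμ.lintegral, h1, ← ENNReal.tsum_add, ← ENNReal.tsum_add, ← ENNReal.tsum_add]
    exact tsum_congr fun a => mul_surprisal_add_klFun prob_le_one prob_le_one fun h0 => h h0
  exact (ENNReal.add_left_inj ENNReal.one_ne_top).1 h4

/-! ### Sums over finite products -/

lemma tsum_pi_fin {β : Type*} (n : ℕ) (f : Fin n → β → ℝ≥0∞) :
    ∑' s : Fin n → β, ∏ i, f i (s i) = ∏ i, ∑' b, f i b := by
  induction n with
  | zero => simp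
  | succ n ih =>
    rw [← (Fin.consEquiv fun _ => β).tsum_eq, ENNReal.tsum_prod', Fin.prod_univ_succ, ← ih]
    rw [← ENNReal.tsum_mul_right]
    refine tsum_congr fun b => ?_
    rw [← ENNReal.tsum_mul_left]
    refine tsum_congr fun s => ?_
    rw [Fin.prod_univ_succ]
    simp [Fin.consEquiv]

lemma tsum_pi {ι β : Type*} [Fintype ι] (f : ι → β → ℝ≥0∞) :
    ∑' s : ι → β, ∏ i, f i (s i) = ∏ i, ∑' b, f i b := by
  let e := Fintype.equivFin ι
  rw [← (e.symm.arrowCongr (Equiv.refl β)).tsum_eq, ← e.symm.prod_comp, ← tsum_pi_fin]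
  refine tsum_congr fun s => ?_
  rw [← e.symm.prod_comp]
  simp

/-- Under a product of probabilities, a function of one coordinate is averaged by that coordinate
alone. -/
lemma tsum_pi_mul {ι β : Type*} [Fintype ι] (f : ι → β → ℝ≥0∞) (hf : ∀ i, ∑' b, f i b = 1)
    (i : ι) (g : β → ℝ≥0∞) :
    ∑' s : ι → β, (∏ j, f j (s j)) * g (s i) = ∑' b, f i b * g b := by
  classical
  have h := tsum_pi fun j b => f j b * if j = i then g b else 1
  have h1 : ∀ s : ι → β, (∏ j, f j (s j) * if j = i then g (s j) else 1) =
      (∏ j, f j (s j)) * g (s i) := by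
    intro s
    rw [Finset.prod_mul_distrib, Finset.prod_ite_eq' Finset.univ i, if_pos (Finset.mem_univ i)]
  rw [tsum_congr h1] at h
  rw [h, Finset.prod_eq_single i]
  · simp
  · intro j _ hj
    simp [hj, hf]
  · simp

/-! ### Counting families with a given multiset of values -/

open Classical in
/-- The product of the factorials of the multiplicities. -/
def factProd {E : Type*} (M : Multiset E) : ℕ := ∏ e ∈ M.toFinset, (M.count e).factorial

lemma factProd_pos {E : Type*} (M : Multiset E) : 0 < factProd M :=
  Finset.prod_pos fun _ _ => Nat.factorial_pos _

open Classical in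
lemma card_perm_comp_eq {ι E : Type*} [Fintype ι] [DecidableEq ι] (f : ι → E) :
    Fintype.card {g : Equiv.Perm ι // f ∘ g = f} = factProd (Finset.univ.val.map f) := by
  rw [DomMulAct.stabilizer_card', factProd]
  refine Finset.prod_congr ?_ fun e _ => ?_
  · ext e; simp
  · rw [← card_fiber_eq_count]

lemma exists_family {ι E E' : Type*} [Fintype ι] {n : ι → E} {r : E' → E} {M : Multiset E'}
    (h : M.map r = Finset.univ.val.map n) :
    ∃ g : ι → E', Finset.univ.val.map g = M ∧ r ∘ g = n := by
  have h1 : Finset.univ.val.map (fun i : Fin M.toList.length => M.toList.get i) = M := by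
    conv_rhs => rw [← M.coe_toList, ← List.ofFn_get M.toList]
    rw [List.ofFn_eq_map, ← Multiset.map_coe]
    congr 1
  have h2 : Finset.univ.val.map n =
      Finset.univ.val.map (fun i : Fin M.toList.length => r (M.toList.get i)) := by
    rw [← h]
    conv_lhs => rw [← h1]
    rw [Multiset.map_map]
    rfl
  obtain ⟨e, he⟩ := exists_equiv_of_map_eq h2
  refine ⟨fun i => M.toList.get (e i), ?_, funext he⟩
  conv_rhs => rw [← h1]
  rw [← Multiset.map_univ_val_equiv e, Multiset.map_map]
  rfl

/-- Orbit counting. The permutations that preserve `n` act transitively on the families with values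
`M` lying over `n`, and the stabilizer of a family has `factProd M` elements. -/
lemma ncard_families {ι E E' : Type*} [Fintype ι] {n : ι → E} {r : E' → E} {M : Multiset E'}
    (h : M.map r = Finset.univ.val.map n) :
    {g : ι → E' | Finset.univ.val.map g = M ∧ r ∘ g = n}.ncard * factProd M =
      factProd (M.map r) ∧ {g : ι → E' | Finset.univ.val.map g = M ∧ r ∘ g = n}.Finite := by
  classical
  obtain ⟨g₀, hg₀, hr⟩ := exists_family h
  have himg : {g : ι → E' | Finset.univ.val.map g = M ∧ r ∘ g = n} =
      ((Finset.univ.filter fun π : Equiv.Perm ι => n ∘ π = n).image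
        fun π : Equiv.Perm ι => g₀ ∘ π :
        Finset (ι → E')) := by
    ext g
    simp only [Set.mem_ofPred_eq, Finset.coe_image, Set.mem_image, Finset.coe_filter,
      Finset.mem_univ, true_and]
    constructor
    · rintro ⟨h1, h2⟩
      obtain ⟨e, he⟩ := exists_equiv_of_map_eq (h1.trans hg₀.symm)
      have he' : g₀ ∘ e = g := funext he
      refine ⟨e, ?_, he'⟩
      rw [← hr, Function.comp_assoc, he', h2, hr]
    · rintro ⟨π, hπ, rfl⟩
      refine ⟨?_, ?_⟩
      · rw [← hg₀, ← Multiset.map_map, Multiset.map_univ_val_equiv]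
      · rw [← Function.comp_assoc, hr, hπ]
  rw [himg]
  refine ⟨?_, Finset.finite_toSet _⟩
  rw [Set.ncard_coe_finset]
  have h1 : (Finset.univ.filter fun π : Equiv.Perm ι => n ∘ π = n).card = factProd (M.map r) := by
    rw [h, ← card_perm_comp_eq, Fintype.card_subtype]
  have h2 : (Finset.univ.filter fun σ : Equiv.Perm ι => g₀ ∘ σ = g₀).card = factProd M := by
    rw [← hg₀, ← card_perm_comp_eq, Fintype.card_subtype]
  rw [← h1, Finset.card_eq_sum_card_image (fun π : Equiv.Perm ι => g₀ ∘ π), ← smul_eq_mul,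
    ← Finset.sum_const]
  refine Finset.sum_congr rfl fun g hg => ?_
  obtain ⟨π₁, hπ₁, rfl⟩ := Finset.mem_image.1 hg
  have hn : n ∘ π₁ = n := (Finset.mem_filter.1 hπ₁).2
  rw [← h2]
  refine Finset.card_bij (fun σ _ => σ * π₁) ?_ (fun _ _ _ _ h => mul_right_cancel h) ?_
  · intro σ hσ
    have hσ' : g₀ ∘ σ = g₀ := (Finset.mem_filter.1 hσ).2
    have h3 : g₀ ∘ (σ * π₁ : Equiv.Perm ι) = g₀ ∘ π₁ := by
      rw [Equiv.Perm.coe_mul, ← Function.comp_assoc, hσ']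
    refine Finset.mem_filter.2 ⟨Finset.mem_filter.2 ⟨Finset.mem_univ _, ?_⟩, h3⟩
    rw [← hr, Function.comp_assoc, h3, ← Function.comp_assoc, hr, hn]
  · intro π hπ
    have h3 : g₀ ∘ π = g₀ ∘ π₁ := (Finset.mem_filter.1 hπ).2
    refine ⟨π * π₁⁻¹, Finset.mem_filter.2 ⟨Finset.mem_univ _, ?_⟩, inv_mul_cancel_right _ _⟩
    rw [Equiv.Perm.coe_mul, ← Function.comp_assoc, h3, Function.comp_assoc, ← Equiv.Perm.coe_mul,
      mul_inv_cancel]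
    rfl

end

/-! ### Edge masses of a unimodular law and of its truncations. -/

section

variable {X : Type u} {Y : Type v} [Nonempty Y]

/-! ### Laws carried by trees -/

/-- Being determined by a truncation is only required on trees; almost everywhere nothing else
occurs. -/
lemma OnTrees.aemeasurable {ρ : Measure (MGraph X Y)} (hT : OnTrees ρ) {β : Type*}
    [MeasurableSpace β] (h : ℕ) {F : MGraph X Y → β}
    (hF : ∀ τ : MGraph X Y, τ.IsTree → F (trunc h τ) = F τ) : AEMeasurable F ρ :=
  ⟨_, measurable_comp_trunc F h, hT.mono fun τ hτ => (hF τ hτ).symm⟩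

lemma OnTrees.aemeasurable_ends {ρ : Measure (MGraph X Y)} (hT : OnTrees ρ) {β : Type*}
    [MeasurableSpace β] (i j : ℕ) (φ : Multiset (Branch X Y × Branch X Y) → β) :
    AEMeasurable (fun τ => φ (ends i j τ)) ρ :=
  hT.aemeasurable (max i j + 1) fun τ hτ => by
    rw [hτ.ends_trunc (le_max_left i j) ((le_max_right i j).trans (Nat.le_succ _))]

lemma MGraph.IsTree.mem_of_mem_ends {τ : MGraph X Y} (hτ : τ.IsTree) {i j : ℕ}
    {p : Branch X Y × Branch X Y} (hp : p ∈ ends i j τ) :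
    p.1.1 ∈ truncTrees X Y i ∧ p.2.1 ∈ truncTrees X Y j := by
  rw [hτ.ends_eq (le_max_left i j) ((le_max_right i j).trans (Nat.le_succ _))] at hp
  obtain ⟨e, he, rfl⟩ := Multiset.mem_map.1 hp
  refine ⟨(hτ.entries_mem he).1.trunc_mem i, ?_⟩
  classical
  refine (isTree_graft fun e' he' => ?_).trunc_mem j
  exact (hτ.entries_mem (Multiset.mem_of_mem_erase he')).1

/-- The branches which are trees of depth at most `k`. -/
def truncBranches (X : Type u) (Y : Type v) (k : ℕ) : Set (Branch X Y) :=
  {t | t.1 ∈ truncTrees X Y k}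

lemma countable_truncBranches [Finite X] [Finite Y] (k : ℕ) :
    (truncBranches X Y k).Countable := by
  have : truncBranches X Y k = truncTrees X Y k ×ˢ Set.univ := by
    ext t; simp [truncBranches]
  rw [this]
  exact (countable_truncTrees k).prod Set.countable_univ

lemma truncBranch_of_mem {k : ℕ} {t : Branch X Y} (ht : t ∈ truncBranches X Y k) :
    truncBranch k t = t := Prod.ext ht.2 rfl

section Pairs

open Classical in
/-- The mean number of edges at the root with a given pair of branches, divided by the mean
degree. -/
def pairMass (ρ : Measure (MGraph X Y)) (i j : ℕ) (p : Branch X Y × Branch X Y) : ℝ≥0∞ :=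
  (∫⁻ τ, ((ends i j τ).count p : ℝ≥0∞) ∂ρ) / meanDeg ρ

lemma sum_map_ite_eq {α : Type*} [DecidableEq α] (M : Multiset α) (q : α) :
    (M.map fun a => if a = q then (1 : ℝ≥0∞) else 0).sum = M.count q := by
  induction M using Multiset.induction_on with
  | empty => simp
  | cons a M ih =>
    rw [Multiset.map_cons, Multiset.sum_cons, ih, Multiset.count_cons]
    by_cases h : a = q
    · subst h; simp [add_comm]
    · simp [h, Ne.symm h]

lemma sum_map_eq_tsum {α : Type*} [DecidableEq α] (M : Multiset α) (f : α → ℝ≥0∞) :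
    (M.map f).sum = ∑' a, (M.count a : ℝ≥0∞) * f a := by
  rw [Finset.sum_multiset_map_count, tsum_eq_sum (s := M.toFinset)]
  · simp
  · intro a ha
    rw [Multiset.count_eq_zero_of_notMem fun h => ha (Multiset.mem_toFinset.2 h)]
    simp

lemma count_le_count_map {α β : Type*} [DecidableEq α] [DecidableEq β] {f : α → β}
    {M : Multiset α} {a : α} : M.count a ≤ (M.map f).count (f a) := by
  rw [Multiset.count_map, Multiset.count_eq_card_filter_eq]
  exact Multiset.card_le_card (Multiset.monotone_filter_right M fun b h => congrArg f h)

variable {ρ : Measure (MGraph X Y)}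

open Classical in
-- At given depths only countably many pairs of branches occur in trees, which permits exchanging
-- the sum over pairs with the integral.
lemma lintegral_ends_eq [Finite X] [Finite Y] (hT : OnTrees ρ) (i j : ℕ)
    (f : Branch X Y × Branch X Y → ℝ≥0∞) : ∫⁻ τ, ((ends i j τ).map f).sum ∂ρ =
      ∑' p, (∫⁻ τ, ((ends i j τ).count p : ℝ≥0∞) ∂ρ) * f p := by
  let C : Set (Branch X Y × Branch X Y) := truncBranches X Y i ×ˢ truncBranches X Y j
  have hC : C.Countable := (countable_truncBranches i).prod (countable_truncBranches j)
  have : Countable C := hC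
  have h0 : ∀ τ : MGraph X Y, τ.IsTree → ∀ p ∉ C, (ends i j τ).count p = 0 := fun τ hτ p hp =>
    Multiset.count_eq_zero_of_notMem fun h => hp (hτ.mem_of_mem_ends h)
  have h1 : ∫⁻ τ, ((ends i j τ).map f).sum ∂ρ =
      ∫⁻ τ, ∑' p : C, ((ends i j τ).count (p : Branch X Y × Branch X Y) : ℝ≥0∞) * f p ∂ρ := by
    refine lintegral_congr_ae ?_
    filter_upwards [hT] with τ hτ
    rw [sum_map_eq_tsum, tsum_subtype C fun p => ((ends i j τ).count p : ℝ≥0∞) * f p]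
    refine tsum_congr fun p => ?_
    by_cases hp : p ∈ C
    · rw [Set.indicator_of_mem hp]
    · rw [Set.indicator_of_notMem hp, h0 τ hτ p hp]; simp
  rw [h1, lintegral_tsum fun p : C => hT.aemeasurable_ends i j fun M =>
    (M.count (p : Branch X Y × Branch X Y) : ℝ≥0∞) * f p,
    ← tsum_subtype_eq_of_support_subset (s := C)]
  · refine tsum_congr fun p : C => ?_
    rw [lintegral_mul_const'' _ (hT.aemeasurable_ends i j fun M =>
      (M.count (p : Branch X Y × Branch X Y) : ℝ≥0∞))]
  · intro p hp
    by_contra hpC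
    refine hp ?_
    have : ∫⁻ τ, ((ends i j τ).count p : ℝ≥0∞) ∂ρ = 0 := by
      rw [lintegral_congr_ae (g := 0), lintegral_zero_fun]
      filter_upwards [hT] with τ hτ
      simp [h0 τ hτ p hpC]
    simp only [this, zero_mul]

variable [Finite X] [Finite Y]

lemma lintegral_ends (hT : OnTrees ρ) (h0 : meanDeg ρ ≠ 0) (h1 : meanDeg ρ ≠ ⊤) (i j : ℕ)
    (f : Branch X Y × Branch X Y → ℝ≥0∞) : ∫⁻ τ, ((ends i j τ).map f).sum ∂ρ =
      meanDeg ρ * ∑' p, pairMass ρ i j p * f p := by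
  rw [lintegral_ends_eq hT, ← ENNReal.tsum_mul_left]
  refine tsum_congr fun p => ?_
  rw [pairMass, ← mul_assoc, ENNReal.mul_div_cancel h0 h1]

lemma tsum_pairMass (hT : OnTrees ρ) (h0 : meanDeg ρ ≠ 0) (h1 : meanDeg ρ ≠ ⊤) (i j : ℕ) :
    ∑' p, pairMass ρ i j p = 1 := by
  have h := lintegral_ends hT h0 h1 i j fun _ => 1
  simp only [Multiset.map_const', Multiset.sum_replicate, card_ends, mul_one, nsmul_eq_mul] at h
  change meanDeg ρ = _ at h
  conv_lhs at h => rw [← mul_one (meanDeg ρ)]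
  exact ((ENNReal.mul_right_inj h0 h1).1 h).symm

lemma pairMass_le_one (hT : OnTrees ρ) (h0 : meanDeg ρ ≠ 0) (h1 : meanDeg ρ ≠ ⊤) (i j : ℕ)
    (p : Branch X Y × Branch X Y) : pairMass ρ i j p ≤ 1 := by
  rw [← tsum_pairMass hT h0 h1 i j]
  exact ENNReal.le_tsum p

lemma pairMass_ne_top (hT : OnTrees ρ) (h0 : meanDeg ρ ≠ 0) (h1 : meanDeg ρ ≠ ⊤) (i j : ℕ)
    (p : Branch X Y × Branch X Y) : pairMass ρ i j p ≠ ⊤ :=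
  ne_top_of_le_ne_top ENNReal.one_ne_top (pairMass_le_one hT h0 h1 i j p)

lemma pairMass_eq_zero (hT : OnTrees ρ) {i j : ℕ} {p : Branch X Y × Branch X Y}
    (hp : ¬ (p.1 ∈ truncBranches X Y i ∧ p.2 ∈ truncBranches X Y j)) : pairMass ρ i j p = 0 := by
  rw [pairMass, lintegral_congr_ae (g := 0), lintegral_zero_fun, ENNReal.zero_div]
  filter_upwards [hT] with τ hτ
  classical
  exact Nat.cast_eq_zero.2 (Multiset.count_eq_zero_of_notMem fun h =>
    hp (MGraph.IsTree.mem_of_mem_ends hτ h))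

/-- The one form in which unimodularity is used from here on; it comes from mass transport of the
indicator of a pair. -/
lemma pairMass_swap (hT : OnTrees ρ) (hU : Unimodular ρ) (i j : ℕ)
    (p : Branch X Y × Branch X Y) : pairMass ρ i j p.swap = pairMass ρ j i p := by
  classical
  have h := mass_transport hT hU i j fun q => if q = p.swap then 1 else 0
  simp only [Prod.swap_inj, sum_map_ite_eq] at h
  rw [pairMass, pairMass]
  congr 1

/-- Edges with a given pair of branches are among the edges with the truncated pair. -/
lemma pairMass_le_trunc {i j i' j' : ℕ} (hi : i' ≤ i) (hj : j' ≤ j)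
    (p : Branch X Y × Branch X Y) :
    pairMass ρ i j p ≤ pairMass ρ i' j' (truncBranch i' p.1, truncBranch j' p.2) := by
  classical
  rw [pairMass, pairMass]
  refine ENNReal.div_le_div_right (lintegral_mono fun τ => ?_) _
  rw [Nat.cast_le, ← map_truncBranch_ends i j i' j' hi hj]
  exact count_le_count_map (f := fun p : Branch X Y × Branch X Y =>
    (truncBranch i' p.1, truncBranch j' p.2))

open Classical in
lemma tsum_pairMass_snd (hT : OnTrees ρ) (h0 : meanDeg ρ ≠ 0) (h1 : meanDeg ρ ≠ ⊤) {i j j' : ℕ}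
    (hj : j' ≤ j) (t t' : Branch X Y) :
    ∑' s, (if truncBranch j' s = t' then pairMass ρ i j (t, s) else 0) =
      pairMass ρ i j' (t, t') := by
  have h := lintegral_ends hT h0 h1 i j
    fun q => if q.1 = t ∧ truncBranch j' q.2 = t' then 1 else 0
  have key : ∀ (M : Multiset (Branch X Y × Branch X Y)), (M.map fun q =>
      if q.1 = t ∧ truncBranch j' q.2 = t' then (1 : ℝ≥0∞) else 0).sum =
      (M.map fun q => (q.1, truncBranch j' q.2)).count (t, t') := by
    intro M
    induction M using Multiset.induction_on with
    | empty => simp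
    | cons a M ih =>
      rw [Multiset.map_cons, Multiset.sum_cons, ih, Multiset.map_cons, Multiset.count_cons]
      by_cases h : a.1 = t ∧ truncBranch j' a.2 = t'
      · rw [if_pos h, if_pos (Prod.ext h.1.symm h.2.symm)]; simp [add_comm]
      · rw [if_neg h, if_neg fun h' => h ⟨(congrArg Prod.fst h').symm, (congrArg Prod.snd h').symm⟩]
        simp
  have h2 : ∀ τ : MGraph X Y, (ends i j τ).map (fun q => (q.1, truncBranch j' q.2)) =
      ends i j' τ := by
    intro τ
    rw [ends, ends, RawGraph.ends, RawGraph.ends, Multiset.map_map]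
    refine Multiset.map_congr rfl fun a _ => ?_
    simp only [Function.comp, RawGraph.up, RawGraph.branch, truncBranch, trunc_mk,
      RawGraph.trunc_trunc, min_eq_right hj]
  simp only [key, h2] at h
  rw [pairMass, h, mul_comm, ENNReal.mul_div_cancel_right h0 h1]
  conv_rhs => rw [ENNReal.tsum_prod']
  refine Eq.trans ?_ (tsum_eq_single t ?_).symm
  · refine tsum_congr fun s => ?_
    by_cases hs : truncBranch j' s = t' <;> simp [hs]
  · intro t₁ ht
    simp [ht]

/-- The mean number of root edges whose type has mass zero is zero. -/
lemma ae_pairMass_ne_zero (hT : OnTrees ρ) (h0 : meanDeg ρ ≠ 0) (h1 : meanDeg ρ ≠ ⊤) (i j : ℕ) :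
    ∀ᵐ τ ∂ρ, ∀ p ∈ ends i j τ, pairMass ρ i j p ≠ 0 := by
  classical
  have h := lintegral_ends hT h0 h1 i j fun p => if pairMass ρ i j p = 0 then 1 else 0
  have h2 : ∑' p, pairMass ρ i j p * (if pairMass ρ i j p = 0 then 1 else 0) = 0 := by
    refine ENNReal.tsum_eq_zero.2 fun p => ?_
    split_ifs with hp <;> simp [hp]
  rw [h2, mul_zero, lintegral_eq_zero_iff' (hT.aemeasurable_ends i j fun M => (M.map _).sum)] at h
  filter_upwards [h] with τ hτ p hp h3
  have h4 := Multiset.single_le_sum (fun _ _ => zero_le) _ (Multiset.mem_map_of_mem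
    (fun p => if pairMass ρ i j p = 0 then (1 : ℝ≥0∞) else 0) hp)
  rw [if_pos h3] at h4
  rw [show (Multiset.map (fun p => if pairMass ρ i j p = 0 then (1 : ℝ≥0∞) else 0)
    (ends i j τ)).sum = 0 from hτ] at h4
  exact absurd h4 (by simp)

end Pairs

/-! ### The truncated laws -/

open Classical in
lemma edgeCount_eq (h : ℕ) (p : Branch X Y × Branch X Y) (τ : MGraph X Y) :
    edgeCount h p τ = (ends (h - 1) (h - 1) τ).count p := by
  rw [ends, RawGraph.ends, Multiset.count_map, edgeCount]
  have : {a : ℕ | a ∈ τ.rep.nbrs ∧ τ.rep.down (h - 1) a = p.1 ∧ τ.rep.up (h - 1) a = p.2} =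
      ((τ.rep.nbrs.filter fun a => p = (τ.rep.down (h - 1) a, τ.rep.up (h - 1) a) : Finset ℕ) :
        Set ℕ) := by
    ext a
    simp only [Set.mem_ofPred_eq, Finset.coe_filter, Prod.ext_iff, eq_comm]
  rw [this, Set.ncard_coe_finset]
  rfl

open Classical in
lemma ncard_condMass {h : ℕ} (t t' s : Branch X Y) (τ : MGraph X Y) :
    {a : ℕ | a ∈ τ.rep.nbrs ∧ τ.rep.up h a = s ∧ τ.rep.up (h - 1) a = t ∧
      τ.rep.down (h - 1) a = t'}.ncard =
      if truncBranch (h - 1) s = t then (ends (h - 1) h τ).count (t', s) else 0 := by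
  have hup : ∀ a, truncBranch (h - 1) (τ.rep.up h a) = τ.rep.up (h - 1) a := fun a => by
    simp only [RawGraph.up, RawGraph.branch, truncBranch, trunc_mk, RawGraph.trunc_trunc,
      min_eq_right (Nat.sub_le h 1)]
  split_ifs with hs
  · rw [ends, RawGraph.ends, Multiset.count_map]
    have : {a : ℕ | a ∈ τ.rep.nbrs ∧ τ.rep.up h a = s ∧ τ.rep.up (h - 1) a = t ∧
        τ.rep.down (h - 1) a = t'} = ((τ.rep.nbrs.filter fun a => (t', s) =
          (τ.rep.down (h - 1) a, τ.rep.up h a) : Finset ℕ) : Set ℕ) := by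
      ext a
      simp only [Set.mem_ofPred_eq, Finset.coe_filter, Prod.mk.injEq]
      constructor
      · rintro ⟨h1, h2, h3, h4⟩
        exact ⟨h1, h4.symm, h2.symm⟩
      · rintro ⟨h1, h2, h3⟩
        exact ⟨h1, h3.symm, by rw [← hup, ← h3, hs], h2.symm⟩
    rw [this, Set.ncard_coe_finset]
    rfl
  · have : {a : ℕ | a ∈ τ.rep.nbrs ∧ τ.rep.up h a = s ∧ τ.rep.up (h - 1) a = t ∧
        τ.rep.down (h - 1) a = t'} = ∅ := by
      ext a
      simp only [Set.mem_ofPred_eq, Set.mem_empty_iff_false, iff_false]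
      rintro ⟨-, h2, h3, -⟩
      exact hs (by rw [← h2, hup, h3])
    rw [this, Set.ncard_empty]

/-- The degree in the size-biased density cancels against the uniform choice of a neighbour. Hence
`edgeMass` and `covMass` are both `pairMass`. -/
lemma Atomic.lintegral_sizeBiased {S : Set (MGraph X Y)} {μ : Measure (MGraph X Y)}
    (hμ : Atomic S μ) (c : MGraph X Y → ℝ≥0∞) (hc : ∀ τ, deg τ = 0 → c τ = 0) :
    ∫⁻ τ, c τ / deg τ ∂sizeBiased μ = (∫⁻ τ, c τ ∂μ) / meanDeg μ := by
  rw [sizeBiased, hμ.lintegral_withDensity, ENNReal.div_eq_inv_mul,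
    ← lintegral_const_mul'' _ (hμ.aemeasurable c)]
  refine lintegral_congr fun τ => ?_
  by_cases h : deg τ = 0
  · simp [h, hc τ h]
  · rw [mul_comm, mul_div_assoc', mul_comm (c τ / _), ENNReal.mul_div_cancel (by exact_mod_cast h)
      (ENNReal.natCast_ne_top _), ENNReal.div_eq_inv_mul]

open Classical in
lemma edgeMass_eq {S : Set (MGraph X Y)} {μ : Measure (MGraph X Y)} (hμ : Atomic S μ) (h : ℕ)
    (p : Branch X Y × Branch X Y) : edgeMass h μ p = pairMass μ (h - 1) (h - 1) p := by
  rw [edgeMass, hμ.lintegral_sizeBiased, pairMass]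
  · simp only [edgeCount_eq]
  · intro τ hτ
    rw [← card_ends (h - 1) (h - 1), Multiset.card_eq_zero] at hτ
    rw [edgeCount_eq, hτ]
    simp

lemma covMass_eq {μ : Measure (MGraph X Y)} (h : ℕ) (p : Branch X Y × Branch X Y) :
    covMass h μ p = pairMass μ (h - 1) (h - 1) p := by
  rw [covMass, pairMass]
  simp only [edgeCount_eq]

open Classical in
lemma condMass_eq {S : Set (MGraph X Y)} {μ : Measure (MGraph X Y)} (hμ : Atomic S μ) (h : ℕ)
    (t t' s : Branch X Y) : condMass h μ t t' s =
      (if truncBranch (h - 1) s = t then pairMass μ (h - 1) h (t', s) else 0) /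
        pairMass μ (h - 1) (h - 1) (t', t) := by
  rw [condMass, edgeMass_eq hμ, hμ.lintegral_sizeBiased]
  · congr 1
    simp only [ncard_condMass]
    split_ifs <;> simp [pairMass]
  · intro τ hτ
    rw [← card_ends (h - 1) h, Multiset.card_eq_zero] at hτ
    rw [ncard_condMass, hτ]
    simp

section Marginal

variable {ρ : Measure (MGraph X Y)}

instance [IsProbabilityMeasure ρ] (h : ℕ) : IsProbabilityMeasure (marginal ρ h) :=
  Measure.isProbabilityMeasure_map (measurable_trunc h).aemeasurable

lemma atomic_marginal [Finite X] [Finite Y] (hT : OnTrees ρ) (h : ℕ) :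
    Atomic (truncTrees X Y h) (marginal ρ h) := by
  have h1 : ∀ a ∈ truncTrees X Y h, MeasurableSet ({a} : Set (MGraph X Y)) := fun a ha =>
    measurableSet_singleton_of_mem ha
  refine ⟨countable_truncTrees h, h1, ?_⟩
  have h2 : MeasurableSet (truncTrees X Y h) := by
    rw [← Set.biUnion_of_singleton (truncTrees X Y h)]
    exact MeasurableSet.biUnion (countable_truncTrees h) h1
  rw [marginal, Measure.map_apply (measurable_trunc h) h2.compl]
  rw [measure_eq_zero_iff_ae_notMem]
  filter_upwards [hT] with τ hτ h'
  exact h' (MGraph.IsTree.trunc_mem hτ h)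

lemma onTrees_of_atomic {μ : Measure (MGraph X Y)} {h : ℕ} (hμ : Atomic (truncTrees X Y h) μ) :
    OnTrees μ := hμ.ae_mem.mono fun _ hσ => hσ.1

variable [Finite X] [Finite Y]

lemma lintegral_marginal (hT : OnTrees ρ) (h : ℕ) (f : MGraph X Y → ℝ≥0∞) :
    ∫⁻ σ, f σ ∂marginal ρ h = ∫⁻ τ, f (trunc h τ) ∂ρ :=
  lintegral_map' ((atomic_marginal hT h).aemeasurable f) (measurable_trunc h).aemeasurable

lemma deg_trunc {τ : MGraph X Y} (hτ : τ.IsTree) (k : ℕ) : deg (trunc (k + 1) τ) = deg τ := by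
  rw [← card_entries 0, hτ.entries_trunc k.zero_le, card_entries]

lemma meanDeg_marginal (hT : OnTrees ρ) (k : ℕ) : meanDeg (marginal ρ (k + 1)) = meanDeg ρ := by
  rw [meanDeg, lintegral_marginal hT]
  refine lintegral_congr_ae ?_
  filter_upwards [hT] with τ hτ
  rw [deg_trunc hτ]

lemma degLogMoment_marginal (hT : OnTrees ρ) (k : ℕ) :
    degLogMoment (marginal ρ (k + 1)) = degLogMoment ρ := by
  rw [degLogMoment, lintegral_marginal hT]
  refine lintegral_congr_ae ?_
  filter_upwards [hT] with τ hτ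
  rw [deg_trunc hτ]

lemma pairMass_marginal (hT : OnTrees ρ) {i j k : ℕ} (hi : i ≤ k) (hj : j ≤ k + 1)
    (p : Branch X Y × Branch X Y) : pairMass (marginal ρ (k + 1)) i j p = pairMass ρ i j p := by
  rw [pairMass, meanDeg_marginal hT, lintegral_marginal hT, pairMass]
  congr 1
  refine lintegral_congr_ae ?_
  filter_upwards [hT] with τ hτ
  rw [MGraph.IsTree.ends_trunc hτ hi hj]

lemma ae_marginal_ne_zero [IsProbabilityMeasure ρ] (hT : OnTrees ρ) (h : ℕ) :
    ∀ᵐ τ ∂ρ, marginal ρ h {trunc h τ} ≠ 0 :=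
  ae_of_ae_map (measurable_trunc h).aemeasurable (atomic_marginal hT h).ae_ne_zero

lemma shannon_marginal [IsProbabilityMeasure ρ] (hT : OnTrees ρ) (h : ℕ) :
    shannon (fun σ => marginal ρ h {σ}) = ∫⁻ τ, surprisal (marginal ρ h {trunc h τ}) ∂ρ := by
  rw [(atomic_marginal hT h).shannon_eq, lintegral_marginal hT]

/-- Turns the entropy of an edge law into the mean of a sum over the root edges, which can be
compared pointwise with logarithms of products over these edges. -/
lemma shannon_pairMass (hT : OnTrees ρ) (h0 : meanDeg ρ ≠ 0) (h1 : meanDeg ρ ≠ ⊤) (i j : ℕ) :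
    meanDeg ρ * shannon (pairMass ρ i j) =
      ∫⁻ τ, ((ends i j τ).map fun p => surprisal (pairMass ρ i j p)).sum ∂ρ := by
  rw [lintegral_ends hT h0 h1, shannon_eq (pairMass_ne_top hT h0 h1 i j)]

end Marginal

end

/-! ### Resampling the branches at the root: the one-step extension. -/

section

variable {X : Type u} {Y : Type v} [Nonempty Y]

/-! ### Replacing the branches at the root -/

lemma entries_rep (k : ℕ) (τ : MGraph X Y) : entries k τ =
    (Finset.univ : Finset τ.rep.nbrs).val.map
      fun a : τ.rep.nbrs => (τ.rep.down k a, τ.rep.emark τ.rep.root a) := by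
  rw [map_univ_coe τ.rep.nbrs fun a => (τ.rep.down k a, τ.rep.emark τ.rep.root a), entries, ends,
    RawGraph.ends, Multiset.map_map]
  rfl

lemma ends_rep (i j : ℕ) (τ : MGraph X Y) : ends i j τ =
    (Finset.univ : Finset τ.rep.nbrs).val.map
      fun a : τ.rep.nbrs => (τ.rep.down i a, τ.rep.up j a) := by
  rw [map_univ_coe τ.rep.nbrs fun a => (τ.rep.down i a, τ.rep.up j a)]
  rfl

lemma MGraph.IsTree.rep_up {τ : MGraph X Y} (hτ : τ.IsTree) {j k : ℕ} (hj : j ≤ k + 1)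
    (a : τ.rep.nbrs) : τ.rep.up j a =
      upBranch j (rootMark τ) (entries k τ) (τ.rep.down k a, τ.rep.emark τ.rep.root a) := by
  have h : (τ.rep.down k a, τ.rep.up j a) ∈ ends k j τ := by
    rw [ends_rep]
    exact Multiset.mem_map_of_mem (fun a : τ.rep.nbrs => (τ.rep.down k a, τ.rep.up j a))
      (Finset.mem_univ a)
  rw [hτ.ends_eq le_rfl hj] at h
  obtain ⟨e, he, h1⟩ := Multiset.mem_map.1 h
  have h2 := congrArg Prod.fst h1
  have h3 := congrArg Prod.snd h1
  have h4 : truncBranch k e.1 = e.1 := truncBranch_of_mem (hτ.entries_mem he)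
  simp only [h4] at h2 h3
  have h5 : e = (τ.rep.down k a, τ.rep.emark τ.rep.root a) :=
    Prod.ext h2 (show e.2 = _ from congrArg (fun t : Branch X Y => t.2) h3)
  rw [← h3, h5]

section Replace

variable {τ : MGraph X Y} {j : ℕ} {s : τ.rep.nbrs → Branch X Y}

lemma entries_replaceBranches (hs : ∀ a, s a ∈ truncBranches X Y j) :
    entries j (replaceBranches τ s) = (Finset.univ : Finset τ.rep.nbrs).val.map
      fun a : τ.rep.nbrs => (s a, τ.rep.emark τ.rep.root a) := by
  rw [replaceBranches_eq, entries_graft, Multiset.map_map]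
  refine Multiset.map_congr rfl fun a _ => ?_
  rw [Function.comp, truncEntry, truncBranch_of_mem (hs a)]

lemma map_truncEntry_replace (hs : ∀ a, truncBranch j (s a) = τ.rep.down j a) :
    ((Finset.univ : Finset τ.rep.nbrs).val.map
      fun a : τ.rep.nbrs => (s a, τ.rep.emark τ.rep.root a)).map (truncEntry j) = entries j τ := by
  rw [entries_rep, Multiset.map_map]
  refine Multiset.map_congr rfl fun a _ => ?_
  rw [Function.comp, truncEntry, hs a]

lemma replaceBranches_mem (hs : ∀ a, s a ∈ truncBranches X Y j) :
    replaceBranches τ s ∈ truncTrees X Y (j + 1) := by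
  rw [replaceBranches_eq]
  refine graft_mem_truncTrees fun e he => ?_
  obtain ⟨a, -, rfl⟩ := Multiset.mem_map.1 he
  exact hs a

lemma trunc_replaceBranches (hτ : τ.IsTree) (hs : ∀ a, truncBranch j (s a) = τ.rep.down j a) :
    trunc (j + 1) (replaceBranches τ s) = trunc (j + 1) τ := by
  rw [replaceBranches_eq, trunc_succ_graft, map_truncEntry_replace hs, hτ.trunc_succ]

/-- The root-side branch of depth `j + 1` sees the other branches only to depth `j`, where the new
branches agree with the old ones. Resampling therefore changes only the far side of each edge. -/
lemma ends_replaceBranches (hτ : τ.IsTree) (hs : ∀ a, truncBranch j (s a) = τ.rep.down j a)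
    (hs' : ∀ a, s a ∈ truncBranches X Y (j + 1)) :
    ends (j + 1) (j + 1) (replaceBranches τ s) = (Finset.univ : Finset τ.rep.nbrs).val.map
      fun a : τ.rep.nbrs => (s a, τ.rep.up (j + 1) a) := by
  rw [replaceBranches_eq, ends_graft', Multiset.map_map]
  refine Multiset.map_congr rfl fun a ha => ?_
  rw [Function.comp, truncBranch_of_mem (hs' a), hτ.rep_up (k := j) le_rfl, ← upBranch_map le_rfl,
    map_truncEntry_replace hs, truncEntry, hs a]
  exact Multiset.mem_map_of_mem (fun a : τ.rep.nbrs => (s a, τ.rep.emark τ.rep.root a)) ha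

end Replace

/-! ### The one-step extension -/

section Extension

variable [Finite X] [Finite Y] {ρ : Measure (MGraph X Y)} {j : ℕ}

open Classical in
lemma condMass_marginal (hT : OnTrees ρ) (t t' s : Branch X Y) :
    condMass (j + 1) (marginal ρ (j + 1)) t t' s =
      (if truncBranch j s = t then pairMass ρ j (j + 1) (t', s) else 0) /
        pairMass ρ j j (t', t) := by
  rw [condMass_eq (atomic_marginal hT _)]
  simp only [Nat.add_sub_cancel]
  rw [pairMass_marginal hT le_rfl le_rfl, pairMass_marginal hT le_rfl (Nat.le_succ j)]

/-- An atom of a truncated law is the truncation of some tree with any prescribed almost sure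
property; this transfers almost sure statements to atoms. -/
lemma exists_of_marginal_ne_zero {h : ℕ} (hT : OnTrees ρ) {τ : MGraph X Y}
    (hτ : marginal ρ h {τ} ≠ 0) {P : MGraph X Y → Prop} (hP : ∀ᵐ τ ∂ρ, P τ) :
    ∃ τ', P τ' ∧ trunc h τ' = τ := by
  by_contra hc
  push Not at hc
  have hmem : τ ∈ truncTrees X Y h := by
    by_contra hm
    exact hτ ((atomic_marginal hT h).apply_of_notMem hm)
  refine hτ ?_
  rw [marginal, Measure.map_apply (measurable_trunc h) (measurableSet_singleton_of_mem hmem)]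
  rw [measure_eq_zero_iff_ae_notMem]
  filter_upwards [hP] with τ' h1 h2
  exact hc τ' h1 h2

lemma isTree_of_marginal_ne_zero {h : ℕ} (hT : OnTrees ρ) {τ : MGraph X Y}
    (hτ : marginal ρ h {τ} ≠ 0) : τ ∈ truncTrees X Y h := by
  by_contra hm
  exact hτ ((atomic_marginal hT h).apply_of_notMem hm)

lemma pairMass_ne_zero_of_marginal (hT : OnTrees ρ) (h0 : meanDeg ρ ≠ 0) (h1 : meanDeg ρ ≠ ⊤)
    {i i' k : ℕ} (hi : i ≤ k) (hi' : i' ≤ k + 1) {τ : MGraph X Y}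
    (hτ : marginal ρ (k + 1) {τ} ≠ 0) {p : Branch X Y × Branch X Y} (hp : p ∈ ends i i' τ) :
    pairMass ρ i i' p ≠ 0 := by
  obtain ⟨τ', ⟨h2, h3⟩, rfl⟩ := exists_of_marginal_ne_zero hT hτ
    ((ae_pairMass_ne_zero hT h0 h1 i i').and hT)
  rw [MGraph.IsTree.ends_trunc h3 hi hi'] at hp
  exact h2 p hp

lemma condMass_eq_zero (hT : OnTrees ρ) {t t' s : Branch X Y}
    (h : ¬ (truncBranch j s = t ∧ s ∈ truncBranches X Y (j + 1))) :
    condMass (j + 1) (marginal ρ (j + 1)) t t' s = 0 := by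
  classical
  rw [condMass_marginal hT]
  split_ifs with h1
  · rw [pairMass_eq_zero hT fun h2 => h ⟨h1, h2.2⟩, ENNReal.zero_div]
  · exact ENNReal.zero_div

/-- Summing the numerator over all refinements of `t` restores the denominator. The symmetry of the
edge law matches the order of the pair in the hypothesis. -/
lemma tsum_condMass (hT : OnTrees ρ) (hU : Unimodular ρ) (h0 : meanDeg ρ ≠ 0)
    (h1 : meanDeg ρ ≠ ⊤) {t t' : Branch X Y} (h : pairMass ρ j j (t, t') ≠ 0) :
    ∑' s, condMass (j + 1) (marginal ρ (j + 1)) t t' s = 1 := by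
  classical
  simp only [condMass_marginal hT, div_eq_mul_inv]
  rw [ENNReal.tsum_mul_right, tsum_pairMass_snd hT h0 h1 (Nat.le_succ j), ← div_eq_mul_inv]
  rw [← pairMass_swap hT hU] at h
  exact ENNReal.div_self h (pairMass_ne_top hT h0 h1 _ _ _)

/-- The weight of a choice of new branches at the root. -/
def replaceWeight (ρ : Measure (MGraph X Y)) (j : ℕ) (τ : MGraph X Y)
    (s : τ.rep.nbrs → Branch X Y) : ℝ≥0∞ :=
  ∏ a : τ.rep.nbrs, condMass (j + 1) (marginal ρ (j + 1)) (τ.rep.down j a) (τ.rep.up j a) (s a)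

lemma of_replaceWeight_ne_zero (hT : OnTrees ρ) {τ : MGraph X Y} {s : τ.rep.nbrs → Branch X Y}
    (h : replaceWeight ρ j τ s ≠ 0) (a : τ.rep.nbrs) : truncBranch j (s a) = τ.rep.down j a ∧
      s a ∈ truncBranches X Y (j + 1) := by
  by_contra hc
  exact h (Finset.prod_eq_zero (Finset.mem_univ a) (condMass_eq_zero hT hc))

open Classical in
/-- The point masses of the one-step extension. -/
def extensionMass (ρ : Measure (MGraph X Y)) (j : ℕ) (σ : MGraph X Y) : ℝ≥0∞ :=
  ∑' τ, marginal ρ (j + 1) {τ} * ∑' s : τ.rep.nbrs → Branch X Y,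
    if replaceBranches τ s = σ then replaceWeight ρ j τ s else 0

lemma extension_eq (hT : OnTrees ρ) :
    extension (j + 1) (marginal ρ (j + 1)) = ofMass (extensionMass ρ j) := by
  rw [extension]
  congr 1
  funext σ
  rw [(atomic_marginal hT (j + 1)).lintegral]
  rfl

lemma extensionMass_eq_zero (hT : OnTrees ρ) {σ : MGraph X Y}
    (hσ : σ ∉ truncTrees X Y (j + 2)) : extensionMass ρ j σ = 0 := by
  classical
  refine ENNReal.tsum_eq_zero.2 fun τ => mul_eq_zero_of_right _ (ENNReal.tsum_eq_zero.2 fun s => ?_)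
  split_ifs with h
  · by_contra hw
    exact hσ (h ▸ replaceBranches_mem fun a => (of_replaceWeight_ne_zero hT hw a).2)
  · rfl

lemma atomic_extension (hT : OnTrees ρ) :
    Atomic (truncTrees X Y (j + 2)) (extension (j + 1) (marginal ρ (j + 1))) := by
  rw [extension_eq hT]
  exact atomic_ofMass (countable_truncTrees _) (fun _ h => measurableSet_singleton_of_mem h)
    fun _ h => extensionMass_eq_zero hT h

/-- Integration over the two-stage experiment, a tree and then its new branches, without collecting
the choices that yield the same tree. -/
lemma lintegral_extension (hT : OnTrees ρ) (f : MGraph X Y → ℝ≥0∞) :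
    ∫⁻ σ, f σ ∂extension (j + 1) (marginal ρ (j + 1)) =
      ∑' τ, marginal ρ (j + 1) {τ} * ∑' s : τ.rep.nbrs → Branch X Y,
        replaceWeight ρ j τ s * f (replaceBranches τ s) := by
  classical
  rw [extension_eq hT, lintegral_ofMass (countable_truncTrees (j + 2))
    (fun _ h => measurableSet_singleton_of_mem h) fun _ h => extensionMass_eq_zero hT h]
  simp only [extensionMass, ← ENNReal.tsum_mul_right]
  rw [ENNReal.tsum_comm]
  refine tsum_congr fun τ => ?_
  simp only [mul_assoc]
  rw [ENNReal.tsum_mul_left]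
  congr 1
  simp only [← ENNReal.tsum_mul_right]
  rw [ENNReal.tsum_comm]
  refine tsum_congr fun s => ?_
  rw [tsum_eq_single (replaceBranches τ s)]
  · rw [if_pos rfl]
  · intro σ hσ
    rw [if_neg hσ.symm, zero_mul]

lemma mem_ends_rep {i i' : ℕ} {τ : MGraph X Y} (a : τ.rep.nbrs) :
    (τ.rep.down i a, τ.rep.up i' a) ∈ ends i i' τ := by
  rw [ends_rep]
  exact Multiset.mem_map_of_mem (fun a : τ.rep.nbrs => (τ.rep.down i a, τ.rep.up i' a))
    (Finset.mem_univ a)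

lemma tsum_condMass_rep (hT : OnTrees ρ) (hU : Unimodular ρ) (h0 : meanDeg ρ ≠ 0)
    (h1 : meanDeg ρ ≠ ⊤) {τ : MGraph X Y} (hτ : marginal ρ (j + 1) {τ} ≠ 0) (a : τ.rep.nbrs) :
    ∑' b, condMass (j + 1) (marginal ρ (j + 1)) (τ.rep.down j a) (τ.rep.up j a) b = 1 :=
  tsum_condMass hT hU h0 h1 (pairMass_ne_zero_of_marginal hT h0 h1 le_rfl (Nat.le_succ j) hτ
    (mem_ends_rep a))

lemma truncBranch_up {i k : ℕ} (hi : i ≤ k) (G : RawGraph X Y) (a : ℕ) :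
    truncBranch i (G.up k a) = G.up i a := by
  simp only [RawGraph.up, RawGraph.branch, truncBranch, trunc_mk, RawGraph.trunc_trunc,
    min_eq_right hi]

lemma extension_univ [IsProbabilityMeasure ρ] (hT : OnTrees ρ) (hU : Unimodular ρ)
    (h0 : meanDeg ρ ≠ 0) (h1 : meanDeg ρ ≠ ⊤) :
    IsProbabilityMeasure (extension (j + 1) (marginal ρ (j + 1))) := by
  constructor
  rw [← lintegral_one, lintegral_extension hT]
  have h2 : ∑' τ, marginal ρ (j + 1) {τ} = 1 := by
    have := (atomic_marginal hT (j + 1)).lintegral 1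
    simpa using this.symm
  refine Eq.trans (tsum_congr fun τ => ?_) h2
  by_cases hτ : marginal ρ (j + 1) {τ} = 0
  · rw [hτ, zero_mul]
  · simp only [mul_one, replaceWeight]
    rw [tsum_pi fun (a : τ.rep.nbrs) b => condMass (j + 1) (marginal ρ (j + 1)) (τ.rep.down j a) (τ.rep.up j a) b,
      Finset.prod_eq_one fun a _ => tsum_condMass_rep hT hU h0 h1 hτ a, mul_one]

/-- Integrals of sums over the edges at the root with respect to the one-step extension. -/
lemma lintegral_ends_extension (hT : OnTrees ρ) (hU : Unimodular ρ) (h0 : meanDeg ρ ≠ 0)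
    (h1 : meanDeg ρ ≠ ⊤) (g : Branch X Y × Branch X Y → ℝ≥0∞) :
    ∫⁻ σ, ((ends (j + 1) (j + 1) σ).map g).sum ∂extension (j + 1) (marginal ρ (j + 1)) =
      meanDeg ρ * ∑' p : Branch X Y × Branch X Y, pairMass ρ j (j + 1) p *
        ∑' b, condMass (j + 1) (marginal ρ (j + 1)) p.1 (truncBranch j p.2) b * g (b, p.2) := by
  rw [lintegral_extension hT, ← lintegral_ends hT h0 h1, ← lintegral_congr_ae (f := fun τ =>
    ((ends j (j + 1) (trunc (j + 1) τ)).map fun p => ∑' b, condMass (j + 1) (marginal ρ (j + 1))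
      p.1 (truncBranch j p.2) b * g (b, p.2)).sum),
    ← lintegral_marginal hT (j + 1) fun τ => ((ends j (j + 1) τ).map fun p =>
      ∑' b, condMass (j + 1) (marginal ρ (j + 1)) p.1 (truncBranch j p.2) b * g (b, p.2)).sum,
    (atomic_marginal hT (j + 1)).lintegral]
  · refine tsum_congr fun τ => ?_
    by_cases hτ : marginal ρ (j + 1) {τ} = 0
    · rw [hτ, zero_mul, zero_mul]
    congr 1
    have hτT := (isTree_of_marginal_ne_zero hT hτ).1
    rw [ends_rep, Multiset.map_map]
    change _ = ∑ a : τ.rep.nbrs, _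
    have h2 : ∀ s : τ.rep.nbrs → Branch X Y, replaceWeight ρ j τ s *
        ((ends (j + 1) (j + 1) (replaceBranches τ s)).map g).sum =
        ∑ a : τ.rep.nbrs, replaceWeight ρ j τ s * g (s a, τ.rep.up (j + 1) a) := by
      intro s
      by_cases hw : replaceWeight ρ j τ s = 0
      · simp [hw]
      · rw [← Finset.mul_sum, ends_replaceBranches hτT
          (fun a => (of_replaceWeight_ne_zero hT hw a).1)
          (fun a => (of_replaceWeight_ne_zero hT hw a).2), Multiset.map_map]
        rfl
    rw [tsum_congr h2, Summable.tsum_finsetSum fun _ _ => ENNReal.summable]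
    refine Finset.sum_congr rfl fun a _ => ?_
    have h3 := tsum_pi_mul (fun (a : τ.rep.nbrs) b => condMass (j + 1) (marginal ρ (j + 1))
      (τ.rep.down j a) (τ.rep.up j a) b) (tsum_condMass_rep hT hU h0 h1 hτ) a
      (fun b => g (b, τ.rep.up (j + 1) a))
    simp only [replaceWeight, Function.comp, truncBranch_up (Nat.le_succ j)]
    exact h3
  · filter_upwards [hT] with τ hτ
    rw [MGraph.IsTree.ends_trunc hτ (Nat.le_refl j) le_rfl]

lemma meanDeg_extension (hT : OnTrees ρ) (hU : Unimodular ρ) (h0 : meanDeg ρ ≠ 0)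
    (h1 : meanDeg ρ ≠ ⊤) : meanDeg (extension (j + 1) (marginal ρ (j + 1))) = meanDeg ρ := by
  have h := lintegral_ends_extension (j := j) hT hU h0 h1 fun _ => 1
  simp only [Multiset.map_const', Multiset.sum_replicate, card_ends, mul_one, nsmul_eq_mul] at h
  change meanDeg _ = _ at h
  rw [h]
  conv_rhs => rw [← mul_one (meanDeg ρ), ← tsum_pairMass hT h0 h1 j (j + 1)]
  congr 1
  refine tsum_congr fun p => ?_
  by_cases hp : pairMass ρ j (j + 1) p = 0
  · rw [hp, zero_mul]
  · rw [tsum_condMass hT hU h0 h1, mul_one]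
    intro h2
    have h3 := pairMass_le_trunc (ρ := ρ) (le_refl j) (Nat.le_succ j) p
    by_cases hp1 : p.1 ∈ truncBranches X Y j
    · rw [truncBranch_of_mem hp1, h2] at h3
      exact hp (le_antisymm h3 zero_le)
    · exact hp (pairMass_eq_zero hT fun h => hp1 h.1)

/-- The far branch is redrawn given the truncations of both sides, independently of the deepest
generation of the root side. The new edge law thus couples the two sides conditionally
independently. -/
lemma pairMass_extension (hT : OnTrees ρ) (hU : Unimodular ρ) (h0 : meanDeg ρ ≠ 0)
    (h1 : meanDeg ρ ≠ ⊤) (t t' : Branch X Y) :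
    pairMass (extension (j + 1) (marginal ρ (j + 1))) (j + 1) (j + 1) (t, t') =
      pairMass ρ j (j + 1) (truncBranch j t, t') *
        (pairMass ρ j (j + 1) (truncBranch j t', t) /
          pairMass ρ j j (truncBranch j t', truncBranch j t)) := by
  classical
  have h := lintegral_ends_extension (j := j) hT hU h0 h1 fun q => if q = (t, t') then 1 else 0
  simp only [sum_map_ite_eq] at h
  rw [pairMass, meanDeg_extension hT hU h0 h1, h, mul_comm, ENNReal.mul_div_cancel_right h0 h1]
  simp only [condMass_marginal hT]
  rw [tsum_eq_single (truncBranch j t, t')]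
  · simp
  · rintro ⟨t₁, u⟩ hp
    by_cases hu : u = t'
    · have ht : truncBranch j t ≠ t₁ := fun h => hp (by rw [h, hu])
      simp [ht]
    · simp [hu]

end Extension

end

/-! ### Exact point masses at depth at least two. -/

section

variable {X : Type u} {Y : Type v} [Nonempty Y]

/-! ### Point masses of the one-step extension -/

section ExtensionMass

variable [Finite X] [Finite Y] {ρ : Measure (MGraph X Y)} {j : ℕ}

lemma tsum_ite_mem_const {α : Type*} {A : Set α} (hA : A.Finite) (c : ℝ≥0∞) [DecidablePred (· ∈ A)] :
    ∑' a, (if a ∈ A then c else 0) = A.ncard * c := by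
  rw [tsum_eq_sum (s := hA.toFinset) fun a ha => if_neg fun h => ha (hA.mem_toFinset.2 h),
    Finset.sum_congr rfl fun a ha => if_pos (hA.mem_toFinset.1 ha), Finset.sum_const,
    Set.ncard_eq_toFinset_card A hA, nsmul_eq_mul]

/-- `ncard_families` applied to the entries of depth `j + 1` lying over those of depth `j`: the
number of assignments of new branches that produce `σ`. -/
lemma ncard_replacements {τ σ : MGraph X Y} (hσ : σ.IsTree) (hτ : trunc (j + 1) σ = τ) :
    {s : τ.rep.nbrs → Branch X Y | (Finset.univ : Finset τ.rep.nbrs).val.map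
        (fun a : τ.rep.nbrs => (s a, τ.rep.emark τ.rep.root a)) = entries (j + 1) σ ∧
        ∀ a, truncBranch j (s a) = τ.rep.down j a}.ncard * factProd (entries (j + 1) σ) =
      factProd (entries j σ) ∧
    {s : τ.rep.nbrs → Branch X Y | (Finset.univ : Finset τ.rep.nbrs).val.map
        (fun a : τ.rep.nbrs => (s a, τ.rep.emark τ.rep.root a)) = entries (j + 1) σ ∧
        ∀ a, truncBranch j (s a) = τ.rep.down j a}.Finite := by
  have h1 : (entries (j + 1) σ).map (truncEntry j) = (Finset.univ : Finset τ.rep.nbrs).val.map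
      fun a : τ.rep.nbrs => (τ.rep.down j a, τ.rep.emark τ.rep.root a) := by
    rw [hσ.map_entries (Nat.le_succ j), ← hσ.entries_trunc le_rfl, hτ, entries_rep]
  have h2 := ncard_families h1
  rw [hσ.map_entries (Nat.le_succ j)] at h2
  set A : Set (τ.rep.nbrs → Branch X Y) := {s | (Finset.univ : Finset τ.rep.nbrs).val.map
        (fun a : τ.rep.nbrs => (s a, τ.rep.emark τ.rep.root a)) = entries (j + 1) σ ∧
        ∀ a, truncBranch j (s a) = τ.rep.down j a}
  have hinj : Function.Injective fun (s : τ.rep.nbrs → Branch X Y) (a : τ.rep.nbrs) =>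
      (s a, τ.rep.emark τ.rep.root a) := fun s s' h => funext fun a =>
    congrArg Prod.fst (congrFun h a)
  have himg : (fun (s : τ.rep.nbrs → Branch X Y) (a : τ.rep.nbrs) =>
      (s a, τ.rep.emark τ.rep.root a)) '' A = {g | Finset.univ.val.map g = entries (j + 1) σ ∧
        truncEntry j ∘ g = fun a : τ.rep.nbrs => (τ.rep.down j a, τ.rep.emark τ.rep.root a)} := by
    ext g
    constructor
    · rintro ⟨s, ⟨h3, h4⟩, rfl⟩
      refine ⟨h3, funext fun a => ?_⟩
      rw [Function.comp, truncEntry, h4 a]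
    · rintro ⟨h3, h4⟩
      have h5 : (fun a : τ.rep.nbrs => ((g a).1, τ.rep.emark τ.rep.root a)) = g := funext fun a =>
        Prod.ext rfl (congrArg Prod.snd (congrFun h4 a)).symm
      refine ⟨fun a => (g a).1, ⟨?_, fun a => congrArg Prod.fst (congrFun h4 a)⟩, h5⟩
      rw [h5, h3]
  rw [← himg, Set.ncard_image_of_injective _ hinj] at h2
  exact ⟨h2.1, Set.Finite.of_finite_image h2.2 hinj.injOn⟩

/-- The density of the law of a new branch with respect to the edge. -/
def newMass (ρ : Measure (MGraph X Y)) (j : ℕ) (p : Branch X Y × Branch X Y) : ℝ≥0∞ :=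
  pairMass ρ j (j + 1) (truncBranch j p.2, p.1) /
    pairMass ρ j j (truncBranch j p.2, truncBranch j p.1)

/-- Only the truncation of `σ` can be extended to `σ`, and all assignments that do so have the same
weight. The mass is therefore the number of assignments times this weight; the quotient of
factorials is written as a product on both sides. -/
lemma extension_singleton (hT : OnTrees ρ) {σ : MGraph X Y} (hσ : σ ∈ truncTrees X Y (j + 2)) :
    extension (j + 1) (marginal ρ (j + 1)) {σ} * factProd (entries (j + 1) σ) =
      marginal ρ (j + 1) {trunc (j + 1) σ} * factProd (entries j σ) *
        ((ends (j + 1) (j + 1) σ).map (newMass ρ j)).prod := by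
  classical
  rw [extension_eq hT, ofMass_singleton _ (measurableSet_singleton_of_mem hσ), extensionMass,
    tsum_eq_single (trunc (j + 1) σ)]
  · by_cases hm : marginal ρ (j + 1) {trunc (j + 1) σ} = 0
    · simp only [hm, zero_mul]
    generalize hτ : trunc (j + 1) σ = τ at hm ⊢
    have hτT : τ.IsTree := hτ ▸ hσ.1.trunc (j + 1)
    obtain ⟨h1, h2⟩ := ncard_replacements hσ.1 hτ
    set A : Set (τ.rep.nbrs → Branch X Y) := {s | (Finset.univ : Finset τ.rep.nbrs).val.map
        (fun a : τ.rep.nbrs => (s a, τ.rep.emark τ.rep.root a)) = entries (j + 1) σ ∧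
        ∀ a, truncBranch j (s a) = τ.rep.down j a} with hA
    have h3 : ∀ s : τ.rep.nbrs → Branch X Y,
        (if replaceBranches τ s = σ then replaceWeight ρ j τ s else 0) =
        if s ∈ A then ((ends (j + 1) (j + 1) σ).map (newMass ρ j)).prod else 0 := by
      intro s
      by_cases hs : s ∈ A
      · have hmem : ∀ a, s a ∈ truncBranches X Y (j + 1) := fun a => by
          have : (s a, τ.rep.emark τ.rep.root a) ∈ entries (j + 1) σ := by
            rw [← hs.1]
            exact Multiset.mem_map_of_mem
              (fun a : τ.rep.nbrs => (s a, τ.rep.emark τ.rep.root a)) (Finset.mem_univ a)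
          exact hσ.1.entries_mem this
        have h4 : replaceBranches τ s = σ := by
          rw [replaceBranches_eq, hs.1, ← hτ, rootMark_trunc, ← eq_graft_of_mem hσ]
        rw [if_pos hs, if_pos h4, ← h4, ends_replaceBranches hτT hs.2 hmem, Multiset.map_map]
        refine Finset.prod_congr rfl fun a _ => ?_
        rw [condMass_marginal hT, if_pos (hs.2 a), Function.comp, newMass]
        simp only [truncBranch_up (Nat.le_succ j), hs.2 a]
      · rw [if_neg hs]
        split_ifs with h4
        · by_contra hw
          have h5 := of_replaceWeight_ne_zero hT hw
          refine hs ⟨?_, fun a => (h5 a).1⟩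
          rw [← entries_replaceBranches (fun a => (h5 a).2), h4]
        · rfl
    rw [tsum_congr h3, tsum_ite_mem_const h2, ← h1]
    push_cast
    ring
  · intro τ hτ
    by_cases hm : marginal ρ (j + 1) {τ} = 0
    · rw [hm, zero_mul]
    have hτT := isTree_of_marginal_ne_zero hT hm
    refine mul_eq_zero_of_right _ (ENNReal.tsum_eq_zero.2 fun s => ?_)
    split_ifs with h4
    · by_contra hw
      refine hτ ?_
      rw [← h4, trunc_replaceBranches hτT.1 fun a => (of_replaceWeight_ne_zero hT hw a).1, hτT.2]
    · rfl

/-! ### The law with corrected edge marginals -/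

/-- The density of `hatLaw` at an edge. -/
def edgeRatio (ρ : Measure (MGraph X Y)) (j : ℕ) (p : Branch X Y × Branch X Y) : ℝ≥0∞ :=
  pairMass ρ (j + 1) (j + 1) p /
    pairMass (extension (j + 1) (marginal ρ (j + 1))) (j + 1) (j + 1) p

lemma hatLaw_eq (hT : OnTrees ρ) : hatLaw ρ (j + 2) =
    (extension (j + 1) (marginal ρ (j + 1))).withDensity fun σ =>
      ((ends (j + 1) (j + 1) σ).map (edgeRatio ρ j)).prod := by
  rw [hatLaw]
  change (extension (j + 1) (marginal ρ (j + 1))).withDensity _ = _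
  congr 1
  funext σ
  rw [ends, RawGraph.ends, Multiset.map_map]
  change _ = ∏ a ∈ σ.rep.nbrs, _
  refine Finset.prod_congr rfl fun a _ => ?_
  change edgeMass (j + 2) (marginal ρ (j + 2)) _ /
    edgeMass (j + 2) (extension (j + 1) (marginal ρ (j + 1))) _ = _
  rw [edgeMass_eq (atomic_marginal hT _), edgeMass_eq (atomic_extension hT), Function.comp,
    edgeRatio]
  simp only [show j + 2 - 1 = j + 1 from rfl]
  rw [pairMass_marginal hT le_rfl (Nat.le_succ _)]

lemma atomic_hatLaw (hT : OnTrees ρ) : Atomic (truncTrees X Y (j + 2)) (hatLaw ρ (j + 2)) := by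
  rw [hatLaw_eq hT]
  exact (atomic_extension hT).withDensity _

/-- By `pairMass_extension` the edge mass of the extension contains `newMass` as a factor. It
cancels, and the conditional law of the far branch given the full root side remains. -/
lemma newMass_mul_edgeRatio (hT : OnTrees ρ) (hU : Unimodular ρ) (h0 : meanDeg ρ ≠ 0)
    (h1 : meanDeg ρ ≠ ⊤) {p : Branch X Y × Branch X Y}
    (hp : pairMass ρ j (j + 1) (truncBranch j p.1, p.2) ≠ 0) :
    newMass ρ j p * edgeRatio ρ j p =
      pairMass ρ (j + 1) (j + 1) p / pairMass ρ j (j + 1) (truncBranch j p.1, p.2) := by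
  obtain ⟨t, t'⟩ := p
  rw [edgeRatio, pairMass_extension hT hU h0 h1, newMass]
  simp only at hp ⊢
  set A := pairMass ρ j (j + 1) (truncBranch j t', t) with hA
  set B := pairMass ρ j j (truncBranch j t', truncBranch j t) with hB
  set C := pairMass ρ j (j + 1) (truncBranch j t, t')
  have hAB : A ≤ B := by
    have h2 := pairMass_le_trunc (ρ := ρ) (le_refl j) (Nat.le_succ j) (truncBranch j t', t)
    have h3 : truncBranch j (truncBranch j t') = truncBranch j t' := by
      rw [truncBranch_truncBranch, min_self]
    simpa only [h3] using h2
  have hDA : pairMass ρ (j + 1) (j + 1) (t, t') ≤ A := by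
    have h2 := pairMass_le_trunc (ρ := ρ) (Nat.le_succ j) (le_refl (j + 1)) (t', t)
    by_cases ht : t ∈ truncBranches X Y (j + 1)
    · rw [show ((t, t') : Branch X Y × Branch X Y) = Prod.swap (t', t) from rfl,
        pairMass_swap hT hU]
      simpa only [truncBranch_of_mem ht] using h2
    · rw [pairMass_eq_zero hT fun h => ht h.1]
      exact zero_le
  have hC1 : C ≠ ⊤ := pairMass_ne_top hT h0 h1 _ _ _
  have hB1 : B ≠ ⊤ := pairMass_ne_top hT h0 h1 _ _ _
  have hA1 : A ≠ ⊤ := pairMass_ne_top hT h0 h1 _ _ _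
  -- If `A` vanishes, so does the edge mass of `ρ`, which is at most `A` by symmetry and truncation;
  -- both sides are then zero. Otherwise `A / B` can be cancelled.
  rcases eq_or_ne A 0 with hA0 | hA0
  · have hD0 : pairMass ρ (j + 1) (j + 1) (t, t') = 0 := le_antisymm (hA0 ▸ hDA) zero_le
    rw [hD0, hA0, ENNReal.zero_div, zero_mul, ENNReal.zero_div]
  · have hB0 : B ≠ 0 := fun h => hA0 (le_antisymm (h ▸ hAB) zero_le)
    have hAB0 : A / B ≠ 0 := ENNReal.div_ne_zero.2 ⟨hA0, hB1⟩
    have hAB1 : A / B ≠ ⊤ := ENNReal.div_ne_top hA1 hB0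
    rw [mul_comm C, ← mul_div_assoc, ENNReal.mul_div_mul_left _ _ hAB0 hAB1]

lemma tsum_pairMass_fst (hT : OnTrees ρ) (hU : Unimodular ρ) (h0 : meanDeg ρ ≠ 0)
    (h1 : meanDeg ρ ≠ ⊤) {i i' k : ℕ} (hi : i' ≤ i) [DecidableEq (Branch X Y)]
    (t t' : Branch X Y) :
    ∑' s, (if truncBranch i' s = t then pairMass ρ i k (s, t') else 0) =
      pairMass ρ i' k (t, t') := by
  classical
  rw [← pairMass_swap hT hU k i' (t, t'), Prod.swap, ← tsum_pairMass_snd hT h0 h1 hi]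
  refine tsum_congr fun s => ?_
  rw [← pairMass_swap hT hU k i (s, t'), Prod.swap]
  congr

lemma tsum_condMass_mul_edgeRatio (hT : OnTrees ρ) (hU : Unimodular ρ) (h0 : meanDeg ρ ≠ 0)
    (h1 : meanDeg ρ ≠ ⊤) {t u : Branch X Y} (h4 : pairMass ρ j (j + 1) (t, u) ≠ 0) :
    ∑' b, condMass (j + 1) (marginal ρ (j + 1)) t (truncBranch j u) b * edgeRatio ρ j (b, u) =
      1 := by
  classical
  have h5 : ∀ b, condMass (j + 1) (marginal ρ (j + 1)) t (truncBranch j u) b *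
      edgeRatio ρ j (b, u) = (if truncBranch j b = t then
        pairMass ρ (j + 1) (j + 1) (b, u) else 0) / pairMass ρ j (j + 1) (t, u) := by
    intro b
    rw [condMass_marginal hT]
    split_ifs with hb
    · subst hb
      rw [← newMass_mul_edgeRatio hT hU h0 h1 (p := (b, u)) h4, newMass]
    · rw [ENNReal.zero_div, zero_mul, ENNReal.zero_div]
  rw [tsum_congr h5]
  simp only [div_eq_mul_inv]
  rw [ENNReal.tsum_mul_right, tsum_pairMass_fst hT hU h0 h1 (Nat.le_succ j), ← div_eq_mul_inv,
    ENNReal.div_self h4 (pairMass_ne_top hT h0 h1 _ _ _)]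

/-- The density is a product over root edges, as is the weight of the new branches, so the total
mass factorises. Each factor is the sum of a conditional law of a far branch and equals one. -/
lemma hatLaw_univ [IsProbabilityMeasure ρ] (hT : OnTrees ρ) (hU : Unimodular ρ)
    (h0 : meanDeg ρ ≠ 0) (h1 : meanDeg ρ ≠ ⊤) : IsProbabilityMeasure (hatLaw ρ (j + 2)) := by
  classical
  constructor
  rw [← lintegral_one, hatLaw_eq hT, (atomic_extension hT).lintegral_withDensity,
    lintegral_extension hT]
  have h2 : ∑' τ, marginal ρ (j + 1) {τ} = 1 := by
    have := (atomic_marginal hT (j + 1)).lintegral 1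
    simpa using this.symm
  refine Eq.trans (tsum_congr fun τ => ?_) h2
  by_cases hτ : marginal ρ (j + 1) {τ} = 0
  · rw [hτ, zero_mul]
  have hτT := (isTree_of_marginal_ne_zero hT hτ).1
  have h3 : ∀ s : τ.rep.nbrs → Branch X Y, replaceWeight ρ j τ s *
      (((ends (j + 1) (j + 1) (replaceBranches τ s)).map (edgeRatio ρ j)).prod * 1) =
      ∏ a : τ.rep.nbrs, condMass (j + 1) (marginal ρ (j + 1)) (τ.rep.down j a) (τ.rep.up j a)
        (s a) * edgeRatio ρ j (s a, τ.rep.up (j + 1) a) := by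
    intro s
    rw [mul_one, Finset.prod_mul_distrib]
    by_cases hw : replaceWeight ρ j τ s = 0
    · rw [hw, zero_mul]
      exact (mul_eq_zero_of_left hw _).symm
    · rw [ends_replaceBranches hτT (fun a => (of_replaceWeight_ne_zero hT hw a).1)
          (fun a => (of_replaceWeight_ne_zero hT hw a).2), Multiset.map_map]
      rfl
  change marginal ρ (j + 1) {τ} * ∑' s : τ.rep.nbrs → Branch X Y, replaceWeight ρ j τ s *
    (((ends (j + 1) (j + 1) (replaceBranches τ s)).map (edgeRatio ρ j)).prod * 1) = _
  rw [tsum_congr h3, tsum_pi fun (a : τ.rep.nbrs) b => condMass (j + 1) (marginal ρ (j + 1))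
    (τ.rep.down j a) (τ.rep.up j a) b * edgeRatio ρ j (b, τ.rep.up (j + 1) a),
    Finset.prod_eq_one, mul_one]
  intro a _
  have h4 : pairMass ρ j (j + 1) (τ.rep.down j a, τ.rep.up (j + 1) a) ≠ 0 :=
    pairMass_ne_zero_of_marginal hT h0 h1 le_rfl le_rfl hτ (mem_ends_rep a)
  have h5 := tsum_condMass_mul_edgeRatio hT hU h0 h1 h4
  rwa [truncBranch_up (Nat.le_succ j)] at h5

lemma hatLaw_singleton (hT : OnTrees ρ) (hU : Unimodular ρ) (h0 : meanDeg ρ ≠ 0)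
    (h1 : meanDeg ρ ≠ ⊤) {σ : MGraph X Y} (hσ : σ ∈ truncTrees X Y (j + 2))
    (hp : ∀ p ∈ ends (j + 1) (j + 1) σ,
      pairMass ρ j (j + 1) (truncBranch j p.1, p.2) ≠ 0) :
    hatLaw ρ (j + 2) {σ} * factProd (entries (j + 1) σ) =
      marginal ρ (j + 1) {trunc (j + 1) σ} * factProd (entries j σ) *
        ((ends (j + 1) (j + 1) σ).map fun p => pairMass ρ (j + 1) (j + 1) p /
          pairMass ρ j (j + 1) (truncBranch j p.1, p.2)).prod := by
  rw [hatLaw_eq hT, (atomic_extension hT).withDensity_apply, mul_right_comm,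
    extension_singleton hT hσ, mul_assoc, ← Multiset.prod_map_mul]
  congr 2
  exact Multiset.map_congr rfl fun p h => newMass_mul_edgeRatio hT hU h0 h1 (hp p h)

end ExtensionMass

end

/-! ### From point masses to entropy balances. -/

section

variable {X : Type u} {Y : Type v} [Nonempty Y]

/-! ### Surprisals of products -/

lemma surprisal_mul {m n : ℝ≥0∞} (hm0 : m ≠ 0) (hm : m ≤ 1) (hn0 : n ≠ 0) (hn : n ≤ 1) :
    surprisal (m * n) = surprisal m + surprisal n := by
  have hm1 : m ≠ ⊤ := ne_top_of_le_ne_top ENNReal.one_ne_top hm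
  have hn1 : n ≠ ⊤ := ne_top_of_le_ne_top ENNReal.one_ne_top hn
  have hm2 : 0 ≤ -Real.log m.toReal := by rw [← toReal_surprisal hm]; exact ENNReal.toReal_nonneg
  have hn2 : 0 ≤ -Real.log n.toReal := by rw [← toReal_surprisal hn]; exact ENNReal.toReal_nonneg
  rw [surprisal, surprisal, surprisal, ← ENNReal.ofReal_add hm2 hn2, ENNReal.toReal_mul,
    Real.log_mul (ENNReal.toReal_pos hm0 hm1).ne' (ENNReal.toReal_pos hn0 hn1).ne', neg_add]

lemma surprisal_prod {α : Type*} {M : Multiset α} {f : α → ℝ≥0∞}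
    (hf : ∀ a ∈ M, f a ≠ 0 ∧ f a ≤ 1) : surprisal (M.map f).prod =
      (M.map fun a => surprisal (f a)).sum ∧ (M.map f).prod ≠ 0 ∧ (M.map f).prod ≤ 1 := by
  induction M using Multiset.induction_on with
  | empty => simp [surprisal]
  | cons a M ih =>
    obtain ⟨h1, h2, h3⟩ := ih fun b hb => hf b (Multiset.mem_cons_of_mem hb)
    obtain ⟨h4, h5⟩ := hf a (Multiset.mem_cons_self a M)
    rw [Multiset.map_cons, Multiset.prod_cons, Multiset.map_cons, Multiset.sum_cons,
      surprisal_mul h4 h5 h2 h3, h1]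
    exact ⟨rfl, mul_ne_zero h4 h2, mul_le_one' h5 h3⟩

lemma prod_div_mul_prod {α : Type*} {M : Multiset α} {f g : α → ℝ≥0∞}
    (hg : ∀ a ∈ M, g a ≠ 0 ∧ g a ≤ 1) :
    (M.map fun a => f a / g a).prod * (M.map g).prod = (M.map f).prod := by
  rw [← Multiset.prod_map_mul]
  congr 1
  exact Multiset.map_congr rfl fun a ha => ENNReal.div_mul_cancel (hg a ha).1
    (ne_top_of_le_ne_top ENNReal.one_ne_top (hg a ha).2)

/-- The logarithm of a product identity with every term on the side where it is nonnegative. In this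
form it can be integrated even if the integrals are infinite. -/
lemma surprisal_balance {q p a b : ℝ≥0∞} {m n : ℕ} (hq0 : q ≠ 0) (hq : q ≤ 1) (hp0 : p ≠ 0)
    (hp : p ≤ 1) (ha0 : a ≠ 0) (ha : a ≤ 1) (hb0 : b ≠ 0) (hb : b ≤ 1) (hm : 0 < m) (hn : 0 < n)
    (h : q * m * b = p * n * a) :
    surprisal q + ENNReal.ofReal (Real.log n) + surprisal b =
      surprisal p + ENNReal.ofReal (Real.log m) + surprisal a := by
  have pos : ∀ {x : ℝ≥0∞}, x ≠ 0 → x ≤ 1 → 0 < x.toReal := fun h h' =>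
    ENNReal.toReal_pos h (ne_top_of_le_ne_top ENNReal.one_ne_top h')
  have hm' : (0 : ℝ) < m := by exact_mod_cast hm
  have hn' : (0 : ℝ) < n := by exact_mod_cast hn
  have hl : ∀ k : ℕ, 0 ≤ Real.log k := fun k => Real.log_natCast_nonneg k
  have h1 := congrArg (fun x => Real.log x.toReal) h
  simp only [ENNReal.toReal_mul, ENNReal.toReal_natCast] at h1
  rw [Real.log_mul (mul_pos (pos hq0 hq) hm').ne' (pos hb0 hb).ne',
    Real.log_mul (pos hq0 hq).ne' hm'.ne', Real.log_mul (mul_pos (pos hp0 hp) hn').ne'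
    (pos ha0 ha).ne', Real.log_mul (pos hp0 hp).ne' hn'.ne'] at h1
  rw [← ENNReal.toReal_eq_toReal_iff' (by simp [surprisal]) (by simp [surprisal])]
  rw [ENNReal.toReal_add (by simp [surprisal]) (by simp [surprisal]),
    ENNReal.toReal_add (by simp [surprisal]) (by simp),
    ENNReal.toReal_add (by simp [surprisal]) (by simp [surprisal]),
    ENNReal.toReal_add (by simp [surprisal]) (by simp), toReal_surprisal hq,
    toReal_surprisal hp, toReal_surprisal ha, toReal_surprisal hb,
    ENNReal.toReal_ofReal (hl _), ENNReal.toReal_ofReal (hl _)]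
  linarith

lemma surprisal_balance_prod {α : Type*} {q p : ℝ≥0∞} {m n : ℕ} {M : Multiset α}
    {f g : α → ℝ≥0∞} (hq0 : q ≠ 0) (hq : q ≤ 1) (hp0 : p ≠ 0)
    (hp : p ≤ 1) (hf : ∀ a ∈ M, f a ≠ 0 ∧ f a ≤ 1) (hg : ∀ a ∈ M, g a ≠ 0 ∧ g a ≤ 1)
    (hm : 0 < m) (hn : 0 < n) (h : q * m = p * n * (M.map fun a => f a / g a).prod) :
    surprisal q + ENNReal.ofReal (Real.log n) + (M.map fun a => surprisal (g a)).sum =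
      surprisal p + ENNReal.ofReal (Real.log m) + (M.map fun a => surprisal (f a)).sum := by
  obtain ⟨hf1, hf2, hf3⟩ := surprisal_prod hf
  obtain ⟨hg1, hg2, hg3⟩ := surprisal_prod hg
  rw [← hf1, ← hg1]
  refine surprisal_balance hq0 hq hp0 hp hf2 hf3 hg2 hg3 hm hn ?_
  rw [h, mul_assoc, prod_div_mul_prod hg]

/-! ### The entropy of the numbers of equal edges -/

lemma factProd_map {α β : Type*} {f : α → β} {M : Multiset α}
    (hf : ∀ a ∈ M, ∀ b ∈ M, f a = f b → a = b) : factProd (M.map f) = factProd M := by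
  classical
  rw [factProd, factProd, Multiset.toFinset_map, Finset.prod_image fun a ha b hb h =>
    hf a (Multiset.mem_toFinset.1 ha) b (Multiset.mem_toFinset.1 hb) h]
  refine Finset.prod_congr rfl fun a ha => ?_
  rw [Multiset.count_map_eq_count f M (fun a ha b hb h => hf a ha b hb h) a
    (Multiset.mem_toFinset.1 ha)]

lemma tsum_log_factorial {α : Type*} [DecidableEq α] (M : Multiset α) :
    ∑' a, ENNReal.ofReal (Real.log ((M.count a).factorial : ℝ)) =
      ENNReal.ofReal (Real.log (factProd M)) := by
  classical
  rw [tsum_eq_sum (s := M.toFinset), ← ENNReal.ofReal_sum_of_nonneg, factProd, Nat.cast_prod,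
    Real.log_prod]
  · congr!
  · intro a _
    exact_mod_cast (Nat.factorial_pos _).ne'
  · intro a _
    exact Real.log_natCast_nonneg _
  · intro a ha
    rw [Multiset.count_eq_zero_of_notMem fun h => ha (Multiset.mem_toFinset.2 h)]
    simp

lemma factProd_le {α : Type*} (M : Multiset α) :
    factProd M ≤ M.card.factorial := by
  classical
  refine Nat.le_of_dvd (Nat.factorial_pos _) ?_
  rw [factProd, ← Multiset.toFinset_sum_count_eq M]
  convert Nat.prod_factorial_dvd_factorial_sum M.toFinset (fun a => M.count a)

/-- In a tree the root-side branch is determined by the entry that is removed, and the entry can be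
recovered from the pair. Hence pairs of branches and entries have the same multiplicities. -/
lemma MGraph.IsTree.factProd_ends {τ : MGraph X Y} (hτ : τ.IsTree) (k : ℕ) :
    factProd (ends k k τ) = factProd (entries k τ) := by
  rw [hτ.ends_eq le_rfl (Nat.le_succ k)]
  refine factProd_map fun e he e' he' h => ?_
  have h1 : truncBranch k e.1 = e.1 := truncBranch_of_mem (hτ.entries_mem he)
  have h2 : truncBranch k e'.1 = e'.1 := truncBranch_of_mem (hτ.entries_mem he')
  have h3 := congrArg Prod.fst h
  simp only [h1, h2] at h3
  exact Prod.ext h3 (congrArg (fun p : Branch X Y × Branch X Y => p.2.2) h)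

/-- The mean logarithm of the number of permutations of equal edges. -/
def countEntropy (ρ : Measure (MGraph X Y)) (k : ℕ) : ℝ≥0∞ :=
  ∫⁻ τ, ENNReal.ofReal (Real.log (factProd (entries k τ))) ∂ρ

lemma countEntropy_le (ρ : Measure (MGraph X Y)) (k : ℕ) : countEntropy ρ k ≤ degLogMoment ρ := by
  refine lintegral_mono fun τ => ENNReal.ofReal_le_ofReal ?_
  have h1 : factProd (entries k τ) ≤ deg τ ^ deg τ := by
    rw [← card_entries k τ]
    exact (factProd_le _).trans (Nat.factorial_le_pow _)
  rw [← Real.log_pow]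
  refine Real.log_le_log ?_ ?_
  · exact_mod_cast factProd_pos _
  · exact_mod_cast h1

section Step

variable [Finite X] [Finite Y] {ρ : Measure (MGraph X Y)} {j : ℕ}

lemma tsum_lintegral_log_factorial (hT : OnTrees ρ) (k : ℕ) :
    ∑' p : Branch X Y × Branch X Y, ∫⁻ τ, ENNReal.ofReal
      (Real.log ((edgeCount (k + 1) p τ).factorial : ℝ)) ∂marginal ρ (k + 1) =
      countEntropy ρ k := by
  classical
  have hA := atomic_marginal hT (k + 1)
  have h1 : ∑' p : Branch X Y × Branch X Y, ∫⁻ τ, ENNReal.ofReal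
      (Real.log ((edgeCount (k + 1) p τ).factorial : ℝ)) ∂marginal ρ (k + 1) =
      ∫⁻ τ, ∑' p : Branch X Y × Branch X Y, ENNReal.ofReal
        (Real.log ((edgeCount (k + 1) p τ).factorial : ℝ)) ∂marginal ρ (k + 1) := by
    rw [hA.lintegral]
    simp only [hA.lintegral, ← ENNReal.tsum_mul_left]
    exact ENNReal.tsum_comm
  rw [h1, lintegral_marginal hT, countEntropy]
  refine lintegral_congr_ae ?_
  filter_upwards [hT] with τ hτ
  simp only [edgeCount_eq, Nat.add_sub_cancel]
  rw [tsum_log_factorial, MGraph.IsTree.ends_trunc hτ le_rfl (Nat.le_succ k),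
    MGraph.IsTree.factProd_ends hτ]

lemma aemeasurable_log_factProd (hT : OnTrees ρ) (k : ℕ) :
    AEMeasurable (fun τ => ENNReal.ofReal (Real.log (factProd (entries k τ)))) ρ :=
  hT.aemeasurable (k + 1) fun τ hτ => by rw [hτ.entries_trunc le_rfl]

lemma marginal_trunc_ne_zero [IsProbabilityMeasure ρ] (hT : OnTrees ρ) {h k : ℕ} (hk : k ≤ h)
    {σ : MGraph X Y} (hσ : marginal ρ h {σ} ≠ 0) : marginal ρ k {trunc k σ} ≠ 0 := by
  obtain ⟨τ, h1, rfl⟩ := exists_of_marginal_ne_zero hT hσ (ae_marginal_ne_zero hT k)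
  rwa [trunc_trunc, min_eq_right hk]

lemma pairMass_trunc_ne_zero {i i' k k' : ℕ} (hi : i' ≤ i) (hk : k' ≤ k)
    {p : Branch X Y × Branch X Y} (hp : pairMass ρ i k p ≠ 0) :
    pairMass ρ i' k' (truncBranch i' p.1, truncBranch k' p.2) ≠ 0 :=
  fun h => hp (le_antisymm (h ▸ pairMass_le_trunc hi hk p) zero_le)

/-- The four masses at an edge which occur in the laws of the next generation do not vanish. -/
lemma edge_masses_ne_zero (hT : OnTrees ρ) (hU : Unimodular ρ) {p : Branch X Y × Branch X Y}
    (hp : pairMass ρ (j + 1) (j + 1) p ≠ 0) :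
    pairMass ρ j (j + 1) (truncBranch j p.2, p.1) ≠ 0 ∧
      pairMass ρ j j (truncBranch j p.2, truncBranch j p.1) ≠ 0 ∧
      pairMass ρ j (j + 1) (truncBranch j p.1, p.2) ≠ 0 := by
  have hmem : p.1 ∈ truncBranches X Y (j + 1) ∧ p.2 ∈ truncBranches X Y (j + 1) := by
    by_contra h
    exact hp (pairMass_eq_zero hT h)
  have h1 := pairMass_trunc_ne_zero (Nat.le_succ j) (le_refl (j + 1)) hp
  have h2 := pairMass_trunc_ne_zero (le_refl (j + 1)) (Nat.le_succ j) hp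
  have h3 := pairMass_trunc_ne_zero (Nat.le_succ j) (Nat.le_succ j) hp
  rw [truncBranch_of_mem hmem.1, ← pairMass_swap hT hU] at h2
  rw [truncBranch_of_mem hmem.2] at h1
  rw [← pairMass_swap hT hU] at h3
  exact ⟨h2, h3, h1⟩

/-- An atom of the left-hand law has a truncation of positive mass and only edges of positive mass,
so no factor in `extension_singleton` vanishes. -/
lemma marginal_ac_checkLaw [IsProbabilityMeasure ρ] (hT : OnTrees ρ) (hU : Unimodular ρ)
    (h0 : meanDeg ρ ≠ 0) (h1 : meanDeg ρ ≠ ⊤) :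
    marginal ρ (j + 2) ≪ extension (j + 1) (marginal ρ (j + 1)) := by
  refine (atomic_marginal hT (j + 2)).absolutelyContinuous fun σ hσ h => ?_
  by_contra hm
  have h2 := extension_singleton hT hσ
  rw [h, zero_mul] at h2
  have hf : ((factProd (entries j σ) : ℕ) : ℝ≥0∞) ≠ 0 := by exact_mod_cast (factProd_pos _).ne'
  refine mul_ne_zero (mul_ne_zero (marginal_trunc_ne_zero hT (Nat.le_succ _) hm) hf) ?_ h2.symm
  rw [Ne, Multiset.prod_eq_zero_iff]
  intro h3
  obtain ⟨p, hp, h4⟩ := Multiset.mem_map.1 h3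
  have h5 := edge_masses_ne_zero hT hU (pairMass_ne_zero_of_marginal hT h0 h1 le_rfl
    (Nat.le_succ _) hm hp)
  exact ENNReal.div_ne_zero.2 ⟨h5.1, pairMass_ne_top hT h0 h1 _ _ _⟩ h4

lemma marginal_ac_hatLaw [IsProbabilityMeasure ρ] (hT : OnTrees ρ) (hU : Unimodular ρ)
    (h0 : meanDeg ρ ≠ 0) (h1 : meanDeg ρ ≠ ⊤) : marginal ρ (j + 2) ≪ hatLaw ρ (j + 2) := by
  refine (atomic_marginal hT (j + 2)).absolutelyContinuous fun σ hσ h => ?_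
  by_contra hm
  have hne : ∀ p ∈ ends (j + 1) (j + 1) σ, pairMass ρ (j + 1) (j + 1) p ≠ 0 := fun p hp =>
    pairMass_ne_zero_of_marginal hT h0 h1 le_rfl (Nat.le_succ _) hm hp
  have h2 := hatLaw_singleton hT hU h0 h1 hσ fun p hp =>
    (edge_masses_ne_zero hT hU (hne p hp)).2.2
  rw [h, zero_mul] at h2
  have hf : ((factProd (entries j σ) : ℕ) : ℝ≥0∞) ≠ 0 := by exact_mod_cast (factProd_pos _).ne'
  refine mul_ne_zero (mul_ne_zero (marginal_trunc_ne_zero hT (Nat.le_succ _) hm) hf) ?_ h2.symm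
  rw [Ne, Multiset.prod_eq_zero_iff]
  intro h3
  obtain ⟨p, hp, h4⟩ := Multiset.mem_map.1 h3
  exact ENNReal.div_ne_zero.2 ⟨hne p hp, pairMass_ne_top hT h0 h1 _ _ _⟩ h4

lemma shannon_swap (hT : OnTrees ρ) (hU : Unimodular ρ) (i k : ℕ) :
    shannon (pairMass ρ i k) = shannon (pairMass ρ k i) := by
  rw [shannon, ← (Equiv.prodComm (Branch X Y) (Branch X Y)).tsum_eq]
  simp only [Equiv.prodComm_apply, pairMass_swap hT hU]
  rfl

/-- A law whose point masses are given by the point masses of the previous generation and by a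
product over the edges at the root. -/
lemma entropy_balance [IsProbabilityMeasure ρ] (hT : OnTrees ρ) (h0 : meanDeg ρ ≠ 0)
    (h1 : meanDeg ρ ≠ ⊤) {κ : Measure (MGraph X Y)} [IsProbabilityMeasure κ]
    (hκ : Atomic (truncTrees X Y (j + 2)) κ) (hac : marginal ρ (j + 2) ≪ κ)
    {f g : Branch X Y × Branch X Y → ℝ≥0∞}
    (hf : ∀ p, pairMass ρ (j + 1) (j + 1) p ≠ 0 → f p ≠ 0 ∧ f p ≤ 1)
    (hg : ∀ p, pairMass ρ (j + 1) (j + 1) p ≠ 0 → g p ≠ 0 ∧ g p ≤ 1)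
    (h : ∀ σ, marginal ρ (j + 2) {σ} ≠ 0 → κ {σ} * factProd (entries (j + 1) σ) =
      marginal ρ (j + 1) {trunc (j + 1) σ} * factProd (entries j σ) *
        ((ends (j + 1) (j + 1) σ).map fun p => f p / g p).prod) :
    (shannon fun σ => marginal ρ (j + 2) {σ}) + klDiv (marginal ρ (j + 2)) κ +
      countEntropy ρ j +
      ∫⁻ τ, ((ends (j + 1) (j + 1) τ).map fun p => surprisal (g p)).sum ∂ρ =
    (shannon fun σ => marginal ρ (j + 1) {σ}) + countEntropy ρ (j + 1) +
      ∫⁻ τ, ((ends (j + 1) (j + 1) τ).map fun p => surprisal (f p)).sum ∂ρ := by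
  have hsup : ∀ φ : Branch X Y × Branch X Y → ℝ≥0∞, AEMeasurable
      (fun τ => ((ends (j + 1) (j + 1) τ).map φ).sum) ρ := fun φ =>
    hT.aemeasurable_ends _ _ fun M => (M.map φ).sum
  -- Entropy plus relative entropy is the mean surprisal under `κ`. Every term is then an integral
  -- over `ρ`, and the claim reduces to the pointwise identity of `surprisal_balance_prod`.
  rw [(atomic_marginal hT (j + 2)).shannon_eq, (atomic_marginal hT (j + 2)).add_klDiv hκ hac,
    lintegral_marginal hT, shannon_marginal hT, countEntropy, countEntropy,
    ← lintegral_add_left' (measurable_comp_trunc (fun σ => surprisal (κ {σ})) _).aemeasurable,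
    ← lintegral_add_right' _ (hsup _),
    ← lintegral_add_left' (measurable_comp_trunc (fun σ => surprisal (marginal ρ (j + 1) {σ}))
      _).aemeasurable, ← lintegral_add_right' _ (hsup _)]
  refine lintegral_congr_ae ?_
  filter_upwards [hT, ae_marginal_ne_zero hT (j + 2)] with τ hτ hm
  have h2 := h _ hm
  have hp := fun p hp => pairMass_ne_zero_of_marginal hT h0 h1 (le_refl (j + 1))
    (Nat.le_succ _) hm (p := p) hp
  have hm' := marginal_trunc_ne_zero hT (Nat.le_succ (j + 1)) hm
  rw [trunc_trunc, min_eq_right (Nat.le_succ _)] at h2 hm'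
  rw [MGraph.IsTree.entries_trunc hτ le_rfl, MGraph.IsTree.entries_trunc hτ (Nat.le_succ j),
    MGraph.IsTree.ends_trunc hτ le_rfl (Nat.le_succ _)] at h2
  rw [MGraph.IsTree.ends_trunc hτ le_rfl (Nat.le_succ _)] at hp
  exact surprisal_balance_prod (fun hc => hm (hac hc)) prob_le_one hm' prob_le_one
    (fun p h => hf p (hp p h)) (fun p h => hg p (hp p h)) (factProd_pos _) (factProd_pos _) h2

lemma lintegral_surprisal_trunc (hT : OnTrees ρ) (h0 : meanDeg ρ ≠ 0) (h1 : meanDeg ρ ≠ ⊤)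
    {i i' k k' : ℕ} (hi : i' ≤ i) (hk : k' ≤ k) :
    ∫⁻ τ, ((ends i k τ).map fun p => surprisal (pairMass ρ i' k'
      (truncBranch i' p.1, truncBranch k' p.2))).sum ∂ρ =
      meanDeg ρ * shannon (pairMass ρ i' k') := by
  rw [shannon_pairMass hT h0 h1]
  refine lintegral_congr fun τ => ?_
  rw [← map_truncBranch_ends i k i' k' hi hk, Multiset.map_map]
  rfl

lemma truncBranch_ends {i i' : ℕ} {τ : MGraph X Y} (hτ : τ.IsTree) {p : Branch X Y × Branch X Y}
    (hp : p ∈ ends i i' τ) : truncBranch i p.1 = p.1 ∧ truncBranch i' p.2 = p.2 :=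
  ⟨truncBranch_of_mem (hτ.mem_of_mem_ends hp).1, truncBranch_of_mem (hτ.mem_of_mem_ends hp).2⟩

/-- The edge factors are those of `extension_singleton`; after exchanging the two sides, their mean
surprisals are the entropies of `π_{j,j+1}` and `π_{j,j}`. -/
lemma check_balance [IsProbabilityMeasure ρ] (hT : OnTrees ρ) (hU : Unimodular ρ)
    (h0 : meanDeg ρ ≠ 0) (h1 : meanDeg ρ ≠ ⊤) :
    (shannon fun σ => marginal ρ (j + 2) {σ}) + klDiv (marginal ρ (j + 2)) (checkLaw ρ (j + 2)) +
      countEntropy ρ j + meanDeg ρ * shannon (pairMass ρ j j) =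
    (shannon fun σ => marginal ρ (j + 1) {σ}) + countEntropy ρ (j + 1) +
      meanDeg ρ * shannon (pairMass ρ j (j + 1)) := by
  have := extension_univ (j := j) hT hU h0 h1
  have h := entropy_balance hT h0 h1 (atomic_extension hT) (marginal_ac_checkLaw hT hU h0 h1)
    (f := fun p => pairMass ρ j (j + 1) (truncBranch j p.2, p.1))
    (g := fun p => pairMass ρ j j (truncBranch j p.2, truncBranch j p.1))
    (fun p hp => ⟨(edge_masses_ne_zero hT hU hp).1, pairMass_le_one hT h0 h1 _ _ _⟩)
    (fun p hp => ⟨(edge_masses_ne_zero hT hU hp).2.1, pairMass_le_one hT h0 h1 _ _ _⟩)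
    (fun σ hσ => extension_singleton hT (isTree_of_marginal_ne_zero hT hσ))
  change _ + klDiv _ (extension (j + 1) (marginal ρ (j + 1))) + _ + _ = _
  convert h using 2
  · rw [← lintegral_surprisal_trunc hT h0 h1 (Nat.le_succ j) (Nat.le_succ j)]
    refine lintegral_congr fun τ => ?_
    congr 1
    refine Multiset.map_congr rfl fun p _ => ?_
    rw [← pairMass_swap hT hU]
    rfl
  · rw [shannon_swap hT hU, ← lintegral_surprisal_trunc hT h0 h1 (le_refl (j + 1)) (Nat.le_succ j)]
    refine lintegral_congr_ae ?_
    filter_upwards [hT] with τ hτ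
    congr 1
    refine Multiset.map_congr rfl fun p hp => ?_
    rw [← pairMass_swap hT hU, (truncBranch_ends hτ hp).1]
    rfl

/-- Here the denominators are the numerators of the first balance up to symmetry. The entropy of
`π_{j,j+1}` therefore stands on the left here and on the right in `check_balance`. -/
lemma hat_balance [IsProbabilityMeasure ρ] (hT : OnTrees ρ) (hU : Unimodular ρ)
    (h0 : meanDeg ρ ≠ 0) (h1 : meanDeg ρ ≠ ⊤) :
    (shannon fun σ => marginal ρ (j + 2) {σ}) + klDiv (marginal ρ (j + 2)) (hatLaw ρ (j + 2)) +
      countEntropy ρ j + meanDeg ρ * shannon (pairMass ρ j (j + 1)) =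
    (shannon fun σ => marginal ρ (j + 1) {σ}) + countEntropy ρ (j + 1) +
      meanDeg ρ * shannon (pairMass ρ (j + 1) (j + 1)) := by
  have := hatLaw_univ (j := j) hT hU h0 h1
  have h := entropy_balance hT h0 h1 (atomic_hatLaw hT) (marginal_ac_hatLaw hT hU h0 h1)
    (f := fun p => pairMass ρ (j + 1) (j + 1) p)
    (g := fun p => pairMass ρ j (j + 1) (truncBranch j p.1, p.2))
    (fun p hp => ⟨hp, pairMass_le_one hT h0 h1 _ _ _⟩)
    (fun p hp => ⟨(edge_masses_ne_zero hT hU hp).2.2, pairMass_le_one hT h0 h1 _ _ _⟩)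
    (fun σ hσ => hatLaw_singleton hT hU h0 h1 (isTree_of_marginal_ne_zero hT hσ) fun p hp =>
      (edge_masses_ne_zero hT hU (pairMass_ne_zero_of_marginal hT h0 h1 le_rfl
        (Nat.le_succ _) hσ hp)).2.2)
  convert h using 2
  · rw [← lintegral_surprisal_trunc hT h0 h1 (Nat.le_succ j) (le_refl (j + 1))]
    refine lintegral_congr_ae ?_
    filter_upwards [hT] with τ hτ
    congr 1
    refine Multiset.map_congr rfl fun p hp => ?_
    rw [(truncBranch_ends hτ hp).2]
  · rw [shannon_pairMass hT h0 h1]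

/-- A finer edge type has smaller mass, hence larger surprisal. -/
lemma shannon_pairMass_mono (hT : OnTrees ρ) (h0 : meanDeg ρ ≠ 0) (h1 : meanDeg ρ ≠ ⊤)
    {i i' k k' : ℕ} (hi : i' ≤ i) (hk : k' ≤ k) :
    meanDeg ρ * shannon (pairMass ρ i' k') ≤ meanDeg ρ * shannon (pairMass ρ i k) := by
  rw [← lintegral_surprisal_trunc hT h0 h1 hi hk, shannon_pairMass hT h0 h1]
  refine lintegral_mono_ae ?_
  filter_upwards [ae_pairMass_ne_zero hT h0 h1 i k] with τ hτ
  exact Multiset.sum_map_le_sum_map _ _ fun p hp => surprisal_anti (hτ p hp)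
    (pairMass_le_trunc hi hk p) (pairMass_ne_top hT h0 h1 _ _ _)

end Step

end

/-! ### Stars and the Poisson reference law. -/

section

variable {X : Type u} {Y : Type v} [Nonempty Y]

/-! ### Stars -/

/-- A single vertex together with an edge mark. -/
def leaf (x : X) (y : Y) : Branch X Y := (MGraph.mk (RawGraph.point x), y)

/-- The entry of a child of the root in a star. -/
def starEntry (e : X × Y × Y) : Branch X Y × Y := (leaf e.1 e.2.1, e.2.2)

/-- The marks of an entry. -/
def entryMarks (e : Branch X Y × Y) : X × Y × Y := (rootMark e.1.1, e.1.2, e.2)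

@[simp] lemma rootMark_leaf (x : X) (y : Y) : rootMark (leaf x y).1 = x := by
  rw [leaf, rootMark_mk]
  rfl

@[simp] lemma entryMarks_starEntry (e : X × Y × Y) : entryMarks (starEntry e) = e := by
  rw [entryMarks, starEntry, rootMark_leaf]
  rfl

lemma starEntry_injective : Function.Injective (starEntry : X × Y × Y → Branch X Y × Y) :=
  Function.LeftInverse.injective entryMarks_starEntry

lemma leaf_mem (x : X) (y : Y) : leaf x y ∈ truncBranches X Y 0 := by
  have h : (graft x (0 : Multiset (Branch X Y × Y))).IsTree := isTree_graft (by simp)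
  have h1 := h.trunc_mem 0
  rw [trunc_zero, rootMark_graft] at h1
  exact h1

lemma eq_leaf_of_mem {t : Branch X Y} (ht : t ∈ truncBranches X Y 0) :
    leaf (rootMark t.1) t.2 = t := by
  refine Prod.ext ?_ rfl
  rw [leaf, ← trunc_zero]
  exact ht.2

lemma starEntry_entryMarks {e : Branch X Y × Y} (he : e.1 ∈ truncBranches X Y 0) :
    starEntry (entryMarks e) = e := Prod.ext (eq_leaf_of_mem he) rfl

lemma star_eq_graft (x : X) (n : ℕ) (m : Fin n → X × Y × Y) :
    star x n m = graft x (Finset.univ.val.map fun i => starEntry (m i)) := star_eq x n m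

lemma star_mem (x : X) (n : ℕ) (m : Fin n → X × Y × Y) : star x n m ∈ truncTrees X Y 1 := by
  rw [star_eq_graft]
  refine graft_mem_truncTrees fun e he => ?_
  obtain ⟨i, -, rfl⟩ := Multiset.mem_map.1 he
  exact leaf_mem _ _

@[simp] lemma rootMark_star (x : X) (n : ℕ) (m : Fin n → X × Y × Y) :
    rootMark (star x n m) = x := by rw [star_eq_graft, rootMark_graft]

lemma entries_star (x : X) (n : ℕ) (m : Fin n → X × Y × Y) :
    entries 0 (star x n m) = Finset.univ.val.map fun i => starEntry (m i) := by
  rw [star_eq_graft, entries_graft, Multiset.map_map]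
  refine Multiset.map_congr rfl fun i _ => ?_
  rw [Function.comp, truncEntry, starEntry, truncBranch_of_mem (leaf_mem _ _)]

@[simp] lemma deg_star (x : X) (n : ℕ) (m : Fin n → X × Y × Y) : deg (star x n m) = n := by
  rw [← card_entries 0, entries_star]
  simp

lemma MGraph.IsTree.ends_zero {τ : MGraph X Y} (hτ : τ.IsTree) :
    ends 0 0 τ = (entries 0 τ).map fun e => (e.1, leaf (rootMark τ) e.2) := by
  rw [hτ.ends_eq le_rfl (Nat.zero_le 1)]
  refine Multiset.map_congr rfl fun e he => ?_
  rw [truncBranch_of_mem (hτ.entries_mem he), upBranch_zero]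
  rfl

lemma ends_star (x : X) (n : ℕ) (m : Fin n → X × Y × Y) : ends 0 0 (star x n m) =
    Finset.univ.val.map fun i => (leaf (m i).1 (m i).2.1, leaf x (m i).2.2) := by
  rw [(star_mem x n m).1.ends_zero, entries_star, Multiset.map_map, rootMark_star]
  rfl

lemma star_eq_iff {σ : MGraph X Y} (hσ : σ ∈ truncTrees X Y 1) {x : X} {n : ℕ}
    {m : Fin n → X × Y × Y} : star x n m = σ ↔
      x = rootMark σ ∧ Finset.univ.val.map (fun i => starEntry (m i)) = entries 0 σ := by
  constructor
  · rintro rfl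
    rw [rootMark_star, entries_star]
    exact ⟨rfl, rfl⟩
  · rintro ⟨rfl, h⟩
    rw [star_eq_graft, h, ← eq_graft_of_mem hσ]

lemma exists_star {σ : MGraph X Y} (hσ : σ ∈ truncTrees X Y 1) :
    ∃ m : Fin (deg σ) → X × Y × Y, star (rootMark σ) (deg σ) m = σ := by
  have hc : (entries 0 σ).toList.length = deg σ := by
    rw [Multiset.length_toList, card_entries]
  refine ⟨fun i => entryMarks ((entries 0 σ).toList.get (i.cast hc.symm)), ?_⟩
  rw [star_eq_iff hσ]
  refine ⟨rfl, ?_⟩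
  conv_rhs => rw [← (entries 0 σ).coe_toList, ← List.ofFn_get (entries 0 σ).toList]
  rw [List.ofFn_eq_map]
  have h1 : ∀ i : Fin (deg σ),
      starEntry (entryMarks ((entries 0 σ).toList.get (i.cast hc.symm))) =
      (entries 0 σ).toList.get (i.cast hc.symm) := fun i =>
    starEntry_entryMarks (hσ.1.entries_mem (Multiset.mem_toList.1 (List.get_mem _ _)))
  simp only [h1]
  rw [← Multiset.map_coe]
  change _ = Multiset.map (entries 0 σ).toList.get
    (Finset.univ : Finset (Fin (entries 0 σ).toList.length)).val
  rw [← Multiset.map_univ_val_equiv (finCongr hc.symm), Multiset.map_map]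
  rfl

lemma factProd_replicate {α : Type*} (n : ℕ) (a : α) :
    factProd (Multiset.replicate n a) = n.factorial := by
  classical
  rcases Nat.eq_zero_or_pos n with rfl | hn
  · simp [factProd]
  · rw [factProd, Multiset.toFinset_replicate, if_neg hn.ne', Finset.prod_singleton,
      Multiset.count_replicate_self]

/-- The multinomial coefficient: `ncard_families` with the constant map, for which all permutations
of the children are allowed. -/
lemma ncard_labellings {σ : MGraph X Y} (hσ : σ ∈ truncTrees X Y 1) :
    {m : Fin (deg σ) → X × Y × Y | star (rootMark σ) (deg σ) m = σ}.ncard *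
      factProd (entries 0 σ) = (deg σ).factorial ∧
    {m : Fin (deg σ) → X × Y × Y | star (rootMark σ) (deg σ) m = σ}.Finite := by
  have h1 : (entries 0 σ).map (fun _ => ()) =
      (Finset.univ : Finset (Fin (deg σ))).val.map fun _ => () := by
    rw [Multiset.map_const', Multiset.map_const', card_entries]
    simp
  have h2 := ncard_families h1
  rw [Multiset.map_const', card_entries, factProd_replicate] at h2
  have hinj : Function.Injective fun (m : Fin (deg σ) → X × Y × Y) (i : Fin (deg σ)) =>
      starEntry (m i) := fun m m' h => funext fun i => starEntry_injective (congrFun h i)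
  have himg : (fun (m : Fin (deg σ) → X × Y × Y) (i : Fin (deg σ)) => starEntry (m i)) ''
      {m | star (rootMark σ) (deg σ) m = σ} = {g | Finset.univ.val.map g = entries 0 σ ∧
        (fun _ => ()) ∘ g = fun _ : Fin (deg σ) => ()} := by
    ext g
    constructor
    · rintro ⟨m, h3, rfl⟩
      exact ⟨((star_eq_iff hσ).1 h3).2, rfl⟩
    · rintro ⟨h3, -⟩
      have h5 : (fun i => starEntry (entryMarks (g i))) = g := funext fun i =>
        starEntry_entryMarks (hσ.1.entries_mem (by
          rw [← h3]
          exact Multiset.mem_map_of_mem g (Finset.mem_univ_val i)))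
      exact ⟨fun i => entryMarks (g i), (star_eq_iff hσ).2 ⟨rfl, by rw [h5, h3]⟩, h5⟩
  rw [← himg, Set.ncard_image_of_injective _ hinj] at h2
  exact ⟨h2.1, Set.Finite.of_finite_image h2.2 hinj.injOn⟩

open Classical in
lemma tsum_labellings {σ : MGraph X Y} (hσ : σ ∈ truncTrees X Y 1) (w : X × Y × Y → ℝ≥0∞) :
    (∑' m : Fin (deg σ) → X × Y × Y, if star (rootMark σ) (deg σ) m = σ then ∏ i, w (m i) else 0) *
      factProd (entries 0 σ) =
      (deg σ).factorial * ((entries 0 σ).map fun e => w (entryMarks e)).prod := by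
  obtain ⟨h1, h2⟩ := ncard_labellings hσ
  have h3 : ∀ m : Fin (deg σ) → X × Y × Y,
      (if star (rootMark σ) (deg σ) m = σ then ∏ i, w (m i) else 0) =
      if m ∈ {m : Fin (deg σ) → X × Y × Y | star (rootMark σ) (deg σ) m = σ} then
        ((entries 0 σ).map fun e => w (entryMarks e)).prod else 0 := by
    intro m
    by_cases h : star (rootMark σ) (deg σ) m = σ
    · have h' : m ∈ {m : Fin (deg σ) → X × Y × Y | star (rootMark σ) (deg σ) m = σ} := h
      rw [if_pos h, if_pos h', ← ((star_eq_iff hσ).1 h).2, Multiset.map_map]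
      simp only [Function.comp_def, entryMarks_starEntry]
      rfl
    · have h' : m ∉ {m : Fin (deg σ) → X × Y × Y | star (rootMark σ) (deg σ) m = σ} := h
      rw [if_neg h, if_neg h']
  rw [tsum_congr h3, tsum_ite_mem_const h2, ← h1]
  push_cast
  ring

/-! ### The law of the first neighbourhood in the Poisson tree -/

section PoissonStar

variable [Fintype X] [Fintype Y] [MeasurableSpace X] [MeasurableSpace Y]
  {ν : Measure X} {ξ : Measure (Y × Y)} {β : ℝ≥0}

open Classical in
lemma poissonStar_mass_eq_zero {σ : MGraph X Y} (hσ : σ ∉ truncTrees X Y 1) :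
    (∑' n : ℕ, ProbabilityTheory.poissonMeasure β {n} *
    ∑' x : X, ν {x} * ∑' m : Fin n → X × Y × Y,
      (if star x n m = σ then ∏ i, ν {(m i).1} * symmLaw ξ {(m i).2} else 0)) = 0 := by
  have h : ∀ (n : ℕ) (x : X) (m : Fin n → X × Y × Y), star x n m ≠ σ := fun n x m h =>
    hσ (h ▸ star_mem x n m)
  simp [h]

lemma atomic_poissonStar : Atomic (truncTrees X Y 1) (poissonStar ν ξ β) :=
  atomic_ofMass (countable_truncTrees _) (fun _ h => measurableSet_singleton_of_mem h)
    fun _ h => poissonStar_mass_eq_zero h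

lemma lintegral_poissonStar (f : MGraph X Y → ℝ≥0∞) : ∫⁻ σ, f σ ∂poissonStar ν ξ β =
    ∑' n : ℕ, ProbabilityTheory.poissonMeasure β {n} * ∑' x : X, ν {x} *
      ∑' m : Fin n → X × Y × Y, (∏ i, ν {(m i).1} * symmLaw ξ {(m i).2}) * f (star x n m) := by
  classical
  rw [poissonStar, lintegral_ofMass (countable_truncTrees 1)
    (fun _ h => measurableSet_singleton_of_mem h) fun _ h => poissonStar_mass_eq_zero h]
  simp only [← ENNReal.tsum_mul_right]
  rw [ENNReal.tsum_comm]
  refine tsum_congr fun n => ?_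
  simp only [mul_assoc]
  rw [ENNReal.tsum_mul_left]
  congr 1
  simp only [← ENNReal.tsum_mul_right]
  rw [ENNReal.tsum_comm]
  refine tsum_congr fun x => ?_
  simp only [mul_assoc]
  rw [ENNReal.tsum_mul_left]
  congr 1
  simp only [← ENNReal.tsum_mul_right]
  rw [ENNReal.tsum_comm]
  refine tsum_congr fun m => ?_
  rw [tsum_eq_single (star x n m)]
  · rw [if_pos rfl]
  · intro σ hσ
    rw [if_neg hσ.symm, zero_mul]

/-- The factorial of the degree in the Poisson weight cancels against the number of orderings of the
children, leaving only `factProd`. -/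
lemma poissonStar_singleton {σ : MGraph X Y} (hσ : σ ∈ truncTrees X Y 1) :
    poissonStar ν ξ β {σ} * factProd (entries 0 σ) =
      ENNReal.ofReal (Real.exp (-β)) * (β : ℝ≥0∞) ^ deg σ * ν {rootMark σ} *
        ((entries 0 σ).map fun e =>
          ν {(entryMarks e).1} * symmLaw ξ {(entryMarks e).2}).prod := by
  classical
  rw [poissonStar, ofMass_singleton _ (measurableSet_singleton_of_mem hσ),
    tsum_eq_single (deg σ), tsum_eq_single (rootMark σ)]
  · have h1 := tsum_labellings hσ fun e => ν {e.1} * symmLaw ξ {e.2}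
    have h2 : ProbabilityTheory.poissonMeasure β {deg σ} * (deg σ).factorial =
        ENNReal.ofReal (Real.exp (-β)) * (β : ℝ≥0∞) ^ deg σ := by
      rw [ProbabilityTheory.poissonMeasure_singleton, ← ENNReal.ofReal_natCast,
        ← ENNReal.ofReal_mul (by positivity), div_mul_cancel₀ _ (by positivity),
        ENNReal.ofReal_mul (Real.exp_pos _).le, ENNReal.ofReal_pow β.coe_nonneg]
      simp
    rw [← h2, mul_assoc, mul_assoc (ν {rootMark σ}), h1]
    ring
  · intro x hx
    have h : ∀ m : Fin (deg σ) → X × Y × Y, star x (deg σ) m ≠ σ := fun m h =>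
      hx ((star_eq_iff hσ).1 h).1
    simp [h]
  · intro n hn
    have h : ∀ (x : X) (m : Fin n → X × Y × Y), star x n m ≠ σ := fun x m h =>
      hn (by rw [← h, deg_star])
    simp [h]

end PoissonStar

end

/-! ### Edge statistics of the Poisson star. -/

section

variable {X : Type u} {Y : Type v} [Nonempty Y]

/-! ### Edge marginals of the Poisson star -/

lemma leaf_injective : Function.Injective fun p : X × Y => leaf p.1 p.2 := fun p q h => by
  have h1 := congrArg (fun t : Branch X Y => rootMark t.1) h
  simp only [rootMark_leaf] at h1
  exact Prod.ext h1 (congrArg (fun t : Branch X Y => t.2) h)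

lemma leaf_inj {x x' : X} {y y' : Y} : leaf x y = leaf x' y' ↔ x = x' ∧ y = y' := by
  refine ⟨fun h => ?_, fun h => by rw [h.1, h.2]⟩
  exact Prod.mk.inj (leaf_injective (a₁ := (x, y)) (a₂ := (x', y')) h)

lemma tsum_branch {f : Branch X Y → ℝ≥0∞} (hf : ∀ t ∉ truncBranches X Y 0, f t = 0) :
    ∑' t, f t = ∑' p : X × Y, f (leaf p.1 p.2) := by
  refine (leaf_injective.tsum_eq fun t ht => ?_).symm
  by_contra hc
  refine ht (hf t fun h => hc ⟨(rootMark t.1, t.2), eq_leaf_of_mem h⟩)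

section SymmLaw

variable [MeasurableSpace Y] {ξ : Measure (Y × Y)}

instance [IsProbabilityMeasure ξ] : IsProbabilityMeasure (symmLaw ξ) := by
  have : IsProbabilityMeasure (ξ.map Prod.swap) :=
    Measure.isProbabilityMeasure_map measurable_swap.aemeasurable
  constructor
  rw [symmLaw, Measure.smul_apply, Measure.add_apply, measure_univ, measure_univ, smul_eq_mul,
    one_add_one_eq_two, ENNReal.inv_mul_cancel two_ne_zero ENNReal.ofNat_ne_top]

lemma symmLaw_swap [MeasurableSingletonClass Y] (ξ : Measure (Y × Y)) (y y' : Y) :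
    symmLaw ξ {(y', y)} = symmLaw ξ {(y, y')} := by
  have h : ∀ y y' : Y, (ξ.map Prod.swap) {(y', y)} = ξ {(y, y')} := fun y y' => by
    rw [Measure.map_apply measurable_swap (measurableSet_singleton _)]
    congr 1
    ext ⟨a, b⟩
    simp [Prod.ext_iff, and_comm]
  simp only [symmLaw, Measure.smul_apply, Measure.add_apply, h, add_comm]

end SymmLaw

lemma tsum_measure_singleton {α : Type*} [Fintype α] [MeasurableSpace α]
    [MeasurableSingletonClass α] (μ : Measure α) [IsProbabilityMeasure μ] :
    ∑' a, μ {a} = 1 := by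
  rw [tsum_fintype, sum_measure_singleton, Finset.coe_univ, measure_univ]

lemma tsum_nat_mul_poisson (β : ℝ≥0) :
    ∑' n : ℕ, ProbabilityTheory.poissonMeasure β {n} * n = β := by
  rw [tsum_eq_zero_add' ENNReal.summable]
  have h : ∀ n : ℕ, ProbabilityTheory.poissonMeasure β {n + 1} * ((n + 1 : ℕ) : ℝ≥0∞) =
      β * ProbabilityTheory.poissonMeasure β {n} := by
    intro n
    rw [ProbabilityTheory.poissonMeasure_singleton, ProbabilityTheory.poissonMeasure_singleton,
      ← ENNReal.ofReal_natCast, ← ENNReal.ofReal_mul (by positivity),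
      ← ENNReal.ofReal_coe_nnreal, ← ENNReal.ofReal_mul β.coe_nonneg]
    congr 1
    rw [Nat.factorial_succ]
    push_cast
    field_simp
    rw [pow_succ]
    ring
  rw [tsum_congr h, ENNReal.tsum_mul_left]
  have h1 : ∑' n : ℕ, ProbabilityTheory.poissonMeasure β {n} = 1 := by
    have := (lintegral_countable' (μ := ProbabilityTheory.poissonMeasure β) 1).symm
    simpa using this
  rw [h1]
  simp

lemma tsum_poisson (β : ℝ≥0) : ∑' n : ℕ, ProbabilityTheory.poissonMeasure β {n} = 1 := by
  have := (lintegral_countable' (μ := ProbabilityTheory.poissonMeasure β) 1).symm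
  simpa using this

section PoissonStar

variable [Fintype X] [Fintype Y] [MeasurableSpace X] [MeasurableSpace Y]
  [MeasurableSingletonClass X] [MeasurableSingletonClass Y]
  {ν : Measure X} {ξ : Measure (Y × Y)} [IsProbabilityMeasure ν] [IsProbabilityMeasure ξ]
  {β : ℝ≥0}

lemma tsum_marks : ∑' e : X × Y × Y, ν {e.1} * symmLaw ξ {e.2} = 1 := by
  rw [ENNReal.tsum_prod']
  simp only [ENNReal.tsum_mul_left, tsum_measure_singleton, mul_one]

/-- Given the degree and the root mark, the children are independent with the same law, so a sum
over edges averages to the mean degree times the mean over one edge. -/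
lemma lintegral_ends_poissonStar (f : Branch X Y × Branch X Y → ℝ≥0∞) :
    ∫⁻ σ, ((ends 0 0 σ).map f).sum ∂poissonStar ν ξ β = β * ∑' x : X, ν {x} *
      ∑' e : X × Y × Y, ν {e.1} * symmLaw ξ {e.2} * f (leaf e.1 e.2.1, leaf x e.2.2) := by
  rw [lintegral_poissonStar, ← tsum_nat_mul_poisson, ← ENNReal.tsum_mul_right]
  refine tsum_congr fun n => ?_
  rw [mul_assoc]
  congr 1
  rw [← ENNReal.tsum_mul_left]
  refine tsum_congr fun x => ?_
  rw [mul_left_comm]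
  congr 1
  simp only [ends_star, Multiset.map_map]
  change ∑' m : Fin n → X × Y × Y, (∏ i, ν {(m i).1} * symmLaw ξ {(m i).2}) *
    ∑ i, f (leaf (m i).1 (m i).2.1, leaf x (m i).2.2) = _
  simp only [Finset.mul_sum]
  rw [Summable.tsum_finsetSum fun _ _ => ENNReal.summable]
  rw [Finset.sum_congr rfl fun i _ => tsum_pi_mul
    (fun (_ : Fin n) (e : X × Y × Y) => ν {e.1} * symmLaw ξ {e.2}) (fun _ => tsum_marks) i
    fun e => f (leaf e.1 e.2.1, leaf x e.2.2)]
  simp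

/-- For a given degree and root mark the mean of the product is a power of the mean over one child.
This is the normalisation of both reference laws at depth one. -/
lemma lintegral_prod_poissonStar (f : Branch X Y × Branch X Y → ℝ≥0∞)
    (hf : ∀ x, ν {x} ≠ 0 → ∑' e : X × Y × Y, ν {e.1} * symmLaw ξ {e.2} *
      f (leaf e.1 e.2.1, leaf x e.2.2) = 1) :
    ∫⁻ σ, ((ends 0 0 σ).map f).prod ∂poissonStar ν ξ β = 1 := by
  rw [lintegral_poissonStar, ← tsum_poisson β]
  refine tsum_congr fun n => ?_
  conv_rhs => rw [← mul_one (ProbabilityTheory.poissonMeasure β {n})]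
  congr 1
  rw [← tsum_measure_singleton ν]
  refine tsum_congr fun x => ?_
  by_cases hx : ν {x} = 0
  · rw [hx, zero_mul]
  conv_rhs => rw [← mul_one (ν {x})]
  congr 1
  simp only [ends_star, Multiset.map_map]
  change ∑' m : Fin n → X × Y × Y, (∏ i, ν {(m i).1} * symmLaw ξ {(m i).2}) *
    ∏ i, f (leaf (m i).1 (m i).2.1, leaf x (m i).2.2) = 1
  simp only [← Finset.prod_mul_distrib]
  rw [tsum_pi fun (_ : Fin n) (e : X × Y × Y) => ν {e.1} * symmLaw ξ {e.2} *
    f (leaf e.1 e.2.1, leaf x e.2.2)]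
  rw [hf x hx, Finset.prod_const_one]

lemma meanDeg_poissonStar : meanDeg (poissonStar ν ξ β) = β := by
  have h := lintegral_ends_poissonStar (ν := ν) (ξ := ξ) (β := β) fun _ => 1
  simp only [mul_one, tsum_marks, tsum_measure_singleton, Multiset.map_const',
    Multiset.sum_replicate, card_ends, nsmul_eq_mul] at h
  exact h

lemma pairMass_poissonStar (hβ : β ≠ 0) (x x' : X) (y y' : Y) :
    pairMass (poissonStar ν ξ β) 0 0 (leaf x y, leaf x' y') =
      ν {x} * ν {x'} * symmLaw ξ {(y, y')} := by
  classical
  have h := lintegral_ends_poissonStar (ν := ν) (ξ := ξ) (β := β) fun q =>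
    if q = (leaf x y, leaf x' y') then 1 else 0
  simp only [sum_map_ite_eq] at h
  rw [pairMass, meanDeg_poissonStar, h, mul_comm (β : ℝ≥0∞), ENNReal.mul_div_cancel_right
    (by exact_mod_cast hβ) ENNReal.coe_ne_top, tsum_eq_single x', tsum_eq_single (x, y, y')]
  · simp
    ring
  · rintro ⟨a, b, b'⟩ hne
    rw [if_neg, mul_zero]
    intro hc
    have h1 := leaf_inj.1 (Prod.mk.inj hc).1
    have h2 := leaf_inj.1 (Prod.mk.inj hc).2
    exact hne (Prod.ext h1.1 (Prod.ext h1.2 h2.2))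
  · intro a ha
    refine mul_eq_zero_of_right _ (ENNReal.tsum_eq_zero.2 fun e => ?_)
    rw [if_neg, mul_zero]
    intro hc
    exact ha (leaf_inj.1 (Prod.mk.inj hc).2).1

lemma pairMass_poissonStar_eq_zero {p : Branch X Y × Branch X Y}
    (hp : ¬ (p.1 ∈ truncBranches X Y 0 ∧ p.2 ∈ truncBranches X Y 0)) :
    pairMass (poissonStar ν ξ β) 0 0 p = 0 :=
  pairMass_eq_zero (onTrees_of_atomic atomic_poissonStar) hp

lemma edgeMass_poissonStar (hβ : β ≠ 0) (x x' : X) (y y' : Y) :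
    edgeMass 1 (poissonStar ν ξ β) (leaf x y, leaf x' y') =
      ν {x} * ν {x'} * symmLaw ξ {(y, y')} := by
  rw [edgeMass_eq atomic_poissonStar]
  exact pairMass_poissonStar hβ x x' y y'

/-- The first marginal of the symmetrized law of the edge marks. -/
def markLaw (ξ : Measure (Y × Y)) (y : Y) : ℝ≥0∞ := ∑' y', symmLaw ξ {(y, y')}

lemma edgeMassFst_poissonStar (hβ : β ≠ 0) (x : X) (y : Y) :
    edgeMassFst 1 (poissonStar ν ξ β) (leaf x y) = ν {x} * markLaw ξ y := by
  rw [edgeMassFst, tsum_branch, ENNReal.tsum_prod']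
  · simp only [edgeMass_poissonStar hβ, ENNReal.tsum_mul_left]
    simp only [mul_assoc, ENNReal.tsum_mul_left]
    rw [ENNReal.tsum_mul_right, tsum_measure_singleton, one_mul]
    rfl
  · intro t ht
    rw [edgeMass_eq atomic_poissonStar]
    exact pairMass_poissonStar_eq_zero fun h => ht h.2

lemma edgeMassSnd_poissonStar (hβ : β ≠ 0) (x : X) (y : Y) :
    edgeMassSnd 1 (poissonStar ν ξ β) (leaf x y) = ν {x} * markLaw ξ y := by
  rw [edgeMassSnd, tsum_branch, ENNReal.tsum_prod']
  · simp only [edgeMass_poissonStar hβ, ENNReal.tsum_mul_left]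
    simp only [mul_assoc]
    rw [ENNReal.tsum_mul_right, tsum_measure_singleton, one_mul]
    congr 1
    exact tsum_congr fun y' => symmLaw_swap ξ y y'
  · intro t ht
    rw [edgeMass_eq atomic_poissonStar]
    exact pairMass_poissonStar_eq_zero fun h => ht h.1

lemma tsum_markLaw : ∑' y, markLaw ξ y = 1 := by
  have h := tsum_measure_singleton (symmLaw ξ)
  rwa [ENNReal.tsum_prod'] at h

lemma markLaw_le_one (y : Y) : markLaw ξ y ≤ 1 := by
  rw [← tsum_markLaw (ξ := ξ)]
  exact ENNReal.le_tsum y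

lemma symmLaw_le_markLaw (y y' : Y) : symmLaw ξ {(y, y')} ≤ markLaw ξ y :=
  ENNReal.le_tsum (f := fun y' => symmLaw ξ {(y, y')}) y'

end PoissonStar

end

/-! ### The reference laws at depth one are probabilities. -/

section

variable {X : Type u} {Y : Type v} [Nonempty Y]

/-! ### The reference laws of the first neighbourhood -/

/-- The law of the mark at the far end of an edge under the size-biased marginal. -/
def leafMass (ρ : Measure (MGraph X Y)) (t : Branch X Y) : ℝ≥0∞ :=
  ∑' t', pairMass ρ 0 0 (t, t')

/-- The mean of a sum over the edges at the root that depends only on the marks at the edge. -/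
def edgeMean (ρ : Measure (MGraph X Y)) (f : Branch X Y × Branch X Y → ℝ≥0∞) : ℝ≥0∞ :=
  ∫⁻ τ, ((ends 0 0 τ).map f).sum ∂ρ

/-- The marks which occur under `ρ` have positive probability under the reference laws. -/
structure Compatible [MeasurableSpace X] [MeasurableSpace Y] (ν : Measure X) (ξ : Measure (Y × Y))
    (ρ : Measure (MGraph X Y)) : Prop where
  root : ∀ᵐ τ ∂ρ, ν {rootMark τ} ≠ 0
  edge : ∀ p, pairMass ρ 0 0 p ≠ 0 → ν {rootMark p.1.1} ≠ 0 ∧ ν {rootMark p.2.1} ≠ 0 ∧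
    symmLaw ξ {(p.1.2, p.2.2)} ≠ 0

section

variable [Finite X] [Finite Y] {ρ : Measure (MGraph X Y)}

lemma edgeMass_marginal (hT : OnTrees ρ) (p : Branch X Y × Branch X Y) :
    edgeMass 1 (marginal ρ 1) p = pairMass ρ 0 0 p := by
  rw [edgeMass_eq (atomic_marginal hT _)]
  exact pairMass_marginal hT le_rfl (Nat.zero_le 1) p

lemma edgeMassFst_marginal (hT : OnTrees ρ) (t : Branch X Y) :
    edgeMassFst 1 (marginal ρ 1) t = leafMass ρ t := by
  simp only [edgeMassFst, edgeMass_marginal hT, leafMass]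

lemma edgeMassSnd_marginal (hT : OnTrees ρ) (hU : Unimodular ρ) (t : Branch X Y) :
    edgeMassSnd 1 (marginal ρ 1) t = leafMass ρ t := by
  simp only [edgeMassSnd, edgeMass_marginal hT, leafMass]
  exact tsum_congr fun t' => pairMass_swap hT hU 0 0 (t, t')

lemma pairMass_le_leafMass (t t' : Branch X Y) : pairMass ρ 0 0 (t, t') ≤ leafMass ρ t :=
  ENNReal.le_tsum (f := fun t' => pairMass ρ 0 0 (t, t')) t'

lemma tsum_leafMass (hT : OnTrees ρ) (h0 : meanDeg ρ ≠ 0) (h1 : meanDeg ρ ≠ ⊤) :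
    ∑' t, leafMass ρ t = 1 := by
  rw [← tsum_pairMass hT h0 h1 0 0, ENNReal.tsum_prod' (f := pairMass ρ 0 0)]
  rfl

lemma leafMass_le_one (hT : OnTrees ρ) (h0 : meanDeg ρ ≠ 0) (h1 : meanDeg ρ ≠ ⊤)
    (t : Branch X Y) : leafMass ρ t ≤ 1 := by
  rw [← tsum_leafMass hT h0 h1]
  exact ENNReal.le_tsum t

lemma leafMass_eq_zero (hT : OnTrees ρ) {t : Branch X Y} (ht : t ∉ truncBranches X Y 0) :
    leafMass ρ t = 0 :=
  ENNReal.tsum_eq_zero.2 fun _ => pairMass_eq_zero hT fun h => ht h.1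

lemma exists_of_leafMass_ne_zero {t : Branch X Y} (ht : leafMass ρ t ≠ 0) :
    ∃ t', pairMass ρ 0 0 (t, t') ≠ 0 := by
  by_contra hc
  push Not at hc
  exact ht (ENNReal.tsum_eq_zero.2 hc)

lemma edgeMean_swap (hT : OnTrees ρ) (hU : Unimodular ρ) (f : Branch X Y × Branch X Y → ℝ≥0∞) :
    edgeMean ρ (fun p => f p.swap) = edgeMean ρ f := (mass_transport hT hU 0 0 f).symm

lemma edgeMean_pairMass (hT : OnTrees ρ) (h0 : meanDeg ρ ≠ 0) (h1 : meanDeg ρ ≠ ⊤) :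
    edgeMean ρ (fun p => surprisal (pairMass ρ 0 0 p)) = meanDeg ρ * shannon (pairMass ρ 0 0) :=
  (shannon_pairMass hT h0 h1 0 0).symm

lemma edgeMean_add_const (hT : OnTrees ρ) (c : ℝ≥0∞) (f : Branch X Y × Branch X Y → ℝ≥0∞) :
    edgeMean ρ (fun p => c + f p) = meanDeg ρ * c + edgeMean ρ f := by
  have h : ∀ τ : MGraph X Y, ((ends 0 0 τ).map fun p => c + f p).sum =
      (deg τ : ℝ≥0∞) * c + ((ends 0 0 τ).map f).sum := by
    intro τ
    rw [Multiset.sum_map_add, Multiset.map_const', Multiset.sum_replicate, card_ends,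
      nsmul_eq_mul]
  simp only [edgeMean, h]
  rw [lintegral_add_right' _ (hT.aemeasurable_ends 0 0 fun M => (M.map f).sum),
    lintegral_mul_const'', meanDeg]
  exact hT.aemeasurable 1 fun τ hτ => by rw [deg_trunc hτ 0]

lemma edgeMean_eq [Fintype X] [Fintype Y] (hT : OnTrees ρ) (h0 : meanDeg ρ ≠ 0)
    (h1 : meanDeg ρ ≠ ⊤) (f : Branch X Y × Branch X Y → ℝ≥0∞) :
    edgeMean ρ f = meanDeg ρ * ∑ a : X × Y, ∑ b : X × Y,
      pairMass ρ 0 0 (leaf a.1 a.2, leaf b.1 b.2) * f (leaf a.1 a.2, leaf b.1 b.2) := by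
  rw [edgeMean, lintegral_ends hT h0 h1, ENNReal.tsum_prod', tsum_branch, tsum_fintype]
  · congr 1
    refine Finset.sum_congr rfl fun a _ => ?_
    rw [tsum_branch, tsum_fintype]
    intro t ht
    rw [pairMass_eq_zero hT fun h => ht h.2, zero_mul]
  · intro t ht
    refine ENNReal.tsum_eq_zero.2 fun t' => ?_
    rw [pairMass_eq_zero hT fun h => ht h.1, zero_mul]

lemma edgeMean_ne_top (hT : OnTrees ρ) (h0 : meanDeg ρ ≠ 0)
    (h1 : meanDeg ρ ≠ ⊤) {f : Branch X Y × Branch X Y → ℝ≥0∞} (hf : ∀ p, f p ≠ ⊤) :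
    edgeMean ρ f ≠ ⊤ := by
  have := Fintype.ofFinite X
  have := Fintype.ofFinite Y
  rw [edgeMean_eq hT h0 h1]
  refine ENNReal.mul_ne_top h1 (ENNReal.sum_ne_top.2 fun a _ => ENNReal.sum_ne_top.2 fun b _ => ?_)
  exact ENNReal.mul_ne_top (pairMass_ne_top hT h0 h1 _ _ _) (hf _)

end

section

variable [Fintype X] [Fintype Y] [MeasurableSpace X] [MeasurableSpace Y]
  [MeasurableSingletonClass X] [MeasurableSingletonClass Y]
  {ν : Measure X} {ξ : Measure (Y × Y)} [IsProbabilityMeasure ν] [IsProbabilityMeasure ξ]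
  {β : ℝ≥0} {ρ : Measure (MGraph X Y)}

lemma checkOne_eq (hT : OnTrees ρ) (η : Measure (MGraph X Y)) : checkOne η (marginal ρ 1) =
    η.withDensity fun σ => ((ends 0 0 σ).map fun p =>
      leafMass ρ p.1 / edgeMassFst 1 η p.1).prod := by
  simp only [checkOne, edgeMassFst_marginal hT, ends, RawGraph.ends, Multiset.map_map]
  rfl

lemma hatOne_eq (η μ : Measure (MGraph X Y)) : hatOne η μ =
    η.withDensity fun σ => ((ends 0 0 σ).map fun p => condDensity η μ p.1 p.2).prod := by
  simp only [hatOne, ends, RawGraph.ends, Multiset.map_map]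
  rfl

lemma markLaw_ne_zero {y y' : Y} (h : symmLaw ξ {(y, y')} ≠ 0) : markLaw ξ y ≠ 0 := fun h' =>
  h (le_antisymm (h' ▸ symmLaw_le_markLaw y y') zero_le)

lemma markLaw_ne_top (y : Y) : markLaw ξ y ≠ ⊤ :=
  ne_top_of_le_ne_top ENNReal.one_ne_top (markLaw_le_one y)

lemma Compatible.of_leafMass (hC : Compatible ν ξ ρ) {x : X} {y : Y}
    (h : leafMass ρ (leaf x y) ≠ 0) : ν {x} ≠ 0 ∧ markLaw ξ y ≠ 0 := by
  obtain ⟨t', ht⟩ := exists_of_leafMass_ne_zero h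
  obtain ⟨h1, -, h3⟩ := hC.edge _ ht
  rw [rootMark_leaf] at h1
  exact ⟨h1, markLaw_ne_zero h3⟩

lemma checkOne_univ (hT : OnTrees ρ) (h0 : meanDeg ρ ≠ 0) (h1 : meanDeg ρ ≠ ⊤)
    (hC : Compatible ν ξ ρ) (hβ : β ≠ 0) :
    IsProbabilityMeasure (checkOne (poissonStar ν ξ β) (marginal ρ 1)) := by
  constructor
  rw [← lintegral_one, checkOne_eq hT, atomic_poissonStar.lintegral_withDensity]
  simp only [mul_one]
  refine lintegral_prod_poissonStar _ fun _ _ => ?_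
  rw [← tsum_leafMass hT h0 h1, tsum_branch fun t ht => leafMass_eq_zero hT ht,
    ENNReal.tsum_prod', ENNReal.tsum_prod']
  refine tsum_congr fun x => ?_
  rw [ENNReal.tsum_prod']
  refine tsum_congr fun y => ?_
  simp only [edgeMassFst_poissonStar hβ]
  rw [ENNReal.tsum_mul_right, ENNReal.tsum_mul_left]
  change ν {x} * markLaw ξ y * _ = _
  by_cases hl : leafMass ρ (leaf x y) = 0
  · rw [hl, ENNReal.zero_div, mul_zero]
  · obtain ⟨h2, h3⟩ := hC.of_leafMass hl
    exact ENNReal.mul_div_cancel (mul_ne_zero h2 h3)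
      (ENNReal.mul_ne_top (measure_ne_top ν _) (markLaw_ne_top y))

lemma div_div_eq_mul {a b c : ℝ≥0∞} (hb0 : b ≠ 0) (hb : b ≠ ⊤) (hc0 : c ≠ 0) (hc : c ≠ ⊤) :
    b * (a / (b / c)) = a * c := by
  rw [div_eq_mul_inv, ENNReal.inv_div (Or.inl hc) (Or.inl hc0), mul_left_comm,
    ENNReal.mul_div_cancel hb0 hb]

/-- Multiplying the density by the weight of a child cancels the mass of the root mark and leaves
the conditional edge law times the law of the mark at the root end. -/
lemma condDensity_leaf (hT : OnTrees ρ) (hU : Unimodular ρ)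
    (hC : Compatible ν ξ ρ) (hβ : β ≠ 0) {x x' : X} {y y' : Y}
    (h : leafMass ρ (leaf x' y') ≠ 0) :
    ν {x} * symmLaw ξ {(y, y')} *
      condDensity (poissonStar ν ξ β) (marginal ρ 1) (leaf x y) (leaf x' y') =
      pairMass ρ 0 0 (leaf x y, leaf x' y') / leafMass ρ (leaf x' y') * markLaw ξ y' := by
  rw [condDensity, edgeMassSnd_marginal hT hU, if_neg h, edgeMass_marginal hT,
    edgeMass_poissonStar hβ, edgeMassSnd_poissonStar hβ]
  obtain ⟨h2, h3⟩ := hC.of_leafMass h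
  rw [mul_right_comm (ν {x}) (ν {x'}), mul_comm (ν {x'}), ENNReal.mul_div_mul_right _ _ h2 (measure_ne_top ν _)]
  by_cases hp : pairMass ρ 0 0 (leaf x y, leaf x' y') = 0
  · simp [hp]
  · obtain ⟨h4, -, h6⟩ := hC.edge _ hp
    rw [rootMark_leaf] at h4
    exact div_div_eq_mul (mul_ne_zero h4 h6) (ENNReal.mul_ne_top (measure_ne_top ν _)
      (measure_ne_top _ _)) h3 (markLaw_ne_top y')

lemma hatOne_univ (hT : OnTrees ρ) (hU : Unimodular ρ) (h0 : meanDeg ρ ≠ 0) (h1 : meanDeg ρ ≠ ⊤)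
    (hC : Compatible ν ξ ρ) (hβ : β ≠ 0) :
    IsProbabilityMeasure (hatOne (poissonStar ν ξ β) (marginal ρ 1)) := by
  constructor
  rw [← lintegral_one, hatOne_eq, atomic_poissonStar.lintegral_withDensity]
  simp only [mul_one]
  refine lintegral_prod_poissonStar _ fun x _ => ?_
  rw [← tsum_markLaw (ξ := ξ),
    ← ((Equiv.prodComm Y (X × Y)).trans (Equiv.prodAssoc X Y Y)).tsum_eq, ENNReal.tsum_prod']
  refine tsum_congr fun y' => ?_
  simp only [Equiv.trans_apply, Equiv.prodComm_apply, Prod.swap_prod_mk, Equiv.prodAssoc_apply]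
  -- For each mark at the root end the sum over the child must be the reference mass of that mark.
  -- For an unseen mark this is where the density one is used as the version of the conditional law.
  by_cases hl : leafMass ρ (leaf x y') = 0
  · have h2 : ∀ t, condDensity (poissonStar ν ξ β) (marginal ρ 1) t (leaf x y') = 1 := fun t => by
      rw [condDensity, edgeMassSnd_marginal hT hU, if_pos hl]
    simp only [h2, mul_one]
    rw [ENNReal.tsum_prod']
    simp only [ENNReal.tsum_mul_left, ENNReal.tsum_mul_right, tsum_measure_singleton, one_mul]
    exact tsum_congr fun y => symmLaw_swap ξ y' y
  · simp only [condDensity_leaf hT hU hC hβ hl, div_eq_mul_inv]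
    rw [ENNReal.tsum_mul_right, ENNReal.tsum_mul_right]
    have h2 : ∑' p : X × Y, pairMass ρ 0 0 (leaf p.1 p.2, leaf x y') = leafMass ρ (leaf x y') := by
      rw [leafMass, tsum_branch]
      · exact tsum_congr fun p => (pairMass_swap hT hU 0 0 _).symm
      · exact fun t ht => pairMass_eq_zero hT fun h => ht h.2
    rw [h2, ← div_eq_mul_inv, ENNReal.div_self hl, one_mul]
    exact ne_top_of_le_ne_top ENNReal.one_ne_top (leafMass_le_one hT h0 h1 _)

end

end

/-! ### Point masses and entropy balance at depth one. -/

section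

variable {X : Type u} {Y : Type v} [Nonempty Y]

/-! ### Entropy balance of the first neighbourhood -/

/-- The numerator of a representation of `β` as a quotient of two numbers of the unit interval. -/
def capNum (β : ℝ≥0) : ℝ≥0∞ := min (β : ℝ≥0∞) 1

/-- The denominator of a representation of `β` as a quotient of two numbers of the unit interval. -/
def capDen (β : ℝ≥0) : ℝ≥0∞ := min (β : ℝ≥0∞)⁻¹ 1

lemma capNum_ne_zero {β : ℝ≥0} (hβ : β ≠ 0) : capNum β ≠ 0 := by
  rw [capNum]
  exact (lt_min (by exact_mod_cast pos_iff_ne_zero.2 hβ) one_pos).ne'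

lemma capDen_ne_zero (β : ℝ≥0) : capDen β ≠ 0 :=
  (lt_min (ENNReal.inv_pos.2 ENNReal.coe_ne_top) one_pos).ne'

lemma capNum_le_one (β : ℝ≥0) : capNum β ≤ 1 := min_le_right _ _

lemma capDen_le_one (β : ℝ≥0) : capDen β ≤ 1 := min_le_right _ _

lemma capDen_ne_top (β : ℝ≥0) : capDen β ≠ ⊤ :=
  ne_top_of_le_ne_top ENNReal.one_ne_top (capDen_le_one β)

/-- Surprisals are logarithms of numbers in the unit interval, but `β` may exceed one. Writing `β`
as a quotient of two such numbers lets each edge of the Poisson star carry its factor `β`. -/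
lemma capNum_eq {β : ℝ≥0} (hβ : β ≠ 0) : capNum β = β * capDen β := by
  have h0 : (β : ℝ≥0∞) ≠ 0 := by exact_mod_cast hβ
  have h1 : (β : ℝ≥0∞) * (β : ℝ≥0∞)⁻¹ = 1 := ENNReal.mul_inv_cancel h0 ENNReal.coe_ne_top
  rcases le_total (β : ℝ≥0∞) 1 with h | h
  · rw [capNum, capDen, min_eq_left h, min_eq_right (ENNReal.one_le_inv.2 h), mul_one]
  · rw [capNum, capDen, min_eq_right h, min_eq_left (ENNReal.inv_le_one.2 h), h1]

lemma surprisal_cap {β : ℝ≥0} (hβ : β ≠ 0) : (surprisal (capNum β)).toReal =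
    (surprisal (capDen β)).toReal - Real.log β := by
  rw [toReal_surprisal (capNum_le_one β), toReal_surprisal (capDen_le_one β), capNum_eq hβ,
    ENNReal.toReal_mul, ENNReal.coe_toReal, Real.log_mul]
  · ring
  · exact_mod_cast hβ
  · exact (ENNReal.toReal_pos (capDen_ne_zero β) (capDen_ne_top β)).ne'

lemma surprisal_ofReal_exp_neg (b : ℝ) :
    surprisal (ENNReal.ofReal (Real.exp (-b))) = ENNReal.ofReal b := by
  rw [surprisal, ENNReal.toReal_ofReal (Real.exp_pos _).le, Real.log_exp, neg_neg]

lemma mem_ends_leaf {σ : MGraph X Y} (hσ : σ.IsTree) {p : Branch X Y × Branch X Y}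
    (hp : p ∈ ends 0 0 σ) : p = (leaf (rootMark p.1.1) p.1.2, leaf (rootMark p.2.1) p.2.2) :=
  Prod.ext (eq_leaf_of_mem (hσ.mem_of_mem_ends hp).1).symm
    (eq_leaf_of_mem (hσ.mem_of_mem_ends hp).2).symm

section

variable [Fintype X] [Fintype Y] [MeasurableSpace X] [MeasurableSpace Y]
  [MeasurableSingletonClass X] [MeasurableSingletonClass Y]
  {ν : Measure X} {ξ : Measure (Y × Y)} [IsProbabilityMeasure ν] [IsProbabilityMeasure ξ]
  {β : ℝ≥0} {ρ : Measure (MGraph X Y)}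

/-- The factor `(1 : ℕ)` takes the place of the factorials of an earlier generation, so that
`surprisal_balance_prod` applies as it stands. -/
lemma poissonStar_withDensity {f g r : Branch X Y × Branch X Y → ℝ≥0∞} {σ : MGraph X Y}
    (hσ : σ ∈ truncTrees X Y 1) (h : ∀ p ∈ ends 0 0 σ,
      β * (ν {rootMark p.1.1} * symmLaw ξ {(p.1.2, p.2.2)} * r p) = f p / g p) :
    (poissonStar ν ξ β).withDensity (fun σ => ((ends 0 0 σ).map r).prod) {σ} *
      factProd (entries 0 σ) = ENNReal.ofReal (Real.exp (-β)) * ν {rootMark σ} * (1 : ℕ) *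
        ((ends 0 0 σ).map fun p => f p / g p).prod := by
  have h1 : ((entries 0 σ).map fun e =>
      ν {(entryMarks e).1} * symmLaw ξ {(entryMarks e).2}).prod = ((ends 0 0 σ).map fun p =>
        ν {rootMark p.1.1} * symmLaw ξ {(p.1.2, p.2.2)}).prod := by
    rw [entries, Multiset.map_map]
    rfl
  have h2 : ((ends 0 0 σ).map fun p => f p / g p).prod = (β : ℝ≥0∞) ^ deg σ *
      (((ends 0 0 σ).map fun p => ν {rootMark p.1.1} * symmLaw ξ {(p.1.2, p.2.2)}).prod *
        ((ends 0 0 σ).map r).prod) := by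
    rw [← Multiset.map_congr rfl h, ← Multiset.prod_map_mul, ← card_ends 0 0,
      ← Multiset.prod_replicate, ← Multiset.map_const', ← Multiset.prod_map_mul]
  rw [atomic_poissonStar.withDensity_apply, mul_right_comm, poissonStar_singleton hσ, h1, h2]
  push_cast
  ring

lemma checkOne_singleton (hT : OnTrees ρ) (hC : Compatible ν ξ ρ) (hβ : β ≠ 0) {σ : MGraph X Y}
    (hσ : σ ∈ truncTrees X Y 1) (hp : ∀ p ∈ ends 0 0 σ, pairMass ρ 0 0 p ≠ 0) :
    checkOne (poissonStar ν ξ β) (marginal ρ 1) {σ} * factProd (entries 0 σ) =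
      ENNReal.ofReal (Real.exp (-β)) * ν {rootMark σ} * (1 : ℕ) *
        ((ends 0 0 σ).map fun p => capNum β * (leafMass ρ p.1 * symmLaw ξ {(p.1.2, p.2.2)}) /
          (capDen β * markLaw ξ p.1.2)).prod := by
  rw [checkOne_eq hT]
  refine poissonStar_withDensity hσ fun p h => ?_
  obtain ⟨h1, -, h3⟩ := hC.edge p (hp p h)
  have h4 : p.1 = leaf (rootMark p.1.1) p.1.2 := congrArg Prod.fst (mem_ends_leaf hσ.1 h)
  have h5 : edgeMassFst 1 (poissonStar ν ξ β) p.1 = ν {rootMark p.1.1} * markLaw ξ p.1.2 := by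
    conv_lhs => rw [h4]
    exact edgeMassFst_poissonStar hβ _ _
  rw [h5, capNum_eq hβ, mul_comm (β : ℝ≥0∞) (capDen β), mul_assoc (capDen β),
    ENNReal.mul_div_mul_left _ _ (capDen_ne_zero β) (capDen_ne_top β), mul_div_assoc]
  congr 1
  rw [mul_assoc, mul_left_comm, ← mul_div_assoc,
    ENNReal.mul_div_mul_left _ _ h1 (measure_ne_top ν _), ← mul_div_assoc, mul_comm (leafMass ρ _)]

lemma hatOne_singleton (hT : OnTrees ρ) (hU : Unimodular ρ) (hC : Compatible ν ξ ρ) (hβ : β ≠ 0)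
    {σ : MGraph X Y} (hσ : σ ∈ truncTrees X Y 1) (hp : ∀ p ∈ ends 0 0 σ, leafMass ρ p.2 ≠ 0) :
    hatOne (poissonStar ν ξ β) (marginal ρ 1) {σ} * factProd (entries 0 σ) =
      ENNReal.ofReal (Real.exp (-β)) * ν {rootMark σ} * (1 : ℕ) *
        ((ends 0 0 σ).map fun p => capNum β * (pairMass ρ 0 0 p * markLaw ξ p.2.2) /
          (capDen β * leafMass ρ p.2)).prod := by
  rw [hatOne_eq]
  refine poissonStar_withDensity hσ fun p h => ?_
  have h1 := hp p h
  rw [mem_ends_leaf hσ.1 h] at h1 ⊢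
  simp only [rootMark_leaf] at h1 ⊢
  change _ * (ν {_} * symmLaw ξ {(p.1.2, p.2.2)} * _) = _
  rw [condDensity_leaf hT hU hC hβ h1, capNum_eq hβ, mul_comm (β : ℝ≥0∞) (capDen β),
    mul_assoc (capDen β), ENNReal.mul_div_mul_left _ _ (capDen_ne_zero β) (capDen_ne_top β),
    mul_div_assoc, ENNReal.mul_div_right_comm]
  rfl

/-- A law on stars whose point masses are products over the edges. -/
lemma entropy_balance_one [IsProbabilityMeasure ρ] (hT : OnTrees ρ) (h0 : meanDeg ρ ≠ 0)
    (h1 : meanDeg ρ ≠ ⊤) (hν : ∀ᵐ τ ∂ρ, ν {rootMark τ} ≠ 0) (hβ : β ≠ 0)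
    {κ : Measure (MGraph X Y)} [IsProbabilityMeasure κ] (hκ : Atomic (truncTrees X Y 1) κ)
    {f g : Branch X Y × Branch X Y → ℝ≥0∞}
    (hf : ∀ p, pairMass ρ 0 0 p ≠ 0 → f p ≠ 0 ∧ f p ≤ 1)
    (hg : ∀ p, pairMass ρ 0 0 p ≠ 0 → g p ≠ 0 ∧ g p ≤ 1)
    (h : ∀ σ, marginal ρ 1 {σ} ≠ 0 → κ {σ} * factProd (entries 0 σ) =
      ENNReal.ofReal (Real.exp (-β)) * ν {rootMark σ} * (1 : ℕ) *
        ((ends 0 0 σ).map fun p => capNum β * f p / (capDen β * g p)).prod) :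
    (shannon fun σ => marginal ρ 1 {σ}) + klDiv (marginal ρ 1) κ +
      (meanDeg ρ * surprisal (capDen β) + edgeMean ρ fun p => surprisal (g p)) =
    β + ∫⁻ τ, surprisal (ν {rootMark τ}) ∂ρ + countEntropy ρ 0 +
      (meanDeg ρ * surprisal (capNum β) + edgeMean ρ fun p => surprisal (f p)) := by
  have hF : ∀ p, pairMass ρ 0 0 p ≠ 0 → capNum β * f p ≠ 0 ∧ capNum β * f p ≤ 1 := fun p hp =>
    ⟨mul_ne_zero (capNum_ne_zero hβ) (hf p hp).1, mul_le_one' (capNum_le_one β) (hf p hp).2⟩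
  have hG : ∀ p, pairMass ρ 0 0 p ≠ 0 → capDen β * g p ≠ 0 ∧ capDen β * g p ≤ 1 := fun p hp =>
    ⟨mul_ne_zero (capDen_ne_zero β) (hg p hp).1, mul_le_one' (capDen_le_one β) (hg p hp).2⟩
  have hexp0 : ENNReal.ofReal (Real.exp (-β)) ≠ 0 := by
    rw [Ne, ENNReal.ofReal_eq_zero, not_le]; exact Real.exp_pos _
  have hexp1 : ENNReal.ofReal (Real.exp (-β)) ≤ 1 := by
    rw [← ENNReal.ofReal_one]
    exact ENNReal.ofReal_le_ofReal (Real.exp_le_one_iff.2 (neg_nonpos.2 β.coe_nonneg))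
  have hpos : ∀ σ, marginal ρ 1 {σ} ≠ 0 → ν {rootMark σ} ≠ 0 ∧
      ∀ p ∈ ends 0 0 σ, pairMass ρ 0 0 p ≠ 0 := by
    intro σ hσ
    refine ⟨?_, fun p hp => pairMass_ne_zero_of_marginal hT h0 h1 le_rfl (Nat.zero_le 1) hσ hp⟩
    obtain ⟨τ, h2, rfl⟩ := exists_of_marginal_ne_zero hT hσ hν
    rwa [rootMark_trunc]
  have hac : marginal ρ 1 ≪ κ := by
    refine (atomic_marginal hT 1).absolutelyContinuous fun σ hσ hz => ?_
    by_contra hm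
    have h2 := h σ hm
    rw [hz, zero_mul] at h2
    obtain ⟨h3, h4⟩ := hpos σ hm
    refine mul_ne_zero (mul_ne_zero (mul_ne_zero hexp0 h3) (by simp)) ?_ h2.symm
    rw [Ne, Multiset.prod_eq_zero_iff]
    intro h5
    obtain ⟨p, hp, h6⟩ := Multiset.mem_map.1 h5
    refine ENNReal.div_ne_zero.2 ⟨(hF p (h4 p hp)).1, ?_⟩ h6
    exact ne_top_of_le_ne_top ENNReal.one_ne_top (hG p (h4 p hp)).2
  have hmap : ∀ (c : ℝ≥0∞) (φ : Branch X Y × Branch X Y → ℝ≥0∞),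
      meanDeg ρ * c + edgeMean ρ φ = edgeMean ρ fun p => c + φ p := fun c φ =>
    (edgeMean_add_const hT c φ).symm
  have hsup : ∀ φ : Branch X Y × Branch X Y → ℝ≥0∞, AEMeasurable
      (fun τ => ((ends 0 0 τ).map φ).sum) ρ := fun φ =>
    hT.aemeasurable_ends _ _ fun M => (M.map φ).sum
  have hroot : AEMeasurable (fun τ => surprisal (ν {rootMark τ})) ρ :=
    hT.aemeasurable 0 fun τ _ => by rw [rootMark_trunc]
  -- The constant `β` is the surprisal of the factor `exp (-β)` of the Poisson weight.
  have hβ' : (β : ℝ≥0∞) = ∫⁻ _ : MGraph X Y, surprisal (ENNReal.ofReal (Real.exp (-β))) ∂ρ := by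
    rw [lintegral_const, measure_univ, mul_one, surprisal_ofReal_exp_neg, ENNReal.ofReal_coe_nnreal]
  rw [(atomic_marginal hT 1).shannon_eq, (atomic_marginal hT 1).add_klDiv hκ hac,
    lintegral_marginal hT, hmap, hmap]
  conv_rhs => rw [hβ']
  rw [edgeMean, edgeMean, countEntropy, ← lintegral_add_right' _ (hsup _),
    ← lintegral_add_left measurable_const, ← lintegral_add_right' _ (aemeasurable_log_factProd hT 0),
    ← lintegral_add_right' _ (hsup _)]
  refine lintegral_congr_ae ?_
  filter_upwards [hT, ae_marginal_ne_zero hT 1] with τ hτ hm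
  have h2 := h _ hm
  obtain ⟨h3, h4⟩ := hpos _ hm
  have hp := MGraph.IsTree.ends_trunc hτ (le_refl 0) (Nat.zero_le 1)
  rw [hp] at h2 h4
  rw [rootMark_trunc] at h2 h3
  rw [MGraph.IsTree.entries_trunc hτ le_rfl] at h2
  have h5 := surprisal_balance_prod (fun hc => hm (hac hc)) prob_le_one (mul_ne_zero hexp0 h3)
    (mul_le_one' hexp1 prob_le_one) (fun p h => hF p (h4 p h)) (fun p h => hG p (h4 p h))
    (factProd_pos _) one_pos h2
  rw [surprisal_mul hexp0 hexp1 h3 prob_le_one, Nat.cast_one, Real.log_one, ENNReal.ofReal_zero,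
    add_zero] at h5
  have hsplit : ∀ (c : ℝ≥0∞) (φ : Branch X Y × Branch X Y → ℝ≥0∞), c ≠ 0 → c ≤ 1 →
      (∀ p, pairMass ρ 0 0 p ≠ 0 → φ p ≠ 0 ∧ φ p ≤ 1) →
      (ends 0 0 τ).map (fun p => surprisal (c * φ p)) =
      (ends 0 0 τ).map fun p => surprisal c + surprisal (φ p) := fun c φ hc0 hc hφ =>
    Multiset.map_congr rfl fun p hp =>
      surprisal_mul hc0 hc (hφ p (h4 p hp)).1 (hφ p (h4 p hp)).2
  rw [hsplit _ _ (capNum_ne_zero hβ) (capNum_le_one β) hf,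
    hsplit _ _ (capDen_ne_zero β) (capDen_le_one β) hg] at h5
  exact h5

end

end

/-! ### Finite entropy at depth one and the two first balances. -/

section

variable {X : Type u} {Y : Type v} [Nonempty Y]

/-! ### Finiteness of the entropy of the first neighbourhood -/

/-- The Gibbs inequality: entropy is at most a cross entropy. The extra total mass of `n` allows
comparison weights that are not normalised. -/
lemma shannon_le {α : Type*} {m n : α → ℝ≥0∞} (hm : ∀ a, m a ≤ 1) (hn : ∀ a, n a ≤ 1)
    (h : ∀ a, n a = 0 → m a = 0) : shannon m ≤ ∑' a, m a * surprisal (n a) + ∑' a, n a := by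
  rw [shannon_eq fun a => ne_top_of_le_ne_top ENNReal.one_ne_top (hm a), ← ENNReal.tsum_add]
  refine ENNReal.tsum_le_tsum fun a => ?_
  rw [← mul_surprisal_add_klFun (hm a) (hn a) (h a), add_assoc]
  exact le_self_add

lemma surprisal_pow {c : ℝ≥0∞} (hc0 : c ≠ 0) (hc : c ≤ 1) (n : ℕ) :
    surprisal (c ^ n) = n * surprisal c := by
  induction n with
  | zero => simp [surprisal]
  | succ n ih =>
    rw [pow_succ, surprisal_mul (pow_ne_zero n hc0) (pow_le_one' hc n) hc0 hc, ih]
    push_cast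
    ring

section

variable [Fintype X] [Fintype Y] [Nonempty X]

/-- The reciprocal of twice the number of possible children. -/
def starScale (X : Type u) (Y : Type v) [Fintype X] [Fintype Y] : ℝ≥0∞ :=
  (2 * Fintype.card (X × Y × Y) : ℝ≥0∞)⁻¹

lemma starScale_ne_zero : starScale X Y ≠ 0 :=
  ENNReal.inv_ne_zero.2 (ENNReal.mul_ne_top ENNReal.ofNat_ne_top (ENNReal.natCast_ne_top _))

lemma starScale_le_one : starScale X Y ≤ 1 := by
  have h : 1 ≤ Fintype.card (X × Y × Y) := Fintype.card_pos
  rw [starScale, ENNReal.inv_le_one]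
  exact_mod_cast (by omega : 1 ≤ 2 * Fintype.card (X × Y × Y))

/-- A star of degree `n` is given by a root mark and `n` of the `card (X × Y × Y)` kinds of
children. The scale is half the reciprocal of that number, so a geometric series of ratio `1/2`
remains. -/
lemma tsum_starScale_ne_top :
    ∑' σ : truncTrees X Y 1, starScale X Y ^ (deg (σ : MGraph X Y) + 1) ≠ ⊤ := by
  let f : (Σ n : ℕ, X × (Fin n → X × Y × Y)) → truncTrees X Y 1 :=
    fun q => ⟨star q.2.1 q.1 q.2.2, star_mem _ _ _⟩
  have hf : Function.Surjective f := by
    rintro ⟨σ, hσ⟩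
    obtain ⟨m, hm⟩ := exists_star hσ
    exact ⟨⟨deg σ, rootMark σ, m⟩, Subtype.ext hm⟩
  refine ne_top_of_le_ne_top ?_ (ENNReal.tsum_le_tsum_comp_of_surjective hf _)
  rw [ENNReal.tsum_sigma']
  have hK : (Fintype.card (X × Y × Y) : ℝ≥0∞) ≠ 0 := by exact_mod_cast Fintype.card_ne_zero
  have h1 : ∀ n : ℕ, ∑' q : X × (Fin n → X × Y × Y),
      starScale X Y ^ (deg ((f ⟨n, q⟩ : truncTrees X Y 1) : MGraph X Y) + 1) =
      Fintype.card X * starScale X Y * 2⁻¹ ^ n := by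
    intro n
    have h2 : ∀ q : X × (Fin n → X × Y × Y),
        deg ((f ⟨n, q⟩ : truncTrees X Y 1) : MGraph X Y) = n := fun q => deg_star _ _ _
    have h3 : (Fintype.card (X × Y × Y) : ℝ≥0∞) * starScale X Y = 2⁻¹ := by
      rw [starScale, ENNReal.mul_inv (Or.inl two_ne_zero) (Or.inl ENNReal.ofNat_ne_top),
        mul_left_comm, ENNReal.mul_inv_cancel hK (ENNReal.natCast_ne_top _), mul_one]
    simp only [h2]
    rw [tsum_fintype, Finset.sum_const, Finset.card_univ, Fintype.card_prod, Fintype.card_fun,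
      Fintype.card_fin, nsmul_eq_mul, ← h3, mul_pow, pow_succ]
    push_cast
    ring
  rw [tsum_congr h1, ENNReal.tsum_mul_left, ENNReal.tsum_geometric]
  refine ENNReal.mul_ne_top (ENNReal.mul_ne_top (ENNReal.natCast_ne_top _) ?_) ?_
  · exact ne_top_of_le_ne_top ENNReal.one_ne_top starScale_le_one
  · rw [ENNReal.one_sub_inv_two, inv_inv]
    exact ENNReal.ofNat_ne_top

lemma shannon_marginal_one_ne_top {ρ : Measure (MGraph X Y)} [IsProbabilityMeasure ρ]
    (hT : OnTrees ρ) (h1 : meanDeg ρ ≠ ⊤) : (shannon fun σ => marginal ρ 1 {σ}) ≠ ⊤ := by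
  classical
  -- Geometric weights make the surprisal affine in the degree, so a finite mean degree bounds the
  -- cross entropy.
  let n : MGraph X Y → ℝ≥0∞ := fun σ =>
    if σ ∈ truncTrees X Y 1 then starScale X Y ^ (deg σ + 1) else 0
  have hn : ∀ σ, n σ ≤ 1 := fun σ => by
    by_cases hσ : σ ∈ truncTrees X Y 1
    · simp only [n, if_pos hσ]
      exact pow_le_one' starScale_le_one _
    · simp only [n, if_neg hσ]
      exact zero_le
  refine ne_top_of_le_ne_top ?_ (shannon_le (n := n) (fun σ => prob_le_one) hn fun σ hσ => ?_)
  · refine ENNReal.add_ne_top.2 ⟨?_, ?_⟩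
    · rw [← (atomic_marginal hT 1).lintegral, lintegral_marginal hT]
      have h2 : ∫⁻ τ, surprisal (n (trunc 1 τ)) ∂ρ =
          ∫⁻ τ, ((deg τ : ℝ≥0∞) + 1) * surprisal (starScale X Y) ∂ρ := by
        refine lintegral_congr_ae ?_
        filter_upwards [hT] with τ hτ
        have h3 : trunc 1 τ ∈ truncTrees X Y 1 := MGraph.IsTree.trunc_mem hτ 1
        simp only [n, if_pos h3]
        rw [surprisal_pow starScale_ne_zero starScale_le_one, deg_trunc hτ 0]
        push_cast
        rfl
      rw [h2, lintegral_mul_const' _ _ (surprisal_ne_top _),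
        lintegral_add_right _ measurable_const, lintegral_const, measure_univ, mul_one]
      exact ENNReal.mul_ne_top (ENNReal.add_ne_top.2 ⟨h1, ENNReal.one_ne_top⟩) (surprisal_ne_top _)
    · have h2 : ∑' σ, n σ = ∑' σ : truncTrees X Y 1, starScale X Y ^ (deg (σ : MGraph X Y) + 1) := by
        rw [tsum_subtype (truncTrees X Y 1) fun σ => starScale X Y ^ (deg σ + 1)]
        refine tsum_congr fun σ => ?_
        by_cases hσ : σ ∈ truncTrees X Y 1
        · simp only [n, if_pos hσ, Set.indicator_of_mem hσ]
        · simp only [n, if_neg hσ, Set.indicator_of_notMem hσ]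
      rw [h2]
      exact tsum_starScale_ne_top
  · by_contra hm
    have h3 := isTree_of_marginal_ne_zero hT hm
    simp only [n, if_pos h3] at hσ
    exact pow_ne_zero _ starScale_ne_zero hσ

lemma factorial_le_mul_factProd {σ : MGraph X Y} (hσ : σ ∈ truncTrees X Y 1) :
    (deg σ).factorial ≤ Fintype.card (X × Y × Y) ^ deg σ * factProd (entries 0 σ) := by
  classical
  obtain ⟨h1, -⟩ := ncard_labellings hσ
  rw [← h1]
  refine Nat.mul_le_mul_right _ ?_
  refine (Set.ncard_le_card _).trans ?_
  simp

/-- Finitely many kinds of children force repetitions: `n!` is at most `card (X × Y × Y) ^ n` times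
the product of the factorials of multiplicities. So an infinite `degLogMoment` makes `countEntropy ρ
0` infinite. -/
lemma degLogMoment_le {ρ : Measure (MGraph X Y)} (hT : OnTrees ρ) :
    degLogMoment ρ ≤ countEntropy ρ 0 +
      meanDeg ρ * ENNReal.ofReal (Real.log (Fintype.card (X × Y × Y)) + 1) := by
  have hK : 1 ≤ Fintype.card (X × Y × Y) := Fintype.card_pos
  have hlogK : 0 ≤ Real.log (Fintype.card (X × Y × Y)) := Real.log_natCast_nonneg _
  rw [meanDeg, ← lintegral_mul_const' _ _ ENNReal.ofReal_ne_top, countEntropy,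
    ← lintegral_add_left' (aemeasurable_log_factProd hT 0)]
  refine lintegral_mono_ae ?_
  filter_upwards [hT] with τ hτ
  have h1 := factorial_le_mul_factProd (MGraph.IsTree.trunc_mem hτ 1)
  rw [deg_trunc hτ 0, MGraph.IsTree.entries_trunc hτ le_rfl] at h1
  rw [← ENNReal.ofReal_natCast (deg τ), ← ENNReal.ofReal_mul (Nat.cast_nonneg _),
    ← ENNReal.ofReal_add (Real.log_natCast_nonneg _) (by positivity)]
  refine ENNReal.ofReal_le_ofReal ?_
  set n := deg τ
  have hf : (0 : ℝ) < (n.factorial : ℝ) := by exact_mod_cast n.factorial_pos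
  have hP : (0 : ℝ) < (factProd (entries 0 τ) : ℝ) := by exact_mod_cast factProd_pos _
  have hK' : (0 : ℝ) < (Fintype.card (X × Y × Y) : ℝ) := by exact_mod_cast hK
  -- From `n ^ n / n! ≤ exp n`.
  have h2 : (n : ℝ) * Real.log n ≤ Real.log n.factorial + n := by
    rcases Nat.eq_zero_or_pos n with hn | hn
    · simp [hn]
    have hn' : (0 : ℝ) < n := by exact_mod_cast hn
    have h3 := Real.pow_div_factorial_le_exp (n : ℝ) hn'.le n
    have h4 := Real.log_le_log (by positivity) h3
    rw [Real.log_exp, Real.log_div (by positivity) hf.ne', Real.log_pow] at h4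
    linarith
  have h3 : Real.log n.factorial ≤
      n * Real.log (Fintype.card (X × Y × Y)) + Real.log (factProd (entries 0 τ)) := by
    rw [← Real.log_pow, ← Real.log_mul (by positivity) hP.ne']
    refine Real.log_le_log hf ?_
    exact_mod_cast h1
  linarith

end

/-! ### The two balances of the first neighbourhood -/

section

variable [Finite X] [Finite Y] {ρ : Measure (MGraph X Y)}

lemma edgeMean_surprisal_mul (hT : OnTrees ρ) (h0 : meanDeg ρ ≠ 0) (h1 : meanDeg ρ ≠ ⊤)
    {f g : Branch X Y × Branch X Y → ℝ≥0∞}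
    (hf : ∀ p, pairMass ρ 0 0 p ≠ 0 → f p ≠ 0 ∧ f p ≤ 1)
    (hg : ∀ p, pairMass ρ 0 0 p ≠ 0 → g p ≠ 0 ∧ g p ≤ 1) :
    edgeMean ρ (fun p => surprisal (f p * g p)) =
      edgeMean ρ (fun p => surprisal (f p)) + edgeMean ρ fun p => surprisal (g p) := by
  rw [edgeMean, edgeMean, edgeMean, ← lintegral_add_right' _
    (hT.aemeasurable_ends 0 0 fun M => (M.map fun p => surprisal (g p)).sum)]
  refine lintegral_congr_ae ?_
  filter_upwards [ae_pairMass_ne_zero hT h0 h1 0 0] with τ hτ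
  rw [← Multiset.sum_map_add]
  congr 1
  exact Multiset.map_congr rfl fun p hp => surprisal_mul (hf p (hτ p hp)).1 (hf p (hτ p hp)).2
    (hg p (hτ p hp)).1 (hg p (hτ p hp)).2

end

section

variable [Fintype X] [Fintype Y] [MeasurableSpace X] [MeasurableSpace Y]
  [MeasurableSingletonClass X] [MeasurableSingletonClass Y]
  {ν : Measure X} {ξ : Measure (Y × Y)} [IsProbabilityMeasure ν] [IsProbabilityMeasure ξ]
  {β : ℝ≥0} {ρ : Measure (MGraph X Y)}

lemma leafMass_ne_zero {p : Branch X Y × Branch X Y} (h : pairMass ρ 0 0 p ≠ 0) :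
    leafMass ρ p.1 ≠ 0 := fun h' => h (le_antisymm (h' ▸ pairMass_le_leafMass p.1 p.2) zero_le)

lemma leafMass_snd_ne_zero (hT : OnTrees ρ) (hU : Unimodular ρ) {p : Branch X Y × Branch X Y}
    (h : pairMass ρ 0 0 p ≠ 0) : leafMass ρ p.2 ≠ 0 := by
  have h' : pairMass ρ 0 0 p.swap ≠ 0 := by rwa [pairMass_swap hT hU]
  exact leafMass_ne_zero (p := p.swap) h'

/-- The edge factor is `β` times `leafMass` of the far end times the mass of the pair of edge marks,
divided by the mass of the far edge mark. -/
lemma checkOne_balance [IsProbabilityMeasure ρ] (hT : OnTrees ρ) (h0 : meanDeg ρ ≠ 0)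
    (h1 : meanDeg ρ ≠ ⊤) (hC : Compatible ν ξ ρ) (hβ : β ≠ 0) :
    (shannon fun σ => marginal ρ 1 {σ}) +
        klDiv (marginal ρ 1) (checkOne (poissonStar ν ξ β) (marginal ρ 1)) +
      (meanDeg ρ * surprisal (capDen β) + edgeMean ρ fun p => surprisal (markLaw ξ p.1.2)) =
    β + ∫⁻ τ, surprisal (ν {rootMark τ}) ∂ρ + countEntropy ρ 0 +
      (meanDeg ρ * surprisal (capNum β) + ((edgeMean ρ fun p => surprisal (leafMass ρ p.1)) +
        edgeMean ρ fun p => surprisal (symmLaw ξ {(p.1.2, p.2.2)}))) := by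
  have := checkOne_univ hT h0 h1 hC hβ
  have hκ : Atomic (truncTrees X Y 1) (checkOne (poissonStar ν ξ β) (marginal ρ 1)) := by
    rw [checkOne_eq hT]
    exact atomic_poissonStar.withDensity _
  have hl : ∀ p, pairMass ρ 0 0 p ≠ 0 → leafMass ρ p.1 ≠ 0 ∧ leafMass ρ p.1 ≤ 1 := fun p hp =>
    ⟨leafMass_ne_zero hp, leafMass_le_one hT h0 h1 _⟩
  have hs : ∀ p : Branch X Y × Branch X Y, pairMass ρ 0 0 p ≠ 0 →
      symmLaw ξ {(p.1.2, p.2.2)} ≠ 0 ∧ symmLaw ξ {(p.1.2, p.2.2)} ≤ 1 := fun p hp =>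
    ⟨(hC.edge p hp).2.2, prob_le_one⟩
  rw [← edgeMean_surprisal_mul hT h0 h1 hl hs]
  refine entropy_balance_one hT h0 h1 hC.root hβ hκ (fun p hp => ⟨mul_ne_zero (hl p hp).1
    (hs p hp).1, mul_le_one' (hl p hp).2 (hs p hp).2⟩) (fun p hp =>
    ⟨markLaw_ne_zero (hs p hp).1, markLaw_le_one _⟩) fun σ hσ => ?_
  exact checkOne_singleton hT hC hβ (isTree_of_marginal_ne_zero hT hσ) fun p hp =>
    pairMass_ne_zero_of_marginal hT h0 h1 le_rfl (Nat.zero_le 1) hσ hp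

/-- Here `leafMass` and `markLaw` stand on the sides opposite to those in `checkOne_balance`. They
occur first at the root end; `edgeMean_swap` moves them to the far end, so that they cancel in the
sum. -/
lemma hatOne_balance [IsProbabilityMeasure ρ] (hT : OnTrees ρ) (hU : Unimodular ρ)
    (h0 : meanDeg ρ ≠ 0) (h1 : meanDeg ρ ≠ ⊤) (hC : Compatible ν ξ ρ) (hβ : β ≠ 0) :
    (shannon fun σ => marginal ρ 1 {σ}) +
        klDiv (marginal ρ 1) (hatOne (poissonStar ν ξ β) (marginal ρ 1)) +
      (meanDeg ρ * surprisal (capDen β) + edgeMean ρ fun p => surprisal (leafMass ρ p.1)) =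
    β + ∫⁻ τ, surprisal (ν {rootMark τ}) ∂ρ + countEntropy ρ 0 +
      (meanDeg ρ * surprisal (capNum β) + (meanDeg ρ * shannon (pairMass ρ 0 0) +
        edgeMean ρ fun p => surprisal (markLaw ξ p.1.2))) := by
  have := hatOne_univ hT hU h0 h1 hC hβ
  have hκ : Atomic (truncTrees X Y 1) (hatOne (poissonStar ν ξ β) (marginal ρ 1)) := by
    rw [hatOne_eq]
    exact atomic_poissonStar.withDensity _
  have hl : ∀ p, pairMass ρ 0 0 p ≠ 0 → pairMass ρ 0 0 p ≠ 0 ∧ pairMass ρ 0 0 p ≤ 1 := fun p hp =>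
    ⟨hp, pairMass_le_one hT h0 h1 _ _ _⟩
  have hs : ∀ p : Branch X Y × Branch X Y, pairMass ρ 0 0 p ≠ 0 →
      markLaw ξ p.2.2 ≠ 0 ∧ markLaw ξ p.2.2 ≤ 1 := fun p hp => by
    refine ⟨?_, markLaw_le_one _⟩
    rw [← pairMass_swap hT hU] at hp
    exact markLaw_ne_zero (hC.edge _ hp).2.2
  rw [← edgeMean_swap hT hU fun p => surprisal (leafMass ρ p.1),
    ← edgeMean_swap hT hU fun p => surprisal (markLaw ξ p.1.2), ← edgeMean_pairMass hT h0 h1]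
  simp only [Prod.fst_swap]
  rw [← edgeMean_surprisal_mul hT h0 h1 hl hs]
  refine entropy_balance_one hT h0 h1 hC.root hβ hκ (fun p hp => ⟨mul_ne_zero (hl p hp).1
    (hs p hp).1, mul_le_one' (hl p hp).2 (hs p hp).2⟩) (fun p hp =>
    ⟨leafMass_snd_ne_zero hT hU hp, leafMass_le_one hT h0 h1 _⟩) fun σ hσ => ?_
  exact hatOne_singleton hT hU hC hβ (isTree_of_marginal_ne_zero hT hσ) fun p hp =>
    leafMass_snd_ne_zero hT hU
      (pairMass_ne_zero_of_marginal hT h0 h1 le_rfl (Nat.zero_le 1) hσ hp)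

end

end

/-! ### Laws of marks and absolute continuity at depth one. -/

section

variable {X : Type u} {Y : Type v} [Nonempty Y]

/-! ### Laws of marks -/

lemma measurable_rootMark [MeasurableSpace X] :
    Measurable (rootMark : MGraph X Y → X) :=
  measurable_of_trunc 0 fun τ τ' h => by rw [← rootMark_trunc 0 τ, h, rootMark_trunc]

instance [MeasurableSpace X] {ρ : Measure (MGraph X Y)} [IsProbabilityMeasure ρ] :
    IsProbabilityMeasure (rootLaw ρ) :=
  Measure.isProbabilityMeasure_map measurable_rootMark.aemeasurable

lemma atomic_of_finite {α : Type*} [Finite α] [MeasurableSpace α] [MeasurableSingletonClass α]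
    (μ : Measure α) : Atomic Set.univ μ :=
  ⟨Set.countable_univ, fun _ _ => measurableSet_singleton _, by simp⟩

lemma klDiv_ne_top_of_finite {α : Type*} [Finite α] [MeasurableSpace α]
    [MeasurableSingletonClass α] {μ ν : Measure α} [IsFiniteMeasure μ] (h : μ ≪ ν) :
    klDiv μ ν ≠ ⊤ := klDiv_ne_top h Integrable.of_finite

lemma absolutelyContinuous_iff {α : Type*} [Finite α] [MeasurableSpace α]
    [MeasurableSingletonClass α] {μ ν : Measure α} : μ ≪ ν ↔ ∀ a, μ {a} ≠ 0 → ν {a} ≠ 0 :=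
  ⟨fun h _ ha hn => ha (h hn), fun h => (atomic_of_finite μ).absolutelyContinuous fun a _ hn => by
    by_contra hm
    exact h a hm hn⟩

lemma shannon_ne_top_of_finite {α : Type*} [Finite α] (m : α → ℝ≥0∞) : shannon m ≠ ⊤ := by
  have := Fintype.ofFinite α
  rw [shannon, tsum_fintype]
  exact ENNReal.sum_ne_top.2 fun _ _ => ENNReal.ofReal_ne_top

section

variable [Fintype X] [Fintype Y] [MeasurableSpace X] [MeasurableSpace Y]
  [MeasurableSingletonClass X] [MeasurableSingletonClass Y]
  {ν : Measure X} {ξ : Measure (Y × Y)} [IsProbabilityMeasure ν] [IsProbabilityMeasure ξ]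
  {β : ℝ≥0} {ρ : Measure (MGraph X Y)}

lemma edgeCount_le_deg (h : ℕ) (p : Branch X Y × Branch X Y) (τ : MGraph X Y) :
    edgeCount h p τ ≤ deg τ := by
  classical
  rw [edgeCount_eq, ← card_ends (h - 1) (h - 1)]
  exact Multiset.count_le_card _ _

lemma covMass_ne_top (h : ℕ) (μ : Measure (MGraph X Y)) (p : Branch X Y × Branch X Y) :
    covMass h μ p ≠ ⊤ := by
  have h1 : ∫⁻ τ, (edgeCount h p τ : ℝ≥0∞) ∂μ ≤ meanDeg μ :=
    lintegral_mono fun τ =>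
      Nat.cast_le.2 (edgeCount_le_deg h p τ)
  refine ne_top_of_le_ne_top ENNReal.one_ne_top (ENNReal.div_le_of_le_mul ?_)
  rwa [one_mul]

lemma edgeMarkLaw_singleton (h0 : meanDeg ρ ≠ 0) (h1 : meanDeg ρ ≠ ⊤) (y y' : Y) :
    edgeMarkLaw ρ {(y, y')} = ∑ x : X, ∑ x' : X, covMass 1 (marginal ρ 1)
      ((MGraph.mk (RawGraph.point x), y), (MGraph.mk (RawGraph.point x'), y')) := by
  rw [edgeMarkLaw, ofMass_singleton _ (measurableSet_singleton _), edgeIntensity, mul_comm,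
    ENNReal.mul_div_cancel_right h0 h1]

lemma isFiniteMeasure_edgeMarkLaw (h0 : meanDeg ρ ≠ 0) (h1 : meanDeg ρ ≠ ⊤) :
    IsFiniteMeasure (edgeMarkLaw ρ) := by
  constructor
  rw [← Finset.coe_univ, ← sum_measure_singleton]
  refine ENNReal.sum_lt_top.2 fun p _ => ?_
  rw [show p = (p.1, p.2) from rfl, edgeMarkLaw_singleton h0 h1]
  exact ENNReal.sum_lt_top.2 fun x _ => ENNReal.sum_lt_top.2 fun x' _ =>
    (covMass_ne_top _ _ _).lt_top

lemma explicitPart_ne_bot (ν : Measure X) (ξ : Measure (Y × Y)) (ρ : Measure (MGraph X Y)) :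
    explicitPart ν ξ ρ ≠ ⊥ := by
  rw [explicitPart]
  simp only [EReal.add_ne_bot_iff]
  exact ⟨⟨⟨EReal.coe_ennreal_ne_bot _, EReal.coe_ennreal_ne_bot _⟩, EReal.coe_ennreal_ne_bot _⟩,
    EReal.coe_ne_bot _⟩

lemma explicitPart_ne_top [IsProbabilityMeasure ρ] (h0 : meanDeg ρ ≠ 0) (h1 : meanDeg ρ ≠ ⊤)
    (hν : rootLaw ρ ≪ ν) (hξ : edgeMarkLaw ρ ≪ symmLaw ξ) : explicitPart ν ξ ρ ≠ ⊤ := by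
  have := isFiniteMeasure_edgeMarkLaw h0 h1
  rw [explicitPart]
  refine EReal.add_ne_top (EReal.add_ne_top (EReal.add_ne_top ?_ ?_) ?_) (EReal.coe_ne_top _)
  · rw [Ne, EReal.coe_ennreal_eq_top_iff]
    exact shannon_ne_top_of_finite _
  · rw [Ne, EReal.coe_ennreal_eq_top_iff]
    exact klDiv_ne_top_of_finite hν
  · rw [Ne, EReal.coe_ennreal_eq_top_iff]
    exact ENNReal.mul_ne_top (ENNReal.div_ne_top h1 two_ne_zero) (klDiv_ne_top_of_finite hξ)

/-- No other summand is `-∞`, so one infinite relative entropy decides; the mean degree must be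
positive for the second one to count. -/
lemma explicitPart_eq_top (h0 : meanDeg ρ ≠ 0)
    (h : ¬ (rootLaw ρ ≪ ν ∧ edgeMarkLaw ρ ≪ symmLaw ξ)) : explicitPart ν ξ ρ = ⊤ := by
  have hb : ∀ a : ℝ≥0∞, (a : EReal) ≠ ⊥ := fun a => EReal.coe_ennreal_ne_bot a
  rw [explicitPart]
  rcases not_and_or.1 h with h | h
  · rw [klDiv_of_not_ac h, EReal.coe_ennreal_top, EReal.add_top_of_ne_bot (hb _),
      EReal.top_add_of_ne_bot (hb _), EReal.top_add_of_ne_bot (EReal.coe_ne_bot _)]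
  · rw [klDiv_of_not_ac h, ENNReal.mul_top (ENNReal.div_ne_zero.2 ⟨h0, ENNReal.ofNat_ne_top⟩),
      EReal.coe_ennreal_top, EReal.add_top_of_ne_bot (EReal.add_ne_bot_iff.2 ⟨hb _, hb _⟩),
      EReal.top_add_of_ne_bot (EReal.coe_ne_bot _)]

/-! ### Absolute continuity of the first neighbourhood -/

lemma exists_of_pairMass_ne_zero {i j : ℕ} {p : Branch X Y × Branch X Y}
    (hp : pairMass ρ i j p ≠ 0) {P : MGraph X Y → Prop} (hP : ∀ᵐ τ ∂ρ, P τ) :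
    ∃ τ, P τ ∧ p ∈ ends i j τ := by
  classical
  by_contra hc
  push Not at hc
  refine hp ?_
  rw [pairMass, lintegral_congr_ae (g := 0), lintegral_zero_fun, ENNReal.zero_div]
  filter_upwards [hP] with τ hτ
  have h1 := Multiset.count_eq_zero_of_notMem (hc τ hτ)
  simp only [Pi.zero_apply, Nat.cast_eq_zero]
  convert h1

lemma rootMark_snd_of_mem_ends {τ : MGraph X Y} (hτ : τ.IsTree) {p : Branch X Y × Branch X Y}
    (hp : p ∈ ends 0 0 τ) : rootMark p.2.1 = rootMark τ := by
  rw [hτ.ends_zero] at hp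
  obtain ⟨e, -, rfl⟩ := Multiset.mem_map.1 hp
  exact rootMark_leaf _ _

/-- The mass of a star under the Poisson law is a product, so at an atom of the 1-neighbourhood each
mark has positive reference mass. -/
lemma compatible_of_ac [IsProbabilityMeasure ρ] (hT : OnTrees ρ)
    (h : marginal ρ 1 ≪ poissonStar ν ξ β) : Compatible ν ξ ρ := by
  have h1 : ∀ᵐ τ ∂ρ, τ.IsTree ∧ ν {rootMark τ} ≠ 0 ∧ ∀ e ∈ entries 0 τ,
      ν {(entryMarks e).1} * symmLaw ξ {(entryMarks e).2} ≠ 0 := by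
    filter_upwards [hT, ae_marginal_ne_zero hT 1] with τ hτ hm
    have h2 := poissonStar_singleton (ν := ν) (ξ := ξ) (β := β) (MGraph.IsTree.trunc_mem hτ 1)
    have h3 : poissonStar ν ξ β {trunc 1 τ} * factProd (entries 0 (trunc 1 τ)) ≠ 0 :=
      mul_ne_zero (fun hz => hm (h hz)) (by exact_mod_cast (factProd_pos _).ne')
    rw [h2, MGraph.IsTree.entries_trunc hτ le_rfl, rootMark_trunc] at h3
    refine ⟨hτ, right_ne_zero_of_mul (left_ne_zero_of_mul h3), fun e he hz => ?_⟩
    refine right_ne_zero_of_mul h3 (Multiset.prod_eq_zero ?_)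
    exact Multiset.mem_map.2 ⟨e, he, hz⟩
  refine ⟨h1.mono fun τ hτ => hτ.2.1, fun p hp => ?_⟩
  obtain ⟨τ, ⟨h2, h3, h4⟩, h5⟩ := exists_of_pairMass_ne_zero hp h1
  have h6 := h4 (p.1, p.2.2) (Multiset.mem_map_of_mem (fun p : Branch X Y × Branch X Y =>
    (p.1, p.2.2)) h5)
  refine ⟨left_ne_zero_of_mul h6, ?_, right_ne_zero_of_mul h6⟩
  rwa [rootMark_snd_of_mem_ends h2 h5]

lemma Compatible.ac [IsProbabilityMeasure ρ] (hC : Compatible ν ξ ρ) (hT : OnTrees ρ)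
    (h0 : meanDeg ρ ≠ 0) (h1 : meanDeg ρ ≠ ⊤) (hβ : β ≠ 0) :
    marginal ρ 1 ≪ poissonStar ν ξ β := by
  refine (atomic_marginal hT 1).absolutelyContinuous fun σ hσ hz => ?_
  by_contra hm
  have h2 := poissonStar_singleton (ν := ν) (ξ := ξ) (β := β) hσ
  rw [hz, zero_mul] at h2
  refine mul_ne_zero (mul_ne_zero (mul_ne_zero ?_ ?_) ?_) ?_ h2.symm
  · rw [Ne, ENNReal.ofReal_eq_zero, not_le]
    exact Real.exp_pos _
  · exact pow_ne_zero _ (by exact_mod_cast hβ)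
  · obtain ⟨τ, h3, rfl⟩ := exists_of_marginal_ne_zero hT hm hC.root
    rwa [rootMark_trunc]
  · rw [Ne, Multiset.prod_eq_zero_iff]
    intro h3
    obtain ⟨e, he, h4⟩ := Multiset.mem_map.1 h3
    obtain ⟨p, hp, rfl⟩ := Multiset.mem_map.1 he
    have h5 := hC.edge p (pairMass_ne_zero_of_marginal hT h0 h1 le_rfl (Nat.zero_le 1) hm hp)
    exact mul_ne_zero h5.1 h5.2.2 h4

lemma edgeMarkLaw_eq (hT : OnTrees ρ) (h0 : meanDeg ρ ≠ 0) (h1 : meanDeg ρ ≠ ⊤) (y y' : Y) :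
    edgeMarkLaw ρ {(y, y')} = ∑ x : X, ∑ x' : X, pairMass ρ 0 0 (leaf x y, leaf x' y') := by
  rw [edgeMarkLaw_singleton h0 h1]
  refine Finset.sum_congr rfl fun x _ => Finset.sum_congr rfl fun x' _ => ?_
  rw [covMass_eq]
  exact pairMass_marginal hT le_rfl (Nat.zero_le 1) _

/-- Translates the condition on edges into conditions on the two laws of marks. The root end of an
edge carries the mark of the root; the far end follows from the symmetry of the edge law. -/
lemma compatible_iff [IsProbabilityMeasure ρ] (hT : OnTrees ρ) (hU : Unimodular ρ)
    (h0 : meanDeg ρ ≠ 0) (h1 : meanDeg ρ ≠ ⊤) :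
    Compatible ν ξ ρ ↔ rootLaw ρ ≪ ν ∧ edgeMarkLaw ρ ≪ symmLaw ξ := by
  have hroot : ∀ x, rootLaw ρ {x} = ρ {τ | rootMark τ = x} := fun x => by
    rw [rootLaw, Measure.map_apply measurable_rootMark (measurableSet_singleton _)]
    rfl
  constructor
  · intro hC
    rw [absolutelyContinuous_iff, absolutelyContinuous_iff]
    refine ⟨fun x hx hn => hx ?_, fun ⟨y, y'⟩ hy => ?_⟩
    · rw [hroot, measure_eq_zero_iff_ae_notMem]
      filter_upwards [hC.root] with τ hτ h2
      rw [show rootMark τ = x from h2] at hτ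
      exact hτ hn
    · rw [edgeMarkLaw_eq hT h0 h1] at hy
      obtain ⟨x, -, hx⟩ := Finset.exists_ne_zero_of_sum_ne_zero hy
      obtain ⟨x', -, hx'⟩ := Finset.exists_ne_zero_of_sum_ne_zero hx
      exact (hC.edge _ hx').2.2
  · rintro ⟨hν, hξ⟩
    have h2 : ∀ᵐ τ ∂ρ, ν {rootMark τ} ≠ 0 := by
      have h3 := (atomic_of_finite (rootLaw ρ)).ae_ne_zero
      filter_upwards [ae_of_ae_map measurable_rootMark.aemeasurable h3] with τ hτ
      exact absolutelyContinuous_iff.1 hν _ hτ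
    have h3 : ∀ p, pairMass ρ 0 0 p ≠ 0 → ν {rootMark p.2.1} ≠ 0 := fun p hp => by
      obtain ⟨τ, ⟨h4, h5⟩, h6⟩ := exists_of_pairMass_ne_zero hp (hT.and h2)
      rwa [rootMark_snd_of_mem_ends h4 h6]
    refine ⟨h2, fun p hp => ⟨?_, h3 p hp, absolutelyContinuous_iff.1 hξ _ ?_⟩⟩
    · refine h3 p.swap ?_
      rwa [pairMass_swap hT hU]
    · rw [edgeMarkLaw_eq hT h0 h1]
      have hmem : p.1 ∈ truncBranches X Y 0 ∧ p.2 ∈ truncBranches X Y 0 := by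
        by_contra hc
        exact hp (pairMass_eq_zero hT hc)
      have h4 : p = (leaf (rootMark p.1.1) p.1.2, leaf (rootMark p.2.1) p.2.2) :=
        Prod.ext (eq_leaf_of_mem hmem.1).symm (eq_leaf_of_mem hmem.2).symm
      intro h5
      rw [Finset.sum_eq_zero_iff] at h5
      have h6 := h5 (rootMark p.1.1) (Finset.mem_univ _)
      rw [Finset.sum_eq_zero_iff] at h6
      have h7 := h6 (rootMark p.2.1) (Finset.mem_univ _)
      rw [← h4] at h7
      exact hp h7

end

end

/-! ### The value of the explicit part and the telescoping of `J`. -/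

section

variable {X : Type u} {Y : Type v} [Nonempty Y]

/-! ### The value of the explicit part -/

lemma coe_ennreal_eq_coe_toReal {a : ℝ≥0∞} (ha : a ≠ ⊤) : (a : EReal) = ((a.toReal : ℝ) : EReal) := by
  lift a to ℝ≥0 using ha
  rfl

section

variable [Fintype X] [Fintype Y] [MeasurableSpace X] [MeasurableSpace Y]
  [MeasurableSingletonClass X] [MeasurableSingletonClass Y]
  {ν : Measure X} {ξ : Measure (Y × Y)} [IsProbabilityMeasure ν] [IsProbabilityMeasure ξ]
  {β : ℝ≥0} {ρ : Measure (MGraph X Y)} [IsProbabilityMeasure ρ]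

lemma shannon_add_klDiv_rootLaw (hν : rootLaw ρ ≪ ν) :
    (shannon fun x => rootLaw ρ {x}) + klDiv (rootLaw ρ) ν =
      ∫⁻ τ, surprisal (ν {rootMark τ}) ∂ρ := by
  rw [(atomic_of_finite (rootLaw ρ)).shannon_eq,
    (atomic_of_finite (rootLaw ρ)).add_klDiv (atomic_of_finite ν) hν, rootLaw,
    lintegral_map (measurable_of_finite _) measurable_rootMark]

lemma edgeMean_marks (hT : OnTrees ρ) (h0 : meanDeg ρ ≠ 0) (h1 : meanDeg ρ ≠ ⊤)
    (f : Y × Y → ℝ≥0∞) : edgeMean ρ (fun p => f (p.1.2, p.2.2)) =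
      meanDeg ρ * ∑ q : Y × Y, edgeMarkLaw ρ {q} * f q := by
  rw [edgeMean_eq hT h0 h1]
  congr 1
  simp only [Fintype.sum_prod_type, edgeMarkLaw_eq hT h0 h1, Finset.sum_mul, leaf]
  rw [Finset.sum_comm]
  refine Finset.sum_congr rfl fun y _ => ?_
  rw [Finset.sum_comm (s := (Finset.univ : Finset Y))]
  refine Finset.sum_congr rfl fun x _ => ?_
  rw [Finset.sum_comm]

lemma isProbabilityMeasure_edgeMarkLaw (hT : OnTrees ρ) (h0 : meanDeg ρ ≠ 0)
    (h1 : meanDeg ρ ≠ ⊤) : IsProbabilityMeasure (edgeMarkLaw ρ) := by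
  constructor
  have h := edgeMean_marks hT h0 h1 fun _ => 1
  have h2 : edgeMean ρ (fun _ => 1) = meanDeg ρ := by
    simp only [edgeMean, Multiset.map_const', Multiset.sum_replicate, card_ends, nsmul_eq_mul,
      mul_one, meanDeg]
  simp only [mul_one, sum_measure_singleton, Finset.coe_univ] at h
  rw [h2] at h
  conv_lhs at h => rw [← mul_one (meanDeg ρ)]
  exact ((ENNReal.mul_right_inj h0 h1).1 h).symm

lemma meanDeg_mul_shannon_add_klDiv (hT : OnTrees ρ) (h0 : meanDeg ρ ≠ 0)
    (h1 : meanDeg ρ ≠ ⊤) (hξ : edgeMarkLaw ρ ≪ symmLaw ξ) :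
    meanDeg ρ * ((shannon fun q => edgeMarkLaw ρ {q}) + klDiv (edgeMarkLaw ρ) (symmLaw ξ)) =
      edgeMean ρ fun p => surprisal (symmLaw ξ {(p.1.2, p.2.2)}) := by
  have := isProbabilityMeasure_edgeMarkLaw hT h0 h1
  rw [(atomic_of_finite (edgeMarkLaw ρ)).shannon_eq,
    (atomic_of_finite (edgeMarkLaw ρ)).add_klDiv (atomic_of_finite (symmLaw ξ)) hξ,
    (atomic_of_finite (edgeMarkLaw ρ)).lintegral, tsum_fintype,
    edgeMean_marks hT h0 h1 fun q => surprisal (symmLaw ξ {q})]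

lemma sFun_mul {b : ℝ} (hb : 0 < b) (e : ℝ) :
    sFun (b * e) = e * sFun b + b / 2 * Real.negMulLog e := by
  rcases eq_or_ne e 0 with rfl | he
  · simp [sFun]
  · rw [sFun, sFun, Real.negMulLog, Real.log_mul hb.ne' he]
    ring

/-- `sFun` of a product splits off the entropy of the second factor, so the edge intensities
separate into `β` and the law of the edge marks. -/
lemma sVec_eq (hT : OnTrees ρ) (hβ : meanDeg ρ = β) (hβ0 : β ≠ 0) :
    sVec (edgeIntensity ρ) =
      sFun β + β / 2 * (shannon fun q => edgeMarkLaw ρ {q}).toReal := by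
  have h0 : meanDeg ρ ≠ 0 := by rw [hβ]; exact_mod_cast hβ0
  have h1 : meanDeg ρ ≠ ⊤ := by rw [hβ]; exact ENNReal.coe_ne_top
  have := isProbabilityMeasure_edgeMarkLaw hT h0 h1
  have hpos : (0 : ℝ) < β := by exact_mod_cast pos_iff_ne_zero.2 hβ0
  have h2 : ∀ y y', (edgeIntensity ρ y y').toReal = β * (edgeMarkLaw ρ {(y, y')}).toReal := by
    intro y y'
    rw [edgeMarkLaw_singleton h0 h1, edgeIntensity, ENNReal.toReal_mul, hβ, ENNReal.coe_toReal]
  have h3 : (shannon fun q => edgeMarkLaw ρ {q}).toReal =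
      ∑ q : Y × Y, Real.negMulLog (edgeMarkLaw ρ {q}).toReal := by
    rw [shannon, tsum_fintype, ENNReal.toReal_sum fun _ _ => ENNReal.ofReal_ne_top]
    refine Finset.sum_congr rfl fun q _ => ENNReal.toReal_ofReal ?_
    refine Real.negMulLog_nonneg ENNReal.toReal_nonneg ?_
    exact ENNReal.toReal_le_of_le_ofReal zero_le_one (by simpa using prob_le_one)
  have h4 : ∑ q : Y × Y, (edgeMarkLaw ρ {q}).toReal = 1 := by
    rw [← ENNReal.toReal_sum fun _ _ => measure_ne_top _ _, sum_measure_singleton,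
      Finset.coe_univ, measure_univ, ENNReal.toReal_one]
  rw [sVec, ← Fintype.sum_prod_type' fun y y' => sFun (edgeIntensity ρ y y').toReal, h3]
  simp only [h2, sFun_mul hpos]
  rw [Finset.sum_add_distrib, ← Finset.sum_mul, ← Finset.mul_sum, h4, one_mul]

/-- Entropies and relative entropies combine to the cross entropies of root marks and of edge marks;
the entropy of the edge marks is the one hidden in `sVec`. -/
lemma explicitPart_eq (hT : OnTrees ρ) (hU : Unimodular ρ) (hβ : meanDeg ρ = β) (hβ0 : β ≠ 0)
    (hC : Compatible ν ξ ρ) : explicitPart ν ξ ρ =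
      ((sFun β + (∫⁻ τ, surprisal (ν {rootMark τ}) ∂ρ).toReal +
        (edgeMean ρ fun p => surprisal (symmLaw ξ {(p.1.2, p.2.2)})).toReal / 2 : ℝ) : EReal) := by
  have h0 : meanDeg ρ ≠ 0 := by rw [hβ]; exact_mod_cast hβ0
  have h1 : meanDeg ρ ≠ ⊤ := by rw [hβ]; exact ENNReal.coe_ne_top
  obtain ⟨hν, hξ⟩ := (compatible_iff hT hU h0 h1).1 hC
  have := isProbabilityMeasure_edgeMarkLaw hT h0 h1
  have hA := shannon_ne_top_of_finite fun x => rootLaw ρ {x}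
  have hB := klDiv_ne_top_of_finite hν
  have hD := shannon_ne_top_of_finite fun q => edgeMarkLaw ρ {q}
  have hE := klDiv_ne_top_of_finite hξ
  rw [explicitPart, sVec_eq hT hβ hβ0, ← shannon_add_klDiv_rootLaw hν,
    ← meanDeg_mul_shannon_add_klDiv hT h0 h1 hξ, coe_ennreal_eq_coe_toReal hA,
    coe_ennreal_eq_coe_toReal hB, coe_ennreal_eq_coe_toReal (ENNReal.mul_ne_top
    (ENNReal.div_ne_top h1 two_ne_zero) hE), hβ, ENNReal.toReal_mul, ENNReal.toReal_mul,
    ENNReal.toReal_div, ENNReal.toReal_add hA hB, ENNReal.toReal_add hD hE, ENNReal.coe_toReal,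
    ENNReal.toReal_ofNat]
  norm_cast
  push_cast
  ring

end

/-! ### The functional at the marginals -/

section

variable [Finite X] [Finite Y] {ρ : Measure (MGraph X Y)} [IsProbabilityMeasure ρ]

lemma J_marginal (hT : OnTrees ρ) (hU : Unimodular ρ) (hL : degLogMoment ρ < ⊤) (k : ℕ) :
    J (meanDeg ρ) (k + 1) (marginal ρ (k + 1)) =
      -((sFun (meanDeg ρ).toReal : ℝ) : EReal) +
        ((shannon fun σ => marginal ρ (k + 1) {σ} : ℝ≥0∞) : EReal)
      - ((meanDeg ρ * shannon (pairMass ρ k k) / 2 : ℝ≥0∞) : EReal)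
      - ((countEntropy ρ k : ℝ≥0∞) : EReal) := by
  have hA : Admissible (k + 1) (marginal ρ (k + 1)) := fun p => by
    rw [edgeMass_eq (atomic_marginal hT _), edgeMass_eq (atomic_marginal hT _)]
    simp only [Nat.add_sub_cancel]
    rw [pairMass_marginal hT le_rfl (Nat.le_succ k), pairMass_marginal hT le_rfl (Nat.le_succ k),
      pairMass_swap hT hU]
  have hc : covMass (k + 1) (marginal ρ (k + 1)) = pairMass ρ k k := funext fun p => by
    rw [covMass_eq]
    exact pairMass_marginal hT le_rfl (Nat.le_succ k) p
  rw [J, if_pos ⟨onTrees_of_atomic (atomic_marginal hT _), meanDeg_marginal hT k, hA, by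
    rwa [degLogMoment_marginal hT]⟩, hc, tsum_lintegral_log_factorial hT, ENNReal.mul_div_right_comm]

lemma J_marginal_eq_bot (hT : OnTrees ρ) (hL : degLogMoment ρ = ⊤) (b : ℝ≥0∞) (k : ℕ) :
    J b (k + 1) (marginal ρ (k + 1)) = ⊥ := by
  rw [J, if_neg]
  rintro ⟨-, -, -, h⟩
  rw [degLogMoment_marginal hT, hL] at h
  exact lt_irrefl _ h

/-- Half the sum of the two balances, in which `W` cancels. If `P'` is infinite, then either `P` is
infinite already, or one of the two balances forces its relative entropy to be infinite. -/
lemma ereal_step {s : ℝ} {H H' P P' W F F' K K' : ℝ≥0∞} (hH : H ≠ ⊤) (hH' : H' ≠ ⊤) (hF : F ≠ ⊤)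
    (hF' : F' ≠ ⊤) (h1 : H' + K + F + P = H + F' + W) (h2 : H' + K' + F + W = H + F' + P')
    (hP : P ≤ W) (hW : W ≤ P') :
    -(s : EReal) + (H' : EReal) - ((P' / 2 : ℝ≥0∞) : EReal) - (F' : EReal) =
      -(s : EReal) + (H : EReal) - ((P / 2 : ℝ≥0∞) : EReal) - (F : EReal)
        - ((2⁻¹ * (K + K') : ℝ≥0∞) : EReal) := by
  have htop : ((⊤ : ℝ≥0∞) / 2) = ⊤ := ENNReal.top_div_of_ne_top ENNReal.ofNat_ne_top
  by_cases hP' : P' = ⊤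
  · subst hP'
    have hl : -(s : EReal) + (H' : EReal) - ((⊤ / 2 : ℝ≥0∞) : EReal) - (F' : EReal) = ⊥ := by
      rw [htop, EReal.coe_ennreal_top, sub_eq_add_neg _ (⊤ : EReal), EReal.neg_top, EReal.add_bot,
        sub_eq_add_neg, EReal.bot_add]
    rw [hl]
    by_cases hPt : P = ⊤
    · rw [hPt, htop, EReal.coe_ennreal_top, sub_eq_add_neg _ (⊤ : EReal), EReal.neg_top,
        EReal.add_bot]
      simp only [sub_eq_add_neg, EReal.bot_add]
    -- With `P` finite and `P'` infinite, the infinity first appears at `W`, which forces `K` to be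
    -- infinite, or at `P'`, which forces `K'` to be infinite.
    · have hK : K + K' = ⊤ := by
        by_cases hWt : W = ⊤
        · rw [hWt, add_top] at h1
          simp only [ENNReal.add_eq_top, hH', hF, hPt, or_false, false_or] at h1
          rw [h1, top_add]
        · rw [add_top] at h2
          simp only [ENNReal.add_eq_top, hH', hF, hWt, or_false, false_or] at h2
          rw [h2, add_top]
      rw [hK, ENNReal.mul_top (ENNReal.inv_ne_zero.2 ENNReal.ofNat_ne_top), EReal.coe_ennreal_top,
        sub_eq_add_neg _ (⊤ : EReal), EReal.neg_top, EReal.add_bot]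
  · have hWt : W ≠ ⊤ := ne_top_of_le_ne_top hP' hW
    have hPt : P ≠ ⊤ := ne_top_of_le_ne_top hWt hP
    have hK : K ≠ ⊤ := fun h => by
      rw [h, add_top, top_add, top_add] at h1
      exact ENNReal.add_ne_top.2 ⟨ENNReal.add_ne_top.2 ⟨hH, hF'⟩, hWt⟩ h1.symm
    have hK' : K' ≠ ⊤ := fun h => by
      rw [h, add_top, top_add, top_add] at h2
      exact ENNReal.add_ne_top.2 ⟨ENNReal.add_ne_top.2 ⟨hH, hF'⟩, hP'⟩ h2.symm
    lift H to ℝ≥0 using hH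
    lift H' to ℝ≥0 using hH'
    lift P to ℝ≥0 using hPt
    lift P' to ℝ≥0 using hP'
    lift W to ℝ≥0 using hWt
    lift F to ℝ≥0 using hF
    lift F' to ℝ≥0 using hF'
    lift K to ℝ≥0 using hK
    lift K' to ℝ≥0 using hK'
    have h3 : (H' : ℝ) + K + F + P = H + F' + W := by exact_mod_cast h1
    have h4 : (H' : ℝ) + K' + F + W = H + F' + P' := by exact_mod_cast h2
    rw [coe_ennreal_eq_coe_toReal (a := (P' : ℝ≥0∞) / 2) (by finiteness),
      coe_ennreal_eq_coe_toReal (a := (P : ℝ≥0∞) / 2) (by finiteness),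
      coe_ennreal_eq_coe_toReal (a := 2⁻¹ * ((K : ℝ≥0∞) + K')) (by finiteness),
      coe_ennreal_eq_coe_toReal (a := (H : ℝ≥0∞)) (by finiteness),
      coe_ennreal_eq_coe_toReal (a := (H' : ℝ≥0∞)) (by finiteness),
      coe_ennreal_eq_coe_toReal (a := (F : ℝ≥0∞)) (by finiteness),
      coe_ennreal_eq_coe_toReal (a := (F' : ℝ≥0∞)) (by finiteness)]
    rw [ENNReal.toReal_div, ENNReal.toReal_div, ENNReal.toReal_mul, ENNReal.toReal_inv,
      ENNReal.toReal_add (by finiteness) (by finiteness)]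
    simp only [ENNReal.coe_toReal, ENNReal.toReal_ofNat]
    norm_cast
    push_cast
    linarith

/-- Excluding `∞ - ∞` even makes every entropy finite: if the edge entropy is finite,
`check_balance` bounds the entropy at the next depth by finite terms, starting from depth one. -/
lemma shannon_marginal_ne_top (hT : OnTrees ρ) (hU : Unimodular ρ) (h0 : meanDeg ρ ≠ 0)
    (h1 : meanDeg ρ ≠ ⊤) [Nonempty X] (hL : degLogMoment ρ < ⊤) (hE : EntropyDefined ρ) (k : ℕ) :
    (shannon fun σ => marginal ρ (k + 1) {σ}) ≠ ⊤ := by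
  have := Fintype.ofFinite X
  have := Fintype.ofFinite Y
  induction k with
  | zero => exact shannon_marginal_one_ne_top hT h1
  | succ k ih =>
    rcases hE hL (k + 2) (by omega) with h | h
    · exact h.ne
    · have hc : covMass (k + 2) (marginal ρ (k + 2)) = pairMass ρ (k + 1) (k + 1) :=
        funext fun p => by
          rw [covMass_eq]
          exact pairMass_marginal hT le_rfl (Nat.le_succ _) p
      rw [hc] at h
      have h2 := check_balance (j := k) hT hU h0 h1
      have h3 : meanDeg ρ * shannon (pairMass ρ k (k + 1)) ≠ ⊤ :=
        ne_top_of_le_ne_top (ENNReal.mul_ne_top h1 h.ne)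
          (shannon_pairMass_mono hT h0 h1 (Nat.le_succ k) le_rfl)
      have h4 : countEntropy ρ (k + 1) ≠ ⊤ := ne_top_of_le_ne_top hL.ne (countEntropy_le ρ _)
      intro h5
      change (shannon fun σ => marginal ρ (k + 2) {σ}) = ⊤ at h5
      rw [h5, top_add, top_add, top_add] at h2
      exact ENNReal.add_ne_top.2 ⟨ENNReal.add_ne_top.2 ⟨ih, h4⟩, h3⟩ h2.symm

lemma J_step (hT : OnTrees ρ) (hU : Unimodular ρ) (h0 : meanDeg ρ ≠ 0)
    (h1 : meanDeg ρ ≠ ⊤) [Nonempty X] (hE : EntropyDefined ρ) (k : ℕ) :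
    J (meanDeg ρ) (k + 2) (marginal ρ (k + 2)) =
      J (meanDeg ρ) (k + 1) (marginal ρ (k + 1)) -
        ((2⁻¹ * (klDiv (marginal ρ (k + 2)) (checkLaw ρ (k + 2)) +
          klDiv (marginal ρ (k + 2)) (hatLaw ρ (k + 2))) : ℝ≥0∞) : EReal) := by
  rcases eq_or_lt_of_le (le_top : degLogMoment ρ ≤ ⊤) with hL | hL
  · rw [J_marginal_eq_bot hT hL, J_marginal_eq_bot hT hL, sub_eq_add_neg, EReal.bot_add]
  · rw [J_marginal hT hU hL, J_marginal hT hU hL]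
    exact ereal_step (shannon_marginal_ne_top hT hU h0 h1 hL hE k)
      (shannon_marginal_ne_top hT hU h0 h1 hL hE (k + 1))
      (ne_top_of_le_ne_top hL.ne (countEntropy_le ρ _))
      (ne_top_of_le_ne_top hL.ne (countEntropy_le ρ _)) (check_balance hT hU h0 h1)
      (hat_balance hT hU h0 h1) (shannon_pairMass_mono hT h0 h1 le_rfl (Nat.le_succ k))
      (shannon_pairMass_mono hT h0 h1 (Nat.le_succ k) le_rfl)

lemma J_one_ne_top (hT : OnTrees ρ) (hU : Unimodular ρ) (h1 : meanDeg ρ ≠ ⊤) [Nonempty X] :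
    J (meanDeg ρ) 1 (marginal ρ 1) ≠ ⊤ := by
  have := Fintype.ofFinite X
  have := Fintype.ofFinite Y
  rcases eq_or_lt_of_le (le_top : degLogMoment ρ ≤ ⊤) with hL | hL
  · rw [J_marginal_eq_bot hT hL (meanDeg ρ) 0]
    exact bot_ne_top
  · rw [J_marginal hT hU hL 0, sub_eq_add_neg, sub_eq_add_neg, ← EReal.coe_neg,
      coe_ennreal_eq_coe_toReal (shannon_marginal_one_ne_top hT h1), ← EReal.coe_add]
    refine EReal.add_ne_top (EReal.add_ne_top (EReal.coe_ne_top _) ?_) ?_ <;>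
    · rw [Ne, EReal.neg_eq_top_iff]
      exact EReal.coe_ennreal_ne_bot _

end

/-! ### The first neighbourhood -/

/-- Half the sum of the two balances at depth one, in which `M` and `S` cancel. The condition on `s`
expresses `β - β log β` through the two capped numbers. -/
lemma ereal_base {s : ℝ} {H K K' D M B N F U S Z P : ℝ≥0∞} (hH : H ≠ ⊤) (hD : D ≠ ⊤) (hM : M ≠ ⊤)
    (hB : B ≠ ⊤) (hN : N ≠ ⊤) (hF : F ≠ ⊤) (hU : U ≠ ⊤) (hS : S ≠ ⊤) (hZ : Z ≠ ⊤) (hP : P ≠ ⊤)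
    (h1 : H + K + (D + M) = B + N + F + (U + (S + Z)))
    (h2 : H + K' + (D + S) = B + N + F + (U + (P + M)))
    (hs : 2 * s = B.toReal + U.toReal - D.toReal) :
    -(s : EReal) + (H : EReal) - ((P / 2 : ℝ≥0∞) : EReal) - (F : EReal) =
      ((s + N.toReal + Z.toReal / 2 : ℝ) : EReal) - ((2⁻¹ * (K + K') : ℝ≥0∞) : EReal) := by
  have hK : K ≠ ⊤ := fun h => by
    rw [h, add_top, top_add] at h1
    exact (by finiteness : B + N + F + (U + (S + Z)) ≠ ⊤) h1.symm
  have hK' : K' ≠ ⊤ := fun h => by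
    rw [h, add_top, top_add] at h2
    exact (by finiteness : B + N + F + (U + (P + M)) ≠ ⊤) h2.symm
  lift H to ℝ≥0 using hH
  lift K to ℝ≥0 using hK
  lift K' to ℝ≥0 using hK'
  lift D to ℝ≥0 using hD
  lift M to ℝ≥0 using hM
  lift B to ℝ≥0 using hB
  lift N to ℝ≥0 using hN
  lift F to ℝ≥0 using hF
  lift U to ℝ≥0 using hU
  lift S to ℝ≥0 using hS
  lift Z to ℝ≥0 using hZ
  lift P to ℝ≥0 using hP
  have h3 : (H : ℝ) + K + (D + M) = B + N + F + (U + (S + Z)) := by exact_mod_cast h1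
  have h4 : (H : ℝ) + K' + (D + S) = B + N + F + (U + (P + M)) := by exact_mod_cast h2
  rw [coe_ennreal_eq_coe_toReal (a := (P : ℝ≥0∞) / 2) (by finiteness),
    coe_ennreal_eq_coe_toReal (a := 2⁻¹ * ((K : ℝ≥0∞) + K')) (by finiteness),
    coe_ennreal_eq_coe_toReal (a := (H : ℝ≥0∞)) (by finiteness),
    coe_ennreal_eq_coe_toReal (a := (F : ℝ≥0∞)) (by finiteness)]
  rw [ENNReal.toReal_div, ENNReal.toReal_mul, ENNReal.toReal_inv,
    ENNReal.toReal_add (by finiteness) (by finiteness)]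
  simp only [ENNReal.coe_toReal, ENNReal.toReal_ofNat] at hs ⊢
  norm_cast
  push_cast
  linarith

section

variable [Fintype X] [Fintype Y] [Nonempty X] [MeasurableSpace X] [MeasurableSpace Y]
  [MeasurableSingletonClass X] [MeasurableSingletonClass Y]
  {ν : Measure X} {ξ : Measure (Y × Y)} [IsProbabilityMeasure ν] [IsProbabilityMeasure ξ]
  {β : ℝ≥0} {ρ : Measure (MGraph X Y)} [IsProbabilityMeasure ρ]

/-- If `degLogMoment` is infinite, both sides are `-∞`: `countEntropy ρ 0` is infinite, and in
`checkOne_balance` only the relative entropy can compensate for it. Otherwise `ereal_base` applies.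
-/
lemma J_one_eq (hT : OnTrees ρ) (hU : Unimodular ρ) (hβ : meanDeg ρ = β) (hβ0 : β ≠ 0)
    (hC : Compatible ν ξ ρ) : J (meanDeg ρ) 1 (marginal ρ 1) = explicitPart ν ξ ρ -
      ((2⁻¹ * (klDiv (marginal ρ 1) (checkOne (poissonStar ν ξ β) (marginal ρ 1)) +
        klDiv (marginal ρ 1) (hatOne (poissonStar ν ξ β) (marginal ρ 1))) : ℝ≥0∞) : EReal) := by
  have h0 : meanDeg ρ ≠ 0 := by rw [hβ]; exact_mod_cast hβ0
  have h1 : meanDeg ρ ≠ ⊤ := by rw [hβ]; exact ENNReal.coe_ne_top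
  have hb1 := checkOne_balance hT h0 h1 hC hβ0
  have hb2 := hatOne_balance hT hU h0 h1 hC hβ0
  have hH := shannon_marginal_one_ne_top hT h1
  have hD : meanDeg ρ * surprisal (capDen β) ≠ ⊤ := ENNReal.mul_ne_top h1 (surprisal_ne_top _)
  have hM := edgeMean_ne_top hT h0 h1 fun p => surprisal_ne_top (markLaw ξ p.1.2)
  rcases eq_or_lt_of_le (le_top : degLogMoment ρ ≤ ⊤) with hL | hL
  · have hF : countEntropy ρ 0 = ⊤ := by
      have h2 := degLogMoment_le hT
      rw [hL, top_le_iff, ENNReal.add_eq_top] at h2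
      exact h2.resolve_right (ENNReal.mul_ne_top h1 ENNReal.ofReal_ne_top)
    rw [hF, add_top, top_add] at hb1
    simp only [ENNReal.add_eq_top, hH, hD, hM, or_false, false_or] at hb1
    rw [J_marginal_eq_bot hT hL (meanDeg ρ) 0, hb1, top_add,
      ENNReal.mul_top (ENNReal.inv_ne_zero.2 ENNReal.ofNat_ne_top), EReal.coe_ennreal_top,
      sub_eq_add_neg, EReal.neg_top, EReal.add_bot]
  · have hν := ((compatible_iff hT hU h0 h1).1 hC).1
    have hN : ∫⁻ τ, surprisal (ν {rootMark τ}) ∂ρ ≠ ⊤ := by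
      rw [← shannon_add_klDiv_rootLaw hν]
      exact ENNReal.add_ne_top.2 ⟨shannon_ne_top_of_finite _, klDiv_ne_top_of_finite hν⟩
    have hP : meanDeg ρ * shannon (pairMass ρ 0 0) ≠ ⊤ := by
      rw [← edgeMean_pairMass hT h0 h1]
      exact edgeMean_ne_top hT h0 h1 fun _ => surprisal_ne_top _
    rw [J_marginal hT hU hL 0, explicitPart_eq hT hU hβ hβ0 hC]
    have hs : 2 * sFun (meanDeg ρ).toReal = (β : ℝ≥0∞).toReal +
        (meanDeg ρ * surprisal (capNum β)).toReal - (meanDeg ρ * surprisal (capDen β)).toReal := by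
      rw [ENNReal.toReal_mul, ENNReal.toReal_mul, surprisal_cap hβ0, hβ, ENNReal.coe_toReal, sFun]
      ring
    have h2 := ereal_base hH hD hM ENNReal.coe_ne_top hN
      (ne_top_of_le_ne_top hL.ne (countEntropy_le ρ 0))
      (ENNReal.mul_ne_top h1 (surprisal_ne_top _))
      (edgeMean_ne_top hT h0 h1 fun p => surprisal_ne_top (leafMass ρ p.1))
      (edgeMean_ne_top hT h0 h1 fun p => surprisal_ne_top (symmLaw ξ {(p.1.2, p.2.2)})) hP hb1 hb2 hs
    rw [show sFun (meanDeg ρ).toReal = sFun β by rw [hβ, ENNReal.coe_toReal]] at h2 ⊢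
    exact h2

end

/-! ### The limit -/

lemma ereal_sub_sub (a : EReal) (b c : ℝ≥0∞) :
    a - (b : EReal) - (c : EReal) = a - ((b + c : ℝ≥0∞) : EReal) := by
  rw [EReal.coe_ennreal_add, sub_eq_add_neg, sub_eq_add_neg, sub_eq_add_neg, EReal.neg_add
    (Or.inl (EReal.coe_ennreal_ne_bot _)) (Or.inr (EReal.coe_ennreal_ne_bot _)), sub_eq_add_neg,
    add_assoc]

/-- Since `a` is not `⊤`, the indeterminate form `⊤ - ⊤` cannot arise, also when the limit is
infinite. -/
lemma tendsto_ereal_sub {a : EReal} (ha : a ≠ ⊤) {d : ℕ → ℝ≥0∞} {l : ℝ≥0∞}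
    (hd : Tendsto d atTop (𝓝 l)) :
    Tendsto (fun n => a - (d n : EReal)) atTop (𝓝 (a - (l : EReal))) := by
  simp only [sub_eq_add_neg]
  by_cases hb : a = ⊥
  · simp only [hb, EReal.bot_add]
    exact tendsto_const_nhds
  · have h1 : Tendsto (fun n => -(d n : EReal)) atTop (𝓝 (-(l : EReal))) :=
      (continuous_neg.tendsto _).comp ((continuous_coe_ennreal_ereal.tendsto _).comp hd)
    exact (EReal.continuousAt_add (Or.inl ha) (Or.inl hb)).tendsto.comp
      (tendsto_const_nhds.prodMk_nhds h1)

section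

variable [Finite X] [Finite Y] [Nonempty X] {ρ : Measure (MGraph X Y)} [IsProbabilityMeasure ρ]

/-- The contribution of the `k + 2`-neighbourhood to the rate function. -/
def rateTerm (ρ : Measure (MGraph X Y)) (k : ℕ) : ℝ≥0∞ :=
  klDiv (marginal ρ (k + 2)) (checkLaw ρ (k + 2)) + klDiv (marginal ρ (k + 2)) (hatLaw ρ (k + 2))

lemma J_eq_sub_sum (hT : OnTrees ρ) (hU : Unimodular ρ) (h0 : meanDeg ρ ≠ 0)
    (h1 : meanDeg ρ ≠ ⊤) (hE : EntropyDefined ρ) (n : ℕ) :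
    J (meanDeg ρ) (n + 1) (marginal ρ (n + 1)) = J (meanDeg ρ) 1 (marginal ρ 1) -
      ((∑ k ∈ Finset.range n, 2⁻¹ * rateTerm ρ k : ℝ≥0∞) : EReal) := by
  induction n with
  | zero => simp
  | succ n ih =>
    rw [Finset.sum_range_succ, ← ereal_sub_sub, ← ih]
    exact J_step hT hU h0 h1 hE n

lemma tendsto_J (hT : OnTrees ρ) (hU : Unimodular ρ) (h0 : meanDeg ρ ≠ 0)
    (h1 : meanDeg ρ ≠ ⊤) (hE : EntropyDefined ρ) :
    Tendsto (fun h : ℕ => J (meanDeg ρ) h (marginal ρ h)) atTop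
      (𝓝 (J (meanDeg ρ) 1 (marginal ρ 1) - ((2⁻¹ * ∑' k, rateTerm ρ k : ℝ≥0∞) : EReal))) := by
  -- Depth zero is skipped: the formulas for `J` at the marginals start at depth one.
  rw [← tendsto_add_atTop_iff_nat 1, ← ENNReal.tsum_mul_left]
  exact (tendsto_ereal_sub (J_one_ne_top hT hU h1) (ENNReal.tendsto_nat_tsum _)).congr fun n =>
    (J_eq_sub_sum hT hU h0 h1 hE n).symm

end

end

end MarkedTree

end

/-! ### Proof of the corollary. -/

open MarkedTree

theorem corollary7p12 {X Y : Type*} [Fintype X] [Fintype Y] [Nonempty X] [Nonempty Y]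
    [MeasurableSpace X] [MeasurableSingletonClass X]
    [MeasurableSpace Y] [MeasurableSingletonClass Y]
    (ν : MeasureTheory.Measure X) [MeasureTheory.IsProbabilityMeasure ν]
    (ξ : MeasureTheory.Measure (Y × Y)) [MeasureTheory.IsProbabilityMeasure ξ]
    (ρ : MeasureTheory.Measure (MarkedTree.MGraph X Y)) [MeasureTheory.IsProbabilityMeasure ρ]
    (β : ℝ≥0∞) (hβ : β = MarkedTree.meanDeg ρ) (hpos : 0 < β) (hfin : β < ⊤)
    -- the defining expression of the microstate entropy is never of the form `∞ - ∞`
    (hdef : MarkedTree.UnimodularTree β ρ → MarkedTree.EntropyDefined ρ) :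
    -- the limit in the definition of the microstate entropy exists
    (MarkedTree.UnimodularTree β ρ →
      Filter.Tendsto (fun h : ℕ => MarkedTree.J β h (MarkedTree.marginal ρ h)) Filter.atTop
        (𝓝 (MarkedTree.microstateEntropy (MarkedTree.edgeIntensity ρ)
          (MarkedTree.rootLaw ρ) ρ))) ∧
    -- the formula, whenever its right-hand side is not of the form `∞ - ∞`
    (MarkedTree.rootLaw ρ ≪ ν → MarkedTree.edgeMarkLaw ρ ≪ MarkedTree.symmLaw ξ →
      MarkedTree.explicitPart ν ξ ρ ≠ ⊤ ∧
      MarkedTree.microstateEntropy (MarkedTree.edgeIntensity ρ) (MarkedTree.rootLaw ρ) ρ =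
        MarkedTree.explicitPart ν ξ ρ -
          ((MarkedTree.rate ν β (MarkedTree.poissonStar ν ξ β.toNNReal) ρ : ℝ≥0∞) : EReal)) ∧
    -- the rearranged formula, without exception
    (MarkedTree.microstateEntropy (MarkedTree.edgeIntensity ρ) (MarkedTree.rootLaw ρ) ρ ≠ ⊤ ∧
      ((MarkedTree.rate ν β (MarkedTree.poissonStar ν ξ β.toNNReal) ρ : ℝ≥0∞) : EReal) =
        MarkedTree.explicitPart ν ξ ρ -
          MarkedTree.microstateEntropy (MarkedTree.edgeIntensity ρ)
            (MarkedTree.rootLaw ρ) ρ) := by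
  have h0 : meanDeg ρ ≠ 0 := hβ ▸ hpos.ne'
  have h1 : meanDeg ρ ≠ ⊤ := hβ ▸ hfin.ne
  have hb : meanDeg ρ = (β.toNNReal : ℝ≥0∞) := by rw [ENNReal.coe_toNNReal hfin.ne, hβ]
  have hb0 : β.toNNReal ≠ 0 := fun h => h0 (by rw [hb, h, ENNReal.coe_zero])
  by_cases hUT : UnimodularTree β ρ
  · obtain ⟨hT, hU, -⟩ := id hUT
    have hlim := tendsto_J hT hU h0 h1 (hdef hUT)
    have hS : microstateEntropy (edgeIntensity ρ) (rootLaw ρ) ρ =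
        J (meanDeg ρ) 1 (marginal ρ 1) - ((2⁻¹ * ∑' k, rateTerm ρ k : ℝ≥0∞) : EReal) := by
      rw [microstateEntropy, if_pos ⟨hβ ▸ hpos, hβ ▸ hfin, ⟨hT, hU, rfl⟩, rfl, rfl⟩,
        hlim.limsup_eq]
    have hStop : microstateEntropy (edgeIntensity ρ) (rootLaw ρ) ρ ≠ ⊤ := by
      rw [hS, sub_eq_add_neg]
      refine EReal.add_ne_top (J_one_ne_top hT hU h1) ?_
      rw [Ne, EReal.neg_eq_top_iff]
      exact EReal.coe_ennreal_ne_bot _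
    refine ⟨fun _ => by rw [hS, hβ]; exact hlim, ?_⟩
    by_cases hac : marginal ρ 1 ≪ poissonStar ν ξ β.toNNReal
    · have hC : Compatible ν ξ ρ := compatible_of_ac hT hac
      obtain ⟨hν, hξ⟩ := (compatible_iff hT hU h0 h1).1 hC
      have htop := explicitPart_ne_top h0 h1 hν hξ
      have hform : microstateEntropy (edgeIntensity ρ) (rootLaw ρ) ρ = explicitPart ν ξ ρ -
          ((rate ν β (poissonStar ν ξ β.toNNReal) ρ : ℝ≥0∞) : EReal) := by
        rw [hS, J_one_eq hT hU hb hb0 hC, ereal_sub_sub, rate,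
          if_neg fun h => hpos.ne' h.1, if_pos ⟨hpos, hUT, hac⟩, ← mul_add]
        rfl
      refine ⟨fun _ _ => ⟨htop, hform⟩, hStop, ?_⟩
      rw [hform]
      have hbot := explicitPart_ne_bot ν ξ ρ
      generalize explicitPart ν ξ ρ = E at htop hbot
      generalize rate ν β (poissonStar ν ξ β.toNNReal) ρ = r
      -- Only because the explicit part is real can the formula be solved for the rate, also when
      -- the rate is infinite.
      lift E to ℝ using ⟨htop, hbot⟩
      induction r with
      | top => simp [sub_eq_add_neg]
      | coe r =>
        rw [coe_ennreal_eq_coe_toReal ENNReal.coe_ne_top]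
        norm_cast
        ring
    -- Without absolute continuity at depth one some mark has reference mass zero, so the second
    -- claim is vacuous and both sides of the third are `⊤`.
    · have hn : ¬ (rootLaw ρ ≪ ν ∧ edgeMarkLaw ρ ≪ symmLaw ξ) := fun h =>
        hac (((compatible_iff hT hU h0 h1).2 h).ac hT h0 h1 hb0)
      refine ⟨fun hν hξ => absurd ⟨hν, hξ⟩ hn, hStop, ?_⟩
      rw [explicitPart_eq_top h0 hn, rate, if_neg fun h => hpos.ne' h.1, if_neg fun h => hac h.2.2,
        EReal.coe_ennreal_top, sub_eq_add_neg, EReal.top_add_of_ne_bot]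
      rwa [Ne, EReal.neg_eq_bot_iff]
  -- For laws that are not unimodular on trees both functionals take their default values, `⊥` and
  -- `⊤`, and the formulas reduce to the explicit part not being `⊥`, and not `⊤` in the second
  -- claim.
  · have hS : microstateEntropy (edgeIntensity ρ) (rootLaw ρ) ρ = ⊥ := by
      rw [microstateEntropy, if_neg fun h => hUT (hβ ▸ h.2.2.1)]
    have hr : rate ν β (poissonStar ν ξ β.toNNReal) ρ = ⊤ := by
      rw [rate, if_neg fun h => hpos.ne' h.1, if_neg fun h => hUT h.2.1]
    rw [hS, hr, EReal.coe_ennreal_top]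
    refine ⟨fun h => absurd h hUT, fun hν hξ => ⟨explicitPart_ne_top h0 h1 hν hξ, ?_⟩,
      bot_ne_top, ?_⟩
    · rw [sub_eq_add_neg, EReal.neg_top, EReal.add_bot]
    · rw [sub_eq_add_neg, EReal.neg_bot, EReal.add_top_of_ne_bot (explicitPart_ne_bot ν ξ ρ)]
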